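/- **Setting.** An instance of weighted flow time consists of jobs $j=1,\dots,n$ with release times $r_j$, processing times $p_j$ and weights $w_j$ (natural numbers). A preemptive schedule on one machine runs at most one job at each time; if job $j$ has received $p_j$ units of processing in $[r_j,C_j)$ for each $j$, its cost is $\sum_j w_j(C_j-r_j)$; the goal is to minimize this. Put $P=\max_jp_j$ and $T=\max_jr_j+\sum_jp_j$. Instances are normalized: $\min_jr_j=0$, $\max_jr_j\le\sum_jp_j$, $\min_jp_j=1$, $1\le w_j\le A\,n^2P$ for a constant $A$ (which may depend on $\epsilon$), and $nP\ge2$. In parts 1 and 2, $1/\epsilon\ge2$ is an integer and the jobs are labelled so that $r_1\le\dots\le r_n$. *Grid.* Let $K=(2/\epsilon)^{1/\epsilon}$, let $\ell_{\max}$ be the least $k$ with $K^{k-2}\ge T$, and let the offsets $\mathrm{off}_y\in\{(2/\epsilon)^0,\dots,(2/\epsilon)^{1/\epsilon-1}\}$ and $\mathrm{off}_x\in\{-K^{\ell_{\max}-1}+1,\dots,0\}$ be arbitrary. The root cell (level $0$) is $[\mathrm{off}_x,\mathrm{off}_x+\mathrm{off}_yK^{\ell_{\max}})$; each cell of level $\ell<\ell_{\max}$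 is divided into $K$ child cells of equal length of level $\ell+1$. Let $\mathcal C$ be the set of cells. *Segments.* For a job $j$ let $C_{\ell_{\max}}$ be the cell of level $\ell_{\max}$ that contains $r_j$, and for $k=\ell_{\max}-1,\dots,0$ let $C_k$ be the cell of level $k$ that contains the right end point of $C_{k+1}$. The interval from the right end of $C_{k+1}$ (from $r_j$ if $k=\ell_{\max}$) to the right end of $C_k$ is divided into segments of length $\mathrm{off}_yK^{\ell_{\max}-k-2}$ if $k\le\ell_{\max}-2$, and of length $1$ otherwise. They form $\mathrm{Seg}(j,C_k)$; $\mathrm{Seg}(j,C)=\emptyset$ for all other cells $C$. Each segment $S\in\mathrm{Seg}(j,C)$ gives a rectangle $R(j,S)=S\times[j,j+1)$ in $\mathcal R(j,C)$, with capacity $p_j$ and cost $w_j(\mathrm{end}(S)-r_j)$ if $S$ is the first segment of $\mathrm{Seg}(j,C)$, and $w_j\,\mathrm{len}(S)$ otherwise. Let $\mathcal R(C)=\bigcup_j\mathcal R(j,C)$ and $\mathcal R=\bigcup_C\mathcal R(C)$. Write $p(\cdot)$ and $c(\cdot)$ for total capacity and total cost. *Covering problem (IP2).* For integers $0\le s\le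 t\le T$ and $I=[s,t]$ let $d(I)=\sum_{j:s\le r_j\le t}p_j-(t-s)$. A set $X\subseteq\mathcal R$ is feasible if for each such $I$ the rectangles $R(j,S)\in X$ with $s\le r_j\le t$ and $t\in S$ have total capacity at least $d(I)$, and if $X$ contains a prefix (from the left) of each $\mathcal R(j,C)$. $\mathrm{OPT}^{(\mathrm{IP2})}$ is the least cost of a feasible set. *Consistent solutions.* Let $\mathcal Q$ be the set of paths in the tree of cells that have the root as an end point, and $\mathcal R(Q)=\bigcup_{C\in Q}\mathcal R(C)$. For $I=[s,t]$ let $\mathcal R(I)$ be the set of rectangles that intersect the ray $\{t+\frac12\}\times[j(I)+\frac12,\infty)$, where $j(I)$ is the first job with $r_j\ge s$ (and $\mathcal R(I)=\emptyset$ if there is none). Given $\chi_Q\subseteq2^{\mathcal R(Q)}$ for all $Q\in\mathcal Q$, a consistent solution for $\{\chi_Q\}$ is a set $\mathcal R'\subseteq\mathcal R$ with sets $\mathcal R'_Q\in\chi_Q$ such that (i) $\mathcal R'_Q\subseteq\mathcal R'$; (ii) $p(\mathcal R'_Q\cap\mathcal R(I))\ge d(I)$ whenever $\mathcal R(I)\subseteq\mathcal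 R(Q)$; (iii) $\mathcal R'_Q\cap\mathcal R(Q')\subseteq\mathcal R'_{Q'}$ whenever $Q'\subseteq Q$. Its cost is $c(\mathcal R')$. Running times are numbers of steps of programs in a fixed machine model that is polynomially equivalent to Turing machines (while-programs over binary trees, with unit cost per elementary tree operation). **Theorem.** 1. In time $(nP)^{O_\epsilon(\log^2(nP))}$ one can compute, from the jobs and the offsets, a family $\{\chi_Q\}_{Q\in\mathcal Q}$ with $\chi_Q\subseteq2^{\mathcal R(Q)}$ and $\max_Q|\chi_Q|\le(nP)^{O_\epsilon(\log^2(nP))}$ for which there is a consistent solution of cost at most $(2+\epsilon)\,\mathrm{OPT}^{(\mathrm{IP2})}$. 2. In time $(nP)^{O_\epsilon(\log^2(nP))}$ one can compute, from the jobs and the offsets, a feasible solution of (IP2) of cost at most $(2+\epsilon)\,\mathrm{OPT}^{(\mathrm{IP2})}$. 3. For every real $\epsilon>0$ there is a $(2+\epsilon)$-approximation algorithm for preemptive weighted flow time on a single machine (on normalized instances) with running time $(nP)^{O_\epsilon(\log^2(nP))}$. The constants in the exponents depend only on $\epsilon$ and $A$. -/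

import Mathlib

open Finset MeasureTheory

namespace FlowTime

/-! ### Machine model

Imperative while-programs over binary trees (pointer structures).  Every elementary operation
(reading a variable, building `nil`, `cons`, `hd`, `tl`) costs one step, and so does every operation
in a test of a branching or of a loop, each time the test is evaluated.  This model simulates, and
is simulated by, Turing machines and random access machines (with addition and subtraction) with
polynomial overhead. -/

inductive Data where
  | nil : Data
  | cons : Data → Data → Data

namespace Data

def hd : Data → Data
  | nil => nil
  | cons a _ => a

def tl : Data → Data
  | nil => nil
  | cons _ b => b

/-- Lists as right combs. -/
def ofList : List Data → Data
  | [] => nil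
  | d :: l => cons d (ofList l)

/-- Natural numbers in unary.  All numbers that occur in inputs and outputs below are polynomially
bounded in `n * P`, and running times are measured in `n * P`, not in the length of the input. -/
def ofNat (k : ℕ) : Data := ofList (List.replicate k nil)

end Data

inductive Expr where
  | var : ℕ → Expr
  | nil : Expr
  | cons : Expr → Expr → Expr
  | hd : Expr → Expr
  | tl : Expr → Expr

namespace Expr

/-- The value of an expression in a store, which maps every variable to its value. -/
def eval (s : ℕ → Data) : Expr → Data
  | var i => s i
  | nil => Data.nil
  | cons e f => Data.cons (e.eval s) (f.eval s)
  | hd e => (e.eval s).hd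
  | tl e => (e.eval s).tl

/-- The number of elementary operations in an expression. -/
def steps : Expr → ℕ
  | var _ => 1
  | nil => 1
  | cons e f => e.steps + f.steps + 1
  | hd e => e.steps + 1
  | tl e => e.steps + 1

end Expr

inductive Program where
  | assign : ℕ → Expr → Program
  | seq : Program → Program → Program
  /-- `branch e p q`: if `e` is not `nil` then `p`, else `q` -/
  | branch : Expr → Program → Program → Program
  /-- `loop e p`: while `e` is not `nil`, do `p` -/
  | loop : Expr → Program → Program

/-- `Exec p s k s'`: started in the store `s`, the program `p` halts after exactly `k` steps in the
store `s'`. -/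
inductive Exec : Program → (ℕ → Data) → ℕ → (ℕ → Data) → Prop where
  | assign (i : ℕ) (e : Expr) (s : ℕ → Data) :
      Exec (.assign i e) s (e.steps + 1) (Function.update s i (e.eval s))
  | seq {p q : Program} {s s' s'' : ℕ → Data} {k l : ℕ} :
      Exec p s k s' → Exec q s' l s'' → Exec (.seq p q) s (k + l) s''
  | branchTrue {e : Expr} {p q : Program} {s s' : ℕ → Data} {k : ℕ} :
      e.eval s ≠ .nil → Exec p s k s' → Exec (.branch e p q) s (e.steps + 1 + k) s'
  | branchFalse {e : Expr} {p q : Program} {s s' : ℕ → Data} {k : ℕ} :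
      e.eval s = .nil → Exec q s k s' → Exec (.branch e p q) s (e.steps + 1 + k) s'
  | loopDone {e : Expr} {p : Program} {s : ℕ → Data} :
      e.eval s = .nil → Exec (.loop e p) s (e.steps + 1) s
  | loopStep {e : Expr} {p : Program} {s s' s'' : ℕ → Data} {k l : ℕ} :
      e.eval s ≠ .nil → Exec p s k s' → Exec (.loop e p) s' l s'' →
        Exec (.loop e p) s (e.steps + 1 + k + l) s''

/-- On the input `d` (in variable `0`, all other variables being `nil`) the program `p` halts after
at most `b` steps with the output `d'` in variable `0`. -/
def Program.OutputsWithin (p : Program) (d d' : Data) (b : ℝ) : Prop :=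
  ∃ (k : ℕ) (s : ℕ → Data),
    Exec p (Function.update (fun _ => Data.nil) 0 d) k s ∧ s 0 = d' ∧ (k : ℝ) ≤ b

/-! ### Weighted flow time -/

/-- An instance of weighted flow time: release times `r`, processing times `p`, weights `w`. -/
structure JobInstance where
  n : ℕ
  r : Fin n → ℕ
  p : Fin n → ℕ
  w : Fin n → ℕ

namespace JobInstance

variable (J : JobInstance)

/-- The largest processing time; it is the ratio of the largest and the smallest processing time
when the smallest one is `1`. -/
def P : ℕ := univ.sup J.p

/-- `T = max_j r_j + ∑_j p_j` -/
def T : ℕ := univ.sup J.r + ∑ j, J.p j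

/-- The standing normalization of instances: `min_j r_j = 0`, `max_j r_j ≤ ∑_j p_j`,
`min_j p_j = 1`, and `1 ≤ w_j ≤ A n² P` for all `j`. -/
structure Normalized (A : ℕ) : Prop where
  exists_r_eq_zero : ∃ j, J.r j = 0
  r_le : ∀ j, J.r j ≤ ∑ i, J.p i
  one_le_p : ∀ j, 1 ≤ J.p j
  exists_p_eq_one : ∃ j, J.p j = 1
  one_le_w : ∀ j, 1 ≤ J.w j
  w_le : ∀ j, J.w j ≤ A * J.n ^ 2 * J.P

/-- The bound `(nP) ^ (c log² (nP))`. -/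
noncomputable def quasiPoly (c : ℝ) : ℝ :=
  ((J.n * J.P : ℕ) : ℝ) ^ (c * Real.log ((J.n * J.P : ℕ) : ℝ) ^ 2)

/-- The input of an algorithm: the list of the triples `(r_j, p_j, w_j)`. -/
def encode : Data :=
  Data.ofList ((List.finRange J.n).map fun j =>
    Data.ofList [Data.ofNat (J.r j), Data.ofNat (J.p j), Data.ofNat (J.w j)])

/-- A preemptive schedule on a single machine: `σ t` is the job that runs at time `t` (or `none`),
and every job `j` has been run for `p_j` units of time between its release time and the time
`C j`, by which it is complete. -/
def IsSchedule (σ : ℝ → Option (Fin J.n)) (C : Fin J.n → ℝ) : Prop :=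
  (∀ j, MeasurableSet {t | σ t = some j}) ∧
  ∀ j, (J.r j : ℝ) ≤ C j ∧
    (J.p j : ENNReal) ≤ volume ({t | σ t = some j} ∩ Set.Ico (J.r j : ℝ) (C j))

/-- The weighted flow time `∑_j w_j (C_j - r_j)`. -/
def flowTime (C : Fin J.n → ℝ) : ℝ := ∑ j, (J.w j : ℝ) * (C j - J.r j)

/-- The minimum weighted flow time over all preemptive schedules. -/
noncomputable def optFlowTime : ℝ :=
  sInf {v | ∃ σ C, J.IsSchedule σ C ∧ v = J.flowTime C}

/-- The schedule given by a list: in the time slot `[u, u + 1)` it runs the job in the `u`-th entry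
of the list, and it is idle after the end of the list. -/
noncomputable def slotSchedule (L : List (Option (Fin J.n))) (t : ℝ) : Option (Fin J.n) :=
  if 0 ≤ t then (L[⌊t⌋₊]?).join else none

/-- An idle slot is written as `0`, a slot that runs job `j` as `j + 1`. -/
def encodeSlots (L : List (Option (Fin J.n))) : Data :=
  Data.ofList (L.map fun o => Data.ofNat (o.elim 0 fun j => (j : ℕ) + 1))

end JobInstance

/-! ### The hierarchical grid and the integer program -/

/-- A grid cell is given by its level and its position (from left to right, from `0`) among the
cells of this level. -/
@[ext] structure Cell where
  level : ℕ
  idx : ℕ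
  deriving DecidableEq

/-- The rectangle `[beg, fin) × [job, job + 1)` of a job and a segment `[beg, fin)`. -/
@[ext] structure Rect (n : ℕ) where
  job : Fin n
  beg : ℤ
  fin : ℤ
  deriving DecidableEq

namespace Rect

/-- The rectangle as a set of points in the plane. -/
def toSet {n : ℕ} (R : Rect n) : Set (ℝ × ℝ) :=
  Set.Ico (R.beg : ℝ) (R.fin : ℝ) ×ˢ Set.Ico ((R.job : ℕ) : ℝ) (((R.job : ℕ) : ℝ) + 1)

/-- Segments lie to the right of the release time of their job, so their end points are natural
numbers. -/
def encode {n : ℕ} (R : Rect n) : Data :=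
  Data.ofList [Data.ofNat R.job, Data.ofNat R.beg.toNat, Data.ofNat R.fin.toNat]

/-- A set of rectangles is written as a list. -/
def encodeList {n : ℕ} (l : List (Rect n)) : Data := Data.ofList (l.map Rect.encode)

end Rect

def Cell.encode (C : Cell) : Data := Data.cons (Data.ofNat C.level) (Data.ofNat C.idx)

/-- A job instance together with `m = 1 / ε` and the offsets `(2 / ε) ^ a` and `-x` of the grid. -/
structure GridInstance extends JobInstance where
  m : ℕ
  a : ℕ
  x : ℕ

namespace GridInstance

variable (G : GridInstance)

/-- `K = (2 / ε) ^ (1 / ε)` -/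
def K : ℕ := (2 * G.m) ^ G.m

/-- The minimal `k` with `K ^ (k - 2) ≥ T` (where `K ^ (-1)`, `K ^ (-2)` are fractions). -/
noncomputable def lmax : ℕ := sInf {k | G.T * G.K ^ 2 ≤ G.K ^ k}

def offX : ℤ := -(G.x : ℤ)

def offY : ℕ := (2 * G.m) ^ G.a

/-- The length of the cells of level `l`. -/
noncomputable def cellLen (l : ℕ) : ℤ := (G.offY * G.K ^ (G.lmax - l) : ℕ)

noncomputable def cellBeg (C : Cell) : ℤ := G.offX + C.idx * G.cellLen C.level

noncomputable def cellEnd (C : Cell) : ℤ := G.cellBeg C + G.cellLen C.level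

/-- `1 / ε` is an integer, `ε < 1`, the offsets are in their ranges, and the jobs are labelled by
non-decreasing release times. -/
structure Valid : Prop where
  two_le_m : 2 ≤ G.m
  a_lt : G.a < G.m
  x_lt : G.x < G.K ^ (G.lmax - 1)
  mono : Monotone G.r

/-- The set of all cells: `K ^ l` cells on each level `l ≤ lmax`. -/
noncomputable def cells : Finset Cell :=
  (range (G.lmax + 1)).biUnion fun l => (range (G.K ^ l)).image fun i => ⟨l, i⟩

/-- The cell of level `l` that contains the time `t`. -/
noncomputable def cellAt (l : ℕ) (t : ℤ) : Cell := ⟨l, ((t - G.offX) / G.cellLen l).toNat⟩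

/-- `chain j d` is the cell `C_k` of job `j` for `k = lmax - d`. -/
noncomputable def chain (G : GridInstance) (j : Fin G.n) : ℕ → Cell
  | 0 => G.cellAt G.lmax (G.r j)
  | d + 1 => G.cellAt (G.lmax - (d + 1)) (G.cellEnd (chain G j d))

/-- The cell `C_k` of job `j`: `C_lmax` contains `r_j`, and `C_k` contains the right end of
`C_{k+1}`. -/
noncomputable def jobCell (j : Fin G.n) (k : ℕ) : Cell := G.chain j (G.lmax - k)

/-- The left end of the interval that is divided into the segments of job `j` on level `k`. -/
noncomputable def segStart (j : Fin G.n) (k : ℕ) : ℤ :=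
  if k = G.lmax then (G.r j : ℤ) else G.cellEnd (G.jobCell j (k + 1))

/-- The common length of the segments that are associated with cells of level `k`. -/
noncomputable def segLen (k : ℕ) : ℤ := if k + 2 ≤ G.lmax then G.cellLen (k + 2) else 1

/-- `R(j, C)`: if `C` is the cell `C_k` of job `j`, the rectangles of the segments of length
`segLen k` into which the interval from `segStart j k` to the right end of `C_k` is divided; no
rectangles otherwise. -/
noncomputable def jobCellRects (j : Fin G.n) (C : Cell) : Finset (Rect G.n) :=
  if C = G.jobCell j C.level then
    (range ((G.cellEnd C - G.segStart j C.level) / G.segLen C.level).toNat).image fun q : ℕ =>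
      { job := j
        beg := G.segStart j C.level + q * G.segLen C.level
        fin := G.segStart j C.level + (q + 1) * G.segLen C.level }
  else ∅

/-- `R(C)` -/
noncomputable def cellRects (C : Cell) : Finset (Rect G.n) :=
  univ.biUnion fun j => G.jobCellRects j C

/-- The set of all rectangles. -/
noncomputable def rects : Finset (Rect G.n) := G.cells.biUnion G.cellRects

/-- `R` is the leftmost rectangle of the set `R(j, C)` that contains it. -/
def IsFirst (R : Rect G.n) : Prop :=
  ∃ C ∈ G.cells, R ∈ G.jobCellRects R.job C ∧ ∀ R' ∈ G.jobCellRects R.job C, R.beg ≤ R'.beg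

open Classical in
/-- The cost of a rectangle: `w_j (end(S) - r_j)` for the first segment `S` of a set `Seg(j, C)`,
and `w_j len(S)` for the other ones. -/
noncomputable def rectCost (R : Rect G.n) : ℤ :=
  if G.IsFirst R then G.w R.job * (R.fin - G.r R.job) else G.w R.job * (R.fin - R.beg)

noncomputable def cost (X : Finset (Rect G.n)) : ℤ := ∑ R ∈ X, G.rectCost R

/-- The total capacity of a set of rectangles. -/
def cap (X : Finset (Rect G.n)) : ℤ := ∑ R ∈ X, (G.p R.job : ℤ)

/-- The demand of the interval `[s, t]`. -/
def demand (s t : ℕ) : ℤ :=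
  ∑ j ∈ univ.filter (fun j => s ≤ G.r j ∧ G.r j ≤ t), (G.p j : ℤ) - ((t : ℤ) - (s : ℤ))

/-- Feasibility for (IP2) of the 0/1-solution whose variables of value `1` are those of the
rectangles in `X`. -/
structure Feasible (X : Finset (Rect G.n)) : Prop where
  subset : X ⊆ G.rects
  covering : ∀ s t : ℕ, s ≤ t → t ≤ G.T →
    G.demand s t ≤
      G.cap (X.filter fun R => (s ≤ G.r R.job ∧ G.r R.job ≤ t) ∧ (R.beg ≤ t ∧ (t : ℤ) < R.fin))
  selectPrefix : ∀ (j : Fin G.n), ∀ C ∈ G.cells,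
    ∀ R ∈ G.jobCellRects j C, ∀ R' ∈ G.jobCellRects j C, R.fin < R'.fin → R' ∈ X → R ∈ X

/-- The optimal value of (IP2); the set of all rectangles is always feasible. -/
noncomputable def opt : ℤ := sInf {v | ∃ X, G.Feasible X ∧ v = G.cost X}

/-! ### Consistent solutions -/

/-- The vertical ray `{t + 1/2} × [j(I) + 1/2, ∞)` of the interval `I = [s, t]`, where `j(I)` is the
first job that is released at or after `s` (no ray if there is no such job). -/
def ray (s t : ℕ) : Set (ℝ × ℝ) :=
  {z | ∃ j : Fin G.n, IsLeast {i | s ≤ G.r i} j ∧ z.1 = (t : ℝ) + 1 / 2 ∧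
    ((j : ℕ) : ℝ) + 1 / 2 ≤ z.2}

open Classical in
/-- `R(I)` for `I = [s, t]`: the rectangles that intersect the ray of `I`. -/
noncomputable def rayRects (s t : ℕ) : Finset (Rect G.n) :=
  G.rects.filter fun R => (R.toSet ∩ G.ray s t).Nonempty

/-- The path from the root of the tree of cells to `C`, as a set of cells: the cells whose interval
contains the interval of `C`.  Paths with the root as an end point are in bijection with their other
end points, so families indexed by such paths are indexed by cells below. -/
noncomputable def path (C : Cell) : Finset Cell :=
  G.cells.filter fun C' => G.cellBeg C' ≤ G.cellBeg C ∧ G.cellEnd C ≤ G.cellEnd C'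

/-- `R(Q)` for the path `Q` that ends in `C`. -/
noncomputable def pathRects (C : Cell) : Finset (Rect G.n) := (G.path C).biUnion G.cellRects

/-- `(R', (R'_Q)_Q)` is a consistent solution for the family `χ`. -/
structure IsConsistent (χ : Cell → Finset (Finset (Rect G.n))) (R' : Finset (Rect G.n))
    (RQ : Cell → Finset (Rect G.n)) : Prop where
  subset_rects : R' ⊆ G.rects
  mem : ∀ Q ∈ G.cells, RQ Q ∈ χ Q
  subset : ∀ Q ∈ G.cells, RQ Q ⊆ R'
  covers : ∀ s t : ℕ, s ≤ t → t ≤ G.T → ∀ Q ∈ G.cells, G.rayRects s t ⊆ G.pathRects Q →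
    G.demand s t ≤ G.cap (RQ Q ∩ G.rayRects s t)
  nested : ∀ Q ∈ G.cells, ∀ Q' ∈ G.cells, G.path Q' ⊆ G.path Q →
    RQ Q ∩ G.pathRects Q' ⊆ RQ Q'

/-- The input: the jobs and the two offsets (algorithms may depend on `ε`). -/
def encodeInput : Data :=
  Data.cons G.toJobInstance.encode (Data.cons (Data.ofNat G.a) (Data.ofNat G.x))

/-- The output `d` describes the family `χ`: it is a list of pairs of a cell `Q` and a list of the
members of `χ Q`, each of them given as a list of rectangles, and every cell occurs. -/
def EncodesFamily (d : Data) (χ : Cell → Finset (Finset (Rect G.n))) : Prop :=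
  ∃ L : List (Cell × List (List (Rect G.n))),
    d = Data.ofList (L.map fun e =>
      Data.cons e.1.encode (Data.ofList (e.2.map Rect.encodeList))) ∧
    (∀ Q ∈ G.cells, ∃ e ∈ L, e.1 = Q) ∧
    ∀ e ∈ L, e.1 ∈ G.cells ∧ ∀ X, X ∈ χ e.1 ↔ ∃ l ∈ e.2, l.toFinset = X

end GridInstance

end FlowTime

/-! All three parts rest on one exchange argument. Suppose the processing times in a class of jobs
agree up to a factor `1 + 1/q`, and a set `F` of jobs of the class, minus one job, has less volume
than a set `A` of jobs of the class. Then `|F| - 1 ≤ (1 + 1/q)|A|`, and as `A` is nonempty, `|F| ≤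
(2 + 1/q)|A|` (`card_le_of_sum_erase_lt`). If the costs also agree up to a factor near 1, replacing
`A` by `F` multiplies the cost by at most `2 + O(1/q)` (`sum_le_of_sum_erase_lt`).

Flow time. Rounding processing times and weights gives `O(log²(nP))` classes. Inside a class jobs
run in order of release, so a schedule is described by the vectors of processed volumes of the
classes, of which there are `2^O(log³(nP))`. Flow time is the sum over time of the pending weight,
so a shortest path through these vectors finds the best such schedule. For the comparison, take any
schedule with completion times `C`. Running the available job with the smallest `C` in each unit
slot also meets all these completion times (`lt_of_rem_pos`, `IsSchedule.sum_proc_le`). With the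
same class volumes but order of release, the pending jobs `F` of a class, minus the first one, have
less volume than the pending jobs `A` of the priority schedule (`class_cost_le`).

Covering. In a cell, jobs with the same key have the same segments and similar capacities and costs.
For each key and each index `j`, the `j`-th segments of a solution are replaced by those of the
latest jobs of sufficient volume. A constraint for `[s, t]` concerns the jobs released from `s` on,
a set closed under passing to later jobs, so no coverage is lost (`volume_le_latest`). The new
choice is described by cost budgets. Rounded to a common unit they lose a factor `1 + 1/q`, and they
add up to only `O(log²(nP))` units, so `O(log²(nP))` bits encode them in unary (`exists_budgets`,
`exists_bits`). A state at time `t` holds the codes of the `O(log(nP))` cells that contain `t`,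
which leaves `2^O(log³(nP))` states. A shortest path over `t` checks all constraints that end at `t`
and charges a cell when it is entered (`Ok.exists_selections`, `Ok.isCover_selections`). The ratio
`(1 + 1/q)³(2 + 1/q)` is at most `2 + 1/m` for `q = 22m`. For part 1, the feasible set `X` found in
this way gives `χ_Q = {X ∩ R(Q)}`, whose members are consistent because they come from one set.

Running times come from closure properties of `TimeIn` and `PTime`. Numbers are unary, so arithmetic
is list manipulation. The only superpolynomial operation is the enumeration `lists`, whose output
size enters the measure. -/

namespace FlowTime

/-! ### Sizes and codes -/

/-- The number of nodes of a binary tree. -/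
def Data.size : Data → ℕ
  | .nil => 1
  | .cons a b => a.size + b.size + 1

/-- Types whose elements are represented by binary trees. -/
class Coded (α : Type) where
  code : α → Data

open Coded (code)

instance : Coded Unit := ⟨fun _ => .nil⟩

instance : Coded Bool := ⟨fun b => if b then .cons .nil .nil else .nil⟩

instance : Coded ℕ := ⟨Data.ofNat⟩

instance {α : Type} [Coded α] : Coded (List α) := ⟨fun l => Data.ofList (l.map code)⟩

instance {α β : Type} [Coded α] [Coded β] : Coded (α × β) := ⟨fun x => .cons (code x.1) (code x.2)⟩

/-- The size of the code of an element. -/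
def sz {α : Type} [Coded α] (a : α) : ℕ := (code a).size

section
variable {α β γ δ : Type} [Coded α] [Coded β] [Coded γ] [Coded δ]

lemma sz_pair (a : α) (b : β) : sz (a, b) = sz a + sz b + 1 := rfl

@[simp] lemma sz_nil : sz ([] : List α) = 1 := rfl

@[simp] lemma sz_cons (a : α) (l : List α) : sz (a :: l) = sz a + sz l + 1 := rfl

@[simp] lemma code_nil : code ([] : List α) = .nil := rfl

@[simp] lemma code_cons (a : α) (l : List α) : code (a :: l) = .cons (code a) (code l) := rfl

lemma code_pair (a : α) (b : β) : code (a, b) = .cons (code a) (code b) := rfl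

/-- A number and a list of that many units are the same tree. Through this identification list
programs do unary arithmetic. -/
lemma code_replicate_unit (n : ℕ) : code (List.replicate n ()) = code n := by
  show Data.ofList _ = Data.ofNat n
  simp [Data.ofNat, code]

@[simp] lemma sz_nat (n : ℕ) : sz n = 2 * n + 1 := by
  have : sz n = sz (List.replicate n ()) := by simp [sz, code_replicate_unit]
  rw [this]
  induction n with
  | zero => rfl
  | succ n ih =>
    rw [List.replicate_succ, sz_cons, ih (by simp [sz, code_replicate_unit])]
    simp [sz, code, Data.size]; ring

lemma sz_append (l l' : List α) : sz (l ++ l') + 1 = sz l + sz l' := by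
  induction l with
  | nil => simp; ring
  | cons a l ih => simp only [List.cons_append, sz_cons]; omega

lemma length_lt_sz (l : List α) : l.length < sz l := by
  induction l with
  | nil => simp
  | cons a l ih => simp only [List.length_cons, sz_cons]; omega

lemma sz_lt_of_mem {a : α} {l : List α} (h : a ∈ l) : sz a < sz l := by
  induction l with
  | nil => simp at h
  | cons b l ih =>
    rcases List.mem_cons.1 h with rfl | h
    · simp only [sz_cons]; omega
    · have := ih h; simp only [sz_cons]; omega

lemma sz_le_of_forall {l : List α} {B : ℕ} (h : ∀ a ∈ l, sz a ≤ B) :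
    sz l ≤ l.length * (B + 1) + 1 := by
  induction l with
  | nil => simp
  | cons a l ih =>
    have h1 := h a (by simp)
    have h2 := ih fun a ha => h a (by simp [ha])
    simp only [sz_cons, List.length_cons, add_mul]; omega

lemma sz_le_of_sublist {l l' : List α} (h : l.Sublist l') : sz l ≤ sz l' := by
  induction h with
  | slnil => simp
  | cons a h ih => simp only [sz_cons]; omega
  | cons_cons a h ih => simp only [sz_cons]; omega

end

/-! ### Polynomial bounds -/

/-- `g` is bounded by a polynomial in `μ`. -/
def PolyBounded {α : Type} (μ g : α → ℕ) : Prop := ∃ c, ∀ a, g a ≤ (μ a + 2) ^ c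

namespace PolyBounded
variable {α β : Type} {μ f g : α → ℕ}

lemma mono (hg : PolyBounded μ g) (h : ∀ a, f a ≤ g a) : PolyBounded μ f :=
  hg.imp fun _ hc a => (h a).trans (hc a)

lemma const (n : ℕ) : PolyBounded μ fun _ => n :=
  ⟨n, fun a => (Nat.lt_two_pow_self).le.trans (Nat.pow_le_pow_left (by omega) n)⟩

lemma self : PolyBounded μ μ := ⟨1, fun a => by simp⟩

lemma mul (hf : PolyBounded μ f) (hg : PolyBounded μ g) : PolyBounded μ fun a => f a * g a := by
  obtain ⟨c, hc⟩ := hf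
  obtain ⟨d, hd⟩ := hg
  exact ⟨c + d, fun a => (Nat.mul_le_mul (hc a) (hd a)).trans (pow_add _ _ _).ge⟩

lemma add (hf : PolyBounded μ f) (hg : PolyBounded μ g) : PolyBounded μ fun a => f a + g a := by
  obtain ⟨c, hc⟩ := hf
  obtain ⟨d, hd⟩ := hg
  refine ⟨c + d + 1, fun a => ?_⟩
  have h1 := (hc a).trans (Nat.pow_le_pow_right (n := μ a + 2) (by omega) (Nat.le_add_right c d))
  have h2 := (hd a).trans (Nat.pow_le_pow_right (n := μ a + 2) (by omega) (Nat.le_add_left d c))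
  rw [pow_succ]
  nlinarith [Nat.zero_le ((μ a + 2) ^ (c + d) * μ a)]

lemma pow (hf : PolyBounded μ f) (n : ℕ) : PolyBounded μ fun a => f a ^ n := by
  obtain ⟨c, hc⟩ := hf
  exact ⟨c * n, fun a => (Nat.pow_le_pow_left (hc a) n).trans (pow_mul _ _ _).ge⟩

lemma comp {ν g : β → ℕ} {φ : α → β} (hg : PolyBounded ν g) (hν : PolyBounded μ fun a => ν (φ a)) :
    PolyBounded μ fun a => g (φ a) := by
  obtain ⟨c, hc⟩ := hg
  exact ((hν.add (const 2)).pow c).mono fun a => hc (φ a)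

end PolyBounded

/-! ### Computable functions with time bounds -/

/-- `f` is computed, in every base register `b`, by a program that needs time polynomial in `μ` and
does not change the registers below `b`. -/
def TimeIn {α β : Type} [Coded α] [Coded β] (μ : α → ℕ) (f : α → β) : Prop :=
  ∃ (p : ℕ → Program) (t : α → ℕ), PolyBounded μ t ∧ ∀ a, sz (f a) ≤ t a ∧
    ∀ (b : ℕ) (s : ℕ → Data), s b = code a →
      ∃ k s', Exec (p b) s k s' ∧ s' b = code (f a) ∧ (∀ i < b, s' i = s i) ∧ k ≤ t a

/-- `f` is computable in polynomial time. -/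
@[fun_prop] def PTime {α β : Type} [Coded α] [Coded β] (f : α → β) : Prop := TimeIn sz f

section
variable {α β γ δ : Type} [Coded α] [Coded β] [Coded γ] [Coded δ]

lemma TimeIn.polyBounded_sz {μ : α → ℕ} {f : α → β} (hf : TimeIn μ f) :
    PolyBounded μ fun a => sz (f a) := by
  obtain ⟨p, t, ht, h⟩ := hf
  exact ht.mono fun a => (h a).1

lemma TimeIn.mono {μ ν : α → ℕ} {f : α → β} (hf : TimeIn μ f) (h : PolyBounded ν μ) :
    TimeIn ν f := by
  obtain ⟨p, t, ht, hp⟩ := hf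
  exact ⟨p, t, ht.comp (φ := id) h, hp⟩

lemma PTime.timeIn {μ : α → ℕ} {f : α → β} (hf : PTime f) (h : PolyBounded μ sz) : TimeIn μ f :=
  TimeIn.mono hf h

/-- Programs see only codes, so a function that agrees with `f` on the level of codes inherits its
program. Many derived operations below are obtained in this way. -/
lemma TimeIn.of_code_eq {α' β' : Type} [Coded α'] [Coded β'] {μ : α → ℕ} {ν : α' → ℕ}
    {f : α → β} {g : α' → β'} (φ : α' → α) (hf : TimeIn μ f) (hν : PolyBounded ν fun a => μ (φ a))
    (h1 : ∀ a, code (φ a) = code a) (h2 : ∀ a, code (g a) = code (f (φ a))) : TimeIn ν g := by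
  obtain ⟨p, t, ht, hp⟩ := hf
  refine ⟨p, fun a => t (φ a), ht.comp hν, fun a => ⟨?_, fun b s hs => ?_⟩⟩
  · have := (hp (φ a)).1
    simpa [sz, h2] using this
  · obtain ⟨k, s', h⟩ := (hp (φ a)).2 b s (by rw [hs, h1])
    exact ⟨k, s', by rw [h2]; exact h⟩

lemma PTime.of_code_eq {α' β' : Type} [Coded α'] [Coded β']
    {f : α → β} {g : α' → β'} (φ : α' → α) (hf : PTime f)
    (h1 : ∀ a, code (φ a) = code a) (h2 : ∀ a, code (g a) = code (f (φ a))) : PTime g :=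
  TimeIn.of_code_eq φ hf (PolyBounded.self.mono fun a => by simp [sz, h1]) h1 h2

/-- The size bound inside `TimeIn` makes the intermediate result polynomial in `μ`, so a
polynomial-time outer function adds only polynomial time. -/
lemma TimeIn.comp {μ : α → ℕ} {g : β → γ} {f : α → β} (hg : PTime g) (hf : TimeIn μ f) :
    TimeIn μ fun a => g (f a) := by
  have hs := hf.polyBounded_sz
  obtain ⟨p, t, ht, hp⟩ := hf
  obtain ⟨q, u, hu, hq⟩ := hg
  refine ⟨fun b => .seq (p b) (q b), fun a => t a + u (f a), ht.add (hu.comp hs), fun a =>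
    ⟨(hq (f a)).1.trans (Nat.le_add_left _ _), fun b s hb => ?_⟩⟩
  obtain ⟨k, s', e, h1, h2, h3⟩ := (hp a).2 b s hb
  obtain ⟨k', s'', e', h1', h2', h3'⟩ := (hq (f a)).2 b s' h1
  exact ⟨_, s'', e.seq e', h1', fun i hi => by rw [h2' i hi, h2 i hi], by dsimp only; omega⟩

/-- The input stays in register `b`, the first component goes to `b + 1`, and the second computation
starts at `b + 2`, where it cannot disturb either of them. -/
lemma TimeIn.pair {μ : α → ℕ} {f : α → β} {g : α → γ} (hf : TimeIn μ f) (hg : TimeIn μ g) :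
    TimeIn μ fun a => (f a, g a) := by
  have hs := hf.polyBounded_sz
  have hs' := hg.polyBounded_sz
  obtain ⟨p, t, ht, hp⟩ := hf
  obtain ⟨q, u, hu, hq⟩ := hg
  refine ⟨fun b => .seq (.assign (b + 1) (.var b)) (.seq (p (b + 1)) (.seq
    (.assign (b + 2) (.var b)) (.seq (q (b + 2))
      (.assign b (.cons (.var (b + 1)) (.var (b + 2))))))), fun a => t a + u a + 8,
    (ht.add hu).add (.const 8), fun a => ⟨?_, fun b s hb => ?_⟩⟩
  · have := (hp a).1
    have := (hq a).1
    rw [sz_pair]; dsimp only; omega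
  obtain ⟨k, s', e, h1, h2, h3⟩ := (hp a).2 (b + 1) (Function.update s (b + 1) (s b)) (by simpa)
  obtain ⟨k', s'', e', h1', h2', h3'⟩ := (hq a).2 (b + 2) (Function.update s' (b + 2) (s' b))
    (by simp [h2 b (by omega), hb])
  refine ⟨_, _, (Exec.assign _ _ _).seq (e.seq ((Exec.assign _ _ _).seq (e'.seq
    (Exec.assign _ _ _)))), ?_, ?_, ?_⟩
  · simp only [Expr.eval, Function.update_self, h1', code_pair, h2' (b + 1) (by omega)]
    simp [h1]
  · intro i hi
    rw [Function.update_of_ne (by omega), h2' i (by omega), Function.update_of_ne (by omega),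
      h2 i (by omega), Function.update_of_ne (by omega)]
  · simp only [Expr.steps]; omega

lemma TimeIn.of_expr {μ : α → ℕ} {f : α → β} (e : ℕ → Expr) (n : ℕ)
    (hs : PolyBounded μ fun a => sz (f a))
    (he : ∀ a b s, s b = code a → (e b).eval s = code (f a)) (hn : ∀ b, (e b).steps ≤ n) :
    TimeIn μ f := by
  refine ⟨fun b => .assign b (e b), fun a => sz (f a) + (n + 1), hs.add (.const _), fun a =>
    ⟨Nat.le_add_right _ _, fun b s hb => ⟨_, _, Exec.assign _ _ _, ?_, ?_, ?_⟩⟩⟩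
  · simpa using he a b s hb
  · intro i hi; rw [Function.update_of_ne (by omega)]
  · have := hn b; dsimp only; omega

/-- An expression with a given value. -/
def Data.toExpr : Data → Expr
  | .nil => .nil
  | .cons a b => .cons a.toExpr b.toExpr

lemma Data.eval_toExpr (d : Data) (s : ℕ → Data) : d.toExpr.eval s = d := by
  induction d with
  | nil => rfl
  | cons a b iha ihb => simp [Data.toExpr, Expr.eval, iha, ihb]

lemma TimeIn.const {μ : α → ℕ} (b : β) : TimeIn μ fun _ : α => b :=
  .of_expr (fun _ => (code b).toExpr) (code b).toExpr.steps (.const _)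
    (fun _ _ _ _ => Data.eval_toExpr _ _) fun _ => le_rfl

lemma TimeIn.ite {μ : α → ℕ} {h : α → Bool} {f g : α → β} (hh : TimeIn μ h) (hf : TimeIn μ f)
    (hg : TimeIn μ g) : TimeIn μ fun a => if h a = true then f a else g a := by
  obtain ⟨r, v, hv, hr⟩ := hh
  obtain ⟨p, t, ht, hp⟩ := hf
  obtain ⟨q, u, hu, hq⟩ := hg
  refine ⟨fun b => .seq (.assign (b + 1) (.var b)) (.seq (r (b + 1))
    (.branch (.var (b + 1)) (p b) (q b))), fun a => t a + u a + v a + 4,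
    ((ht.add hu).add hv).add (.const 4), fun a => ⟨?_, fun b s hb => ?_⟩⟩
  · have := (hp a).1
    have := (hq a).1
    dsimp only; split_ifs <;> omega
  obtain ⟨k, s', e, h1, h2, h3⟩ := (hr a).2 (b + 1) (Function.update s (b + 1) (s b)) (by simpa)
  have hb' : s' b = code a := by rw [h2 b (by omega), Function.update_of_ne (by omega), hb]
  have hlow : ∀ i < b, s' i = s i := fun i hi => by
    rw [h2 i (by omega), Function.update_of_ne (by omega)]
  by_cases hc : h a = true
  · obtain ⟨k', s'', e', h1', h2', h3'⟩ := (hp a).2 b s' hb'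
    refine ⟨_, _, (Exec.assign _ _ _).seq (e.seq (Exec.branchTrue ?_ e')), ?_, ?_, ?_⟩
    · simp [Expr.eval, h1, hc, code]
    · simp [h1', hc]
    · intro i hi; rw [h2' i hi, hlow i hi]
    · simp only [Expr.steps]; omega
  · obtain ⟨k', s'', e', h1', h2', h3'⟩ := (hq a).2 b s' hb'
    refine ⟨_, _, (Exec.assign _ _ _).seq (e.seq (Exec.branchFalse ?_ e')), ?_, ?_, ?_⟩
    · simp [Expr.eval, h1, hc, code]
    · simp [h1', hc]
    · intro i hi; rw [h2' i hi, hlow i hi]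
    · simp only [Expr.steps]; omega

/-- Iteration over a list, when all intermediate results are small. -/
lemma TimeIn.foldl {μ : γ → ℕ} {l : γ → List α} {i : γ → β} {g : γ → β → α → β}
    (hl : TimeIn μ l) (hi : TimeIn μ i) (hμ : PolyBounded μ sz)
    (hg : PTime fun x : γ × β × α => g x.1 x.2.1 x.2.2) (B : γ → ℕ) (hB : PolyBounded μ B)
    (hbd : ∀ c l', l' <+: l c → sz (l'.foldl (g c) (i c)) ≤ B c) :
    TimeIn μ fun c => (l c).foldl (g c) (i c) := by
  have hs := hl.polyBounded_sz
  obtain ⟨pl, tl, htl, hpl⟩ := hl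
  obtain ⟨pi, ti, hti, hpi⟩ := hi
  obtain ⟨pg, tg, ⟨d, htg⟩, hpg⟩ := hg
  -- Cost of one round: the step program runs on `(c, acc, a)`, of size at most `sz c + B c + sz (l
  -- c) + 2`, and `20` generously pays for the loop test and the assignments.
  have hD : PolyBounded μ fun c => (sz c + B c + sz (l c) + 2 + 2) ^ d + 20 :=
    (((((hμ.add hB).add hs).add (.const 2)).add (.const 2)).pow d).add (.const 20)
  set D : γ → ℕ := fun c => (sz c + B c + sz (l c) + 2 + 2) ^ d + 20 with hDdef
  -- Registers: `b` holds the parameter `c`, `b + 1` the accumulator, `b + 2` the unread part of the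
  -- list, and `b + 3` the argument and the result of the step program.
  refine ⟨fun b => .seq (.assign (b + 1) (.var b)) (.seq (pi (b + 1)) (.seq
    (.assign (b + 2) (.var b)) (.seq (pl (b + 2)) (.seq
    (.loop (.var (b + 2)) (.seq
      (.assign (b + 3) (.cons (.var b) (.cons (.var (b + 1)) (.hd (.var (b + 2)))))) (.seq
      (pg (b + 3)) (.seq (.assign (b + 1) (.var (b + 3))) (.assign (b + 2) (.tl (.var (b + 2))))))))
    (.assign b (.var (b + 1))))))), fun c => ti c + tl c + sz (l c) * D c + B c + 10,
    (((hti.add htl).add (hs.mul hD)).add hB).add (.const 10), fun c => ⟨?_, fun b s hb => ?_⟩⟩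
  · have := hbd c (l c) (List.prefix_refl _); dsimp only; omega
  obtain ⟨k, s1, e1, h11, h12, h13⟩ := (hpi c).2 (b + 1) (Function.update s (b + 1) (s b))
    (by simpa)
  obtain ⟨k', s2, e2, h21, h22, h23⟩ := (hpl c).2 (b + 2) (Function.update s1 (b + 2) (s1 b))
    (by simp [h12 b (by omega), hb])
  -- Loop invariant: `l1` has been consumed and its fold is the accumulator; `l2` is unread.
  have key : ∀ (l2 l1 : List α) (s : ℕ → Data), l c = l1 ++ l2 → s b = code c →
      s (b + 1) = code (l1.foldl (g c) (i c)) → s (b + 2) = code l2 →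
      ∃ k s', Exec (.loop (.var (b + 2)) (.seq
      (.assign (b + 3) (.cons (.var b) (.cons (.var (b + 1)) (.hd (.var (b + 2)))))) (.seq
      (pg (b + 3)) (.seq (.assign (b + 1) (.var (b + 3)))
      (.assign (b + 2) (.tl (.var (b + 2)))))))) s k s' ∧
        s' (b + 1) = code ((l c).foldl (g c) (i c)) ∧ (∀ i < b, s' i = s i) ∧
        k ≤ l2.length * D c + 2 := by
    intro l2
    induction l2 with
    | nil =>
      intro l1 s hc h0 h1 h2
      refine ⟨_, s, Exec.loopDone (by simp [Expr.eval, h2]), ?_, fun _ _ => rfl, ?_⟩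
      · simpa [hc] using h1
      · simp [Expr.steps]
    | cons a l2 ih =>
      intro l1 s hc h0 h1 h2
      obtain ⟨k1, t1, f1, g1, g2, g3⟩ := (hpg (c, l1.foldl (g c) (i c), a)).2 (b + 3)
        (Function.update s (b + 3) (.cons (s b) (.cons (s (b + 1)) (s (b + 2)).hd)))
        (by simp [h0, h1, h2, code_pair, Data.hd])
      obtain ⟨k2, t2, f2, g1', g2', g3'⟩ := ih (l1 ++ [a])
        (Function.update (Function.update t1 (b + 1) (t1 (b + 3))) (b + 2) (t1 (b + 2)).tl)
        (by simp [hc])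
        (by simp [g2 b (by omega), h0])
        (by simp [g1])
        (by simp [g2 (b + 2) (by omega), h2, Data.tl])
      refine ⟨_, t2, Exec.loopStep (l := k2) (by simp [Expr.eval, h2])
        ((Exec.assign _ _ _).seq
        (f1.seq ((Exec.assign _ _ _).seq (Exec.assign _ _ _)))) ?_, g1', ?_, ?_⟩
      · simpa [Expr.eval] using f2
      · intro j hj
        rw [g2' j hj, Function.update_of_ne (by omega), Function.update_of_ne (by omega),
          g2 j (by omega), Function.update_of_ne (by omega)]
      · have hk1 : k1 ≤ (sz c + B c + sz (l c) + 2 + 2) ^ d := by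
          refine g3.trans ((htg _).trans (Nat.pow_le_pow_left ?_ d))
          have ha : sz a < sz (l c) := sz_lt_of_mem (by simp [hc])
          have := hbd c l1 ⟨_, hc.symm⟩
          simp only [sz_pair]; omega
        have : k1 + 20 ≤ D c := by simp only [hDdef]; omega
        simp only [Expr.steps, List.length_cons, add_mul]; omega
  obtain ⟨k3, s3, e3, h31, h32, h33⟩ := key (l c) [] s2 rfl
    (by rw [h22 b (by omega), Function.update_of_ne (by omega), h12 b (by omega),
      Function.update_of_ne (by omega), hb])
    (by rw [h22 (b + 1) (by omega), Function.update_of_ne (by omega), h11]; rfl) h21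
  refine ⟨_, _, (Exec.assign _ _ _).seq (e1.seq ((Exec.assign _ _ _).seq (e2.seq (e3.seq
    (Exec.assign _ _ _))))), ?_, ?_, ?_⟩
  · simp [Expr.eval, h31]
  · intro i hi
    rw [Function.update_of_ne (by omega), h32 i hi, h22 i (by omega),
      Function.update_of_ne (by omega), h12 i (by omega), Function.update_of_ne (by omega)]
  · have : (l c).length * D c ≤ sz (l c) * D c := Nat.mul_le_mul_right _ (length_lt_sz _).le
    simp only [Expr.steps]; omega

end

/-! ### Basic polynomial-time functions -/

namespace PTime
variable {α β γ δ : Type} [Coded α] [Coded β] [Coded γ] [Coded δ]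

@[fun_prop] lemma id' : PTime fun a : α => a :=
  TimeIn.of_expr (fun b => .var b) 1 .self (fun _ _ _ h => h) fun _ => le_rfl

@[fun_prop] lemma const (b : β) : PTime fun _ : α => b := TimeIn.const b

@[fun_prop] lemma comp {g : β → γ} {f : α → β} (hg : PTime g) (hf : PTime f) :
    PTime fun a => g (f a) := TimeIn.comp hg hf

@[fun_prop] lemma pair {f : α → β} {g : α → γ} (hf : PTime f) (hg : PTime g) :
    PTime fun a => (f a, g a) := TimeIn.pair hf hg

@[fun_prop] lemma fst {f : α → β × γ} (hf : PTime f) : PTime fun a => (f a).1 :=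
  TimeIn.comp (g := Prod.fst) (TimeIn.of_expr (fun b => .hd (.var b)) 2
    (PolyBounded.self.mono fun a => by rcases a with ⟨a, b⟩; simp only [sz_pair]; omega)
    (fun ⟨a, a'⟩ b s h => by simp [Expr.eval, h, code_pair, Data.hd]) fun _ => le_rfl) hf

@[fun_prop] lemma snd {f : α → β × γ} (hf : PTime f) : PTime fun a => (f a).2 :=
  TimeIn.comp (g := Prod.snd) (TimeIn.of_expr (fun b => .tl (.var b)) 2
    (PolyBounded.self.mono fun a => by rcases a with ⟨a, b⟩; simp only [sz_pair]; omega)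
    (fun ⟨a, a'⟩ b s h => by simp [Expr.eval, h, code_pair, Data.tl]) fun _ => le_rfl) hf

@[fun_prop] lemma cons {f : α → β} {g : α → List β} (hf : PTime f) (hg : PTime g) :
    PTime fun a => f a :: g a :=
  (hf.pair hg).of_code_eq (fun a => a) (fun _ => rfl) fun _ => rfl

@[fun_prop] lemma tail {f : α → List β} (hf : PTime f) : PTime fun a => (f a).tail :=
  TimeIn.comp (g := List.tail) (TimeIn.of_expr (fun b => .tl (.var b)) 2
    (PolyBounded.self.mono fun a => sz_le_of_sublist (List.tail_sublist a))
    (fun a b s h => by cases a <;> simp [Expr.eval, h, Data.tl]) fun _ => le_rfl) hf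

@[fun_prop] lemma ite_bool {h : α → Bool} {f g : α → β} (hh : PTime h) (hf : PTime f)
    (hg : PTime g) : PTime fun a => if h a = true then f a else g a := TimeIn.ite hh hf hg

@[fun_prop] lemma ite {h : α → Prop} [DecidablePred h] {f g : α → β}
    (hh : PTime fun a => decide (h a)) (hf : PTime f)
    (hg : PTime g) : PTime fun a => if h a then f a else g a := by
  simpa using ite_bool hh hf hg

@[fun_prop] lemma isEmpty {f : α → List β} (hf : PTime f) : PTime fun a => (f a).isEmpty := by
  suffices PTime fun l : List β => l.isEmpty from this.comp hf
  refine ⟨fun b => .branch (.var b) (.assign b .nil) (.assign b (.cons .nil .nil)), fun _ => 10,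
    .const _, fun l => ⟨?_, fun b s h => ?_⟩⟩
  · cases l <;> simp [sz, code, Data.size]
  · cases l with
    | nil =>
      refine ⟨_, _, .branchFalse (by simpa [Expr.eval] using h) (.assign _ _ _), ?_, ?_, ?_⟩
      · simp [Expr.eval, code]
      · intro i hi; rw [Function.update_of_ne (by omega)]
      · simp [Expr.steps]
    | cons a l =>
      refine ⟨_, _, .branchTrue (by simp [Expr.eval, h]) (.assign _ _ _), ?_, ?_, ?_⟩
      · simp [Expr.eval, code]
      · intro i hi; rw [Function.update_of_ne (by omega)]
      · simp [Expr.steps]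

lemma foldl {l : γ → List α} {i : γ → β} {g : γ → β → α → β}
    (hl : PTime l) (hi : PTime i) (hg : PTime fun x : γ × β × α => g x.1 x.2.1 x.2.2)
    (B : γ → ℕ) (hB : PolyBounded sz B)
    (hbd : ∀ c l', l' <+: l c → sz (l'.foldl (g c) (i c)) ≤ B c) :
    PTime fun c => (l c).foldl (g c) (i c) :=
  TimeIn.foldl hl hi .self hg B hB hbd

@[fun_prop] lemma headD {f : α → List β} {g : α → β} (hf : PTime f) (hg : PTime g) :
    PTime fun a => (f a).headD (g a) := by
  have h : PTime fun x : List β × β => if x.1.isEmpty = true then x.2 else x.1.headD x.2 := by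
    refine ⟨fun b => .branch (.hd (.var b)) (.assign b (.hd (.hd (.var b))))
      (.assign b (.tl (.var b))), fun x => sz x + 20, .add .self (.const _), fun x =>
        ⟨?_, fun b s h => ?_⟩⟩
    · rcases x with ⟨_ | ⟨a, l⟩, b⟩
      · simp [sz_pair]; omega
      · simp [sz_pair]; omega
    · rcases x with ⟨_ | ⟨a, l⟩, c⟩
      · refine ⟨_, _, .branchFalse (by simp [Expr.eval, h, code_pair, Data.hd]) (.assign _ _ _),
          ?_, ?_, ?_⟩
        · simp [Expr.eval, h, code_pair, Data.tl]
        · intro i hi; rw [Function.update_of_ne (by omega)]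
        · simp [Expr.steps]
      · refine ⟨_, _, .branchTrue (by simp [Expr.eval, h, code_pair, Data.hd]) (.assign _ _ _),
          ?_, ?_, ?_⟩
        · simp [Expr.eval, h, code_pair, Data.hd]
        · intro i hi; rw [Function.update_of_ne (by omega)]
        · simp [Expr.steps]
  have h2 := h.comp (hf.pair hg)
  refine h2.of_code_eq (fun a => a) (fun _ => rfl) fun a => ?_
  cases f a <;> simp

end PTime

/-! ### List operations and unary arithmetic in polynomial time -/

namespace PTime
variable {α β γ δ : Type} [Coded α] [Coded β] [Coded γ] [Coded δ]

lemma polyBounded_sz {f : α → β} (hf : PTime f) : PolyBounded sz fun a => sz (f a) :=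
  TimeIn.polyBounded_sz hf

@[fun_prop] lemma reverse {f : α → List β} (hf : PTime f) : PTime fun a => (f a).reverse := by
  suffices PTime fun l : List β => l.reverse from this.comp hf
  have := foldl (γ := List β) (l := fun l => l) (i := fun _ => []) (g := fun _ acc a => a :: acc)
    (by fun_prop) (by fun_prop) (by fun_prop) (fun l => sz l) .self fun l l' h => by
      have h1 : l'.foldl (fun acc a => a :: acc) [] = l'.reverse := by simp
      have h2 : ∀ l : List β, sz l.reverse = sz l := fun l => by
        induction l with
        | nil => rfl
        | cons a l ih =>
          have := sz_append l.reverse [a]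
          simp only [List.reverse_cons, sz_cons, sz_nil] at *; omega
      simp only [h1, h2]
      exact sz_le_of_sublist h.sublist
  simpa using this

lemma sz_map_le (f : α → β) (l : List α) (B : ℕ) (h : ∀ a ∈ l, sz (f a) ≤ B) :
    sz (l.map f) ≤ sz l * (B + 1) + 1 := by
  refine (sz_le_of_forall (B := B) (by simpa using h)).trans ?_
  have := length_lt_sz l
  rw [List.length_map]
  have := Nat.mul_le_mul_right (B + 1) this.le
  omega

@[fun_prop] lemma map {l : γ → List α} {f : γ → α → β} (hl : PTime l)
    (hf : PTime fun x : γ × α => f x.1 x.2) : PTime fun c => (l c).map (f c) := by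
  obtain ⟨d, hd⟩ := hf.polyBounded_sz
  -- Consing the images produces them in reverse order; a final reversal restores it.
  have := foldl (γ := γ) (l := l) (i := fun _ => []) (g := fun c acc a => f c a :: acc)
    hl (by fun_prop) (by
      have : PTime fun x : γ × List β × α => f x.1 x.2.2 :=
        hf.comp (f := fun x : γ × List β × α => (x.1, x.2.2)) (by fun_prop)
      fun_prop)
    (fun c => sz (l c) * ((sz c + sz (l c) + 1 + 2) ^ d + 1) + 1)
    ((hl.polyBounded_sz.mul ((((((PolyBounded.self.add hl.polyBounded_sz).add (.const 1)).add
      (.const 2)).pow d)).add (.const 1))).add (.const 1)) fun c l' h => by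
      have h1 : ∀ acc, l'.foldl (fun acc a => f c a :: acc) acc = (l'.map (f c)).reverse ++ acc := by
        clear h
        induction l' with
        | nil => simp
        | cons a l ih => intro acc; simp [ih]
      have h2 : ∀ l : List β, sz l.reverse = sz l := fun l => by
        induction l with
        | nil => rfl
        | cons a l ih =>
          have := sz_append l.reverse [a]
          simp only [List.reverse_cons, sz_cons, sz_nil] at *; omega
      simp only [h1, List.append_nil, h2]
      refine (sz_le_of_sublist (h.sublist.map (f c))).trans (sz_map_le _ _ _ fun a ha => ?_)
      refine (hd (c, a)).trans (Nat.pow_le_pow_left ?_ d)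
      have := sz_lt_of_mem ha
      simp only [sz_pair]; omega
  have h3 := this.reverse
  refine h3.of_code_eq (fun a => a) (fun _ => rfl) fun c => ?_
  have h1 : ∀ (l' : List α) acc,
      l'.foldl (fun acc a => f c a :: acc) acc = (l'.map (f c)).reverse ++ acc := by
    intro l'
    induction l' with
    | nil => simp
    | cons a l ih => intro acc; simp [ih]
  simp [h1]

@[fun_prop] lemma append {f g : α → List β} (hf : PTime f) (hg : PTime g) :
    PTime fun a => f a ++ g a := by
  have := foldl (γ := α) (l := fun a => (f a).reverse) (i := g) (g := fun _ acc a => a :: acc)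
    (by fun_prop) (by fun_prop) (by fun_prop) (fun a => sz (f a) + sz (g a))
    (hf.polyBounded_sz.add hg.polyBounded_sz) fun a l' h => by
      have h1 : l'.foldl (fun acc a => a :: acc) (g a) = l'.reverse ++ g a := by simp
      rw [h1]
      have h2 := sz_append l'.reverse (g a)
      have h3 := sz_le_of_sublist (h.sublist.reverse)
      rw [List.reverse_reverse] at h3
      omega
  simpa using this

lemma sz_flatten_le (l : List (List α)) : sz l.flatten ≤ sz l := by
  induction l with
  | nil => simp
  | cons a l ih =>
    have := sz_append a l.flatten
    simp only [List.flatten_cons, sz_cons]; omega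

@[fun_prop] lemma flatten {f : α → List (List β)} (hf : PTime f) :
    PTime fun a => (f a).flatten := by
  have := foldl (γ := α) (l := f) (i := fun _ => []) (g := fun _ acc a => acc ++ a)
    (by fun_prop) (by fun_prop) (by fun_prop) (fun a => sz (f a))
    hf.polyBounded_sz fun a l' h => by
      have h1 : ∀ acc, l'.foldl (fun acc a => acc ++ a) acc = acc ++ l'.flatten := by
        clear h
        induction l' with
        | nil => simp
        | cons a l ih => intro acc; simp [ih]
      rw [h1]
      exact (sz_flatten_le _).trans (sz_le_of_sublist h.sublist)
  refine this.of_code_eq (fun a => a) (fun _ => rfl) fun a => ?_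
  have h1 : ∀ (l' : List (List β)) acc,
      l'.foldl (fun acc a => acc ++ a) acc = acc ++ l'.flatten := by
    intro l'
    induction l' with
    | nil => simp
    | cons a l ih => intro acc; simp [ih]
  simp [h1]

@[fun_prop] lemma flatMap {l : γ → List α} {f : γ → α → List β} (hl : PTime l)
    (hf : PTime fun x : γ × α => f x.1 x.2) : PTime fun c => (l c).flatMap (f c) := by
  simp only [List.flatMap_def]
  exact (map hl hf).flatten

@[fun_prop] lemma filter {l : γ → List α} {f : γ → α → Bool} (hl : PTime l)
    (hf : PTime fun x : γ × α => f x.1 x.2) : PTime fun c => (l c).filter (f c) := by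
  have : PTime fun c => (l c).flatMap fun a => if f c a = true then [a] else [] := by
    apply flatMap hl; fun_prop
  refine this.of_code_eq (fun a => a) (fun _ => rfl) fun c => ?_
  congr 1
  induction l c with
  | nil => rfl
  | cons a l ih => by_cases h : f c a = true <;> simp_all

@[fun_prop] lemma not {f : α → Bool} (hf : PTime f) : PTime fun a => !f a := by
  have : PTime fun a => if f a = true then false else true := by fun_prop
  refine this.of_code_eq (fun a => a) (fun _ => rfl) fun c => ?_
  cases f c <;> rfl

@[fun_prop] lemma and {f g : α → Bool} (hf : PTime f) (hg : PTime g) :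
    PTime fun a => f a && g a := by
  have : PTime fun a => if f a = true then g a else false := by fun_prop
  refine this.of_code_eq (fun a => a) (fun _ => rfl) fun c => ?_
  cases f c <;> simp

@[fun_prop] lemma or {f g : α → Bool} (hf : PTime f) (hg : PTime g) :
    PTime fun a => f a || g a := by
  have : PTime fun a => if f a = true then true else g a := by fun_prop
  refine this.of_code_eq (fun a => a) (fun _ => rfl) fun c => ?_
  cases f c <;> simp

@[fun_prop] lemma decide_and {p q : α → Prop} [DecidablePred p] [DecidablePred q]
    (hp : PTime fun a => decide (p a)) (hq : PTime fun a => decide (q a)) :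
    PTime fun a => decide (p a ∧ q a) := by
  simpa using hp.and hq

@[fun_prop] lemma decide_or {p q : α → Prop} [DecidablePred p] [DecidablePred q]
    (hp : PTime fun a => decide (p a)) (hq : PTime fun a => decide (q a)) :
    PTime fun a => decide (p a ∨ q a) := by
  simpa using hp.or hq

@[fun_prop] lemma all {l : γ → List α} {f : γ → α → Bool} (hl : PTime l)
    (hf : PTime fun x : γ × α => f x.1 x.2) : PTime fun c => (l c).all (f c) := by
  have : PTime fun c => ((l c).filter fun a => !f c a).isEmpty := by
    apply isEmpty; apply filter hl; fun_prop
  refine this.of_code_eq (fun a => a) (fun _ => rfl) fun c => ?_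
  congr 1
  rw [Bool.eq_iff_iff]
  simp

/-- The list of `n` units has the same code as `n`. -/
lemma units {f : α → ℕ} (hf : PTime f) : PTime fun a => List.replicate (f a) () :=
  hf.of_code_eq (fun a => a) (fun _ => rfl) fun _ => code_replicate_unit _

@[fun_prop] lemma replicate {f : α → ℕ} {g : α → β} (hf : PTime f) (hg : PTime g) :
    PTime fun a => List.replicate (f a) (g a) := by
  have : PTime fun a => (List.replicate (f a) ()).map fun _ => g a := by
    apply map hf.units; fun_prop
  simpa using this

@[fun_prop] lemma length {f : α → List β} (hf : PTime f) : PTime fun a => (f a).length := by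
  have : PTime fun a => (f a).map fun _ => () := by apply map hf; fun_prop
  refine this.of_code_eq (fun a => a) (fun _ => rfl) fun c => ?_
  rw [← code_replicate_unit]; simp

@[fun_prop] lemma add {f g : α → ℕ} (hf : PTime f) (hg : PTime g) : PTime fun a => f a + g a := by
  have : PTime fun a => (List.replicate (f a) () ++ List.replicate (g a) ()).length :=
    (hf.units.append hg.units).length
  simpa using this

@[fun_prop] lemma mul {f g : α → ℕ} (hf : PTime f) (hg : PTime g) : PTime fun a => f a * g a := by
  have : PTime fun a => ((List.replicate (f a) ()).flatMap fun _ =>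
    List.replicate (g a) ()).length := by fun_prop
  refine this.of_code_eq (fun a => a) (fun _ => rfl) fun c => ?_
  simp

@[fun_prop] lemma sum {f : α → List ℕ} (hf : PTime f) : PTime fun a => (f a).sum := by
  have : PTime fun a => ((f a).flatMap fun n => List.replicate n ()).length := by
    fun_prop
  refine this.of_code_eq (fun a => a) (fun _ => rfl) fun c => ?_
  simp

@[fun_prop] lemma drop {f : α → List β} {g : α → ℕ} (hf : PTime f) (hg : PTime g) :
    PTime fun a => (f a).drop (g a) := by
  have hu := hg.units
  have h1 : ∀ (l : List Unit) (l' : List β),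
      l.foldl (fun acc _ => acc.tail) l' = l'.drop l.length := by
    intro l
    induction l with
    | nil => simp
    | cons a l ih => intro l'; simp [ih]
  have := foldl (γ := α) (l := fun a => List.replicate (g a) ()) (i := f)
    (g := fun _ acc _ => acc.tail)
    hu hf (by fun_prop) (fun a => sz (f a)) hf.polyBounded_sz fun a l' h => by
      rw [h1]
      exact sz_le_of_sublist (List.drop_sublist _ _)
  refine this.of_code_eq (fun a => a) (fun _ => rfl) fun c => ?_
  simp [h1]

@[fun_prop] lemma sub {f g : α → ℕ} (hf : PTime f) (hg : PTime g) : PTime fun a => f a - g a := by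
  have : PTime fun a => ((List.replicate (f a) ()).drop (g a)).length := by fun_prop
  simpa using this

@[fun_prop] lemma decide_le {f g : α → ℕ} (hf : PTime f) (hg : PTime g) :
    PTime fun a => decide (f a ≤ g a) := by
  have : PTime fun a => (List.replicate (f a - g a) ()).isEmpty := by fun_prop
  refine this.of_code_eq (fun a => a) (fun _ => rfl) fun c => ?_
  congr 1
  rw [Bool.eq_iff_iff, List.isEmpty_iff]
  simp [Nat.sub_eq_zero_iff_le]

@[fun_prop] lemma decide_lt {f g : α → ℕ} (hf : PTime f) (hg : PTime g) :
    PTime fun a => decide (f a < g a) := by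
  have : PTime fun a => decide (f a + 1 ≤ g a) := by fun_prop
  exact this

@[fun_prop] lemma decide_eq {f g : α → ℕ} (hf : PTime f) (hg : PTime g) :
    PTime fun a => decide (f a = g a) := by
  have : PTime fun a => decide (f a ≤ g a ∧ g a ≤ f a) := by fun_prop
  simpa only [← Nat.le_antisymm_iff] using this

@[fun_prop] lemma min {f g : α → ℕ} (hf : PTime f) (hg : PTime g) :
    PTime fun a => Min.min (f a) (g a) := by
  have : PTime fun a => if f a ≤ g a then f a else g a := by fun_prop
  exact this

@[fun_prop] lemma range {f : α → ℕ} (hf : PTime f) : PTime fun a => List.range (f a) := by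
  have hu := hf.units
  have h1 : ∀ (l : List Unit), l.foldl (fun (acc : List ℕ) _ => acc ++ [acc.length]) [] =
      List.range l.length := by
    intro l
    induction l using List.reverseRecOn with
    | nil => simp
    | append_singleton l a ih => simp [ih, List.range_succ]
  have := foldl (γ := α) (l := fun a => List.replicate (f a) ()) (i := fun _ => ([] : List ℕ))
    (g := fun _ acc _ => acc ++ [acc.length])
    hu (by fun_prop) (by fun_prop) (fun a => sz (f a) * (sz (f a) + 1) + 1)
    ((hf.polyBounded_sz.mul (hf.polyBounded_sz.add (.const 1))).add (.const 1)) fun a l' h => by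
      rw [h1]
      have hl := h.length_le
      simp only [List.length_replicate] at hl
      refine (sz_le_of_forall (B := sz (f a)) fun i hi => ?_).trans ?_
      · have := List.mem_range.1 hi
        simp only [sz_nat]; omega
      · rw [List.length_range]
        refine Nat.add_le_add_right (Nat.mul_le_mul_right _ ?_) 1
        rw [sz_nat]; omega
  refine this.of_code_eq (fun a => a) (fun _ => rfl) fun c => ?_
  simp [h1]

-- With unary numbers an exhaustive search is affordable: the quotient is the number of `q < f` with
-- `(q + 1) * g ≤ f`. The test `0 < g` gives the conventional value `0` for division by zero.
@[fun_prop] lemma div {f g : α → ℕ} (hf : PTime f) (hg : PTime g) : PTime fun a => f a / g a := by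
  have : PTime fun a => ((List.range (f a)).filter fun q =>
      decide (0 < g a ∧ (q + 1) * g a ≤ f a)).length := by fun_prop
  refine this.of_code_eq (fun a => a) (fun _ => rfl) fun c => ?_
  congr 1
  rcases Nat.eq_zero_or_pos (g c) with h | h
  · simp [h]
  · have h2 : ((List.range (f c)).filter fun q => decide (0 < g c ∧ (q + 1) * g c ≤ f c)) =
        (List.range (f c)).filter fun q => decide (q < f c / g c) := by
      refine List.filter_congr fun q _ => ?_
      rw [decide_eq_decide, ← Nat.le_div_iff_mul_le h]
      exact ⟨fun h' => h'.2, fun h' => ⟨h, h'⟩⟩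
    rw [h2, ← List.toFinset_card_of_nodup (List.nodup_range.filter _)]
    have h3 : ((List.range (f c)).filter fun q => decide (q < f c / g c)).toFinset =
        Finset.range (f c / g c) := by
      ext q
      simp only [List.mem_toFinset, List.mem_filter, List.mem_range, decide_eq_true_eq,
        Finset.mem_range]
      have := Nat.div_le_self (f c) (g c)
      omega
    rw [h3, Finset.card_range]

@[fun_prop] lemma getD {f : α → List β} {g : α → ℕ} {h : α → β} (hf : PTime f) (hg : PTime g)
    (hh : PTime h) : PTime fun a => (f a).getD (g a) (h a) := by
  have : PTime fun a => ((f a).drop (g a)).headD (h a) := by fun_prop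
  refine this.of_code_eq (fun a => a) (fun _ => rfl) fun c => ?_
  congr 1
  rw [List.getD_eq_getElem?_getD, List.headD_eq_head?_getD, List.head?_drop]

/-- Powers below a bound. -/
lemma pow_min {f g : α → ℕ} (B : ℕ) (hB : 1 ≤ B) (hf : PTime f) (hg : PTime g) :
    PTime fun a => Min.min (B ^ f a) (g a) := by
  have hu := hf.units
  -- Truncating at `M` after every multiplication agrees with truncating once at the end because `B
  -- ≥ 1`, and it keeps every intermediate unary number at most `M`.
  have h1 : ∀ (M : ℕ) (l : List Unit), l.foldl (fun (acc : ℕ) _ => Min.min (B * acc) M)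
      (Min.min 1 M) = Min.min (B ^ l.length) M := by
    intro M l
    induction l using List.reverseRecOn with
    | nil => simp
    | append_singleton l a ih =>
      simp only [List.foldl_append, ih, List.foldl_cons, List.foldl_nil, List.length_append,
        List.length_singleton, pow_succ']
      rcases le_total (B ^ l.length) M with h | h
      · rw [min_eq_left h]
      · rw [min_eq_right h, min_eq_right (Nat.le_mul_of_pos_left _ hB), min_eq_right]
        exact h.trans (Nat.le_mul_of_pos_left _ hB)
  have := foldl (γ := α) (l := fun a => List.replicate (f a) ()) (i := fun a => Min.min 1 (g a))
    (g := fun a acc _ => Min.min (B * acc) (g a))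
    hu (by fun_prop) (by fun_prop) (fun a => sz (g a)) hg.polyBounded_sz fun a l' h => by
      rw [h1]; simp only [sz_nat]; omega
  refine this.of_code_eq (fun a => a) (fun _ => rfl) fun c => ?_
  simp [h1]

-- The logarithm counts the `i` with `B ^ (i + 1) ≤ f`. Capping the power at `f + 1` does not change
-- its comparison with `f`.
@[fun_prop] lemma log {f : α → ℕ} (B : ℕ) (hf : PTime f) :
    PTime fun a => Nat.log B (f a) := by
  rcases Nat.lt_or_ge 1 B with hB | hB
  · have h1 : PTime fun x : α × ℕ => Min.min (B ^ (x.2 + 1)) (f x.1 + 1) :=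
      pow_min B (by omega) (by fun_prop) (by fun_prop)
    have : PTime fun a => ((List.range (f a)).filter fun i =>
        decide (Min.min (B ^ (i + 1)) (f a + 1) ≤ f a)).length := by fun_prop
    refine this.of_code_eq (fun a => a) (fun _ => rfl) fun c => ?_
    congr 1
    rw [← List.toFinset_card_of_nodup (List.nodup_range.filter _), ← Finset.card_range (Nat.log B (f c))]
    congr 1
    ext i
    simp only [List.mem_toFinset, List.mem_filter, List.mem_range, decide_eq_true_eq,
      Finset.mem_range, min_le_iff, Nat.not_succ_le_self, or_false]
    rcases Nat.eq_zero_or_pos (f c) with h | h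
    · simp [h]
    · rw [← Nat.le_log_iff_pow_le hB h.ne']
      have := Nat.log_lt_self B h.ne'
      omega
  · simp only [Nat.log_of_left_le_one hB]
    fun_prop

end PTime

/-! ### Composition under different measures, and the resulting programs -/

section
variable {α β γ σ : Type} [Coded α] [Coded β] [Coded γ] [Coded σ]

/-- Needed for `lists`, whose time is not polynomial in its input but in a measure that accounts for
its output. -/
lemma TimeIn.comp' {μ : α → ℕ} {ν : β → ℕ} {g : β → γ} {f : α → β} (hg : TimeIn ν g)
    (hf : TimeIn μ f) (hν : PolyBounded μ fun a => ν (f a)) : TimeIn μ fun a => g (f a) := by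
  obtain ⟨p, t, ht, hp⟩ := hf
  obtain ⟨q, u, hu, hq⟩ := hg
  refine ⟨fun b => .seq (p b) (q b), fun a => t a + u (f a), ht.add (hu.comp hν), fun a =>
    ⟨(hq (f a)).1.trans (Nat.le_add_left _ _), fun b s hb => ?_⟩⟩
  obtain ⟨k, s', e, h1, h2, h3⟩ := (hp a).2 b s hb
  obtain ⟨k', s'', e', h1', h2', h3'⟩ := (hq (f a)).2 b s' h1
  exact ⟨_, s'', e.seq e', h1', fun i hi => by rw [h2' i hi, h2 i hi], by dsimp only; omega⟩

lemma TimeIn.exists_program {μ : α → ℕ} {f : α → β} (hf : TimeIn μ f) :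
    ∃ (p : Program) (c : ℕ), ∀ a, p.OutputsWithin (code a) (code (f a)) (((μ a + 2) ^ c : ℕ) : ℝ) := by
  obtain ⟨p, t, ⟨c, hc⟩, hp⟩ := hf
  refine ⟨p 0, c, fun a => ?_⟩
  obtain ⟨k, s', e, h1, -, h3⟩ := (hp a).2 0 (Function.update (fun _ => Data.nil) 0 (code a))
    (by simp)
  exact ⟨k, s', e, h1, by exact_mod_cast h3.trans (hc a)⟩

/-! ### Enumeration of lists -/

/-- All lists of length `n` with entries in `A`. -/
def lists {α : Type} (A : List α) (n : ℕ) : List (List α) :=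
  (List.range n).foldl (fun acc _ => A.flatMap fun a => acc.map fun l => a :: l) [[]]

lemma lists_succ {α : Type} (A : List α) (n : ℕ) :
    lists A (n + 1) = A.flatMap fun a => (lists A n).map fun l => a :: l := by
  simp [lists, List.range_succ]

lemma mem_lists {α : Type} (A : List α) (n : ℕ) (l : List α) :
    l ∈ lists A n ↔ l.length = n ∧ ∀ a ∈ l, a ∈ A := by
  induction n generalizing l with
  | zero =>
    have : lists A 0 = [[]] := rfl
    rw [this, List.mem_singleton, List.length_eq_zero_iff]
    constructor
    · rintro rfl; simp
    · exact fun h => h.1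
  | succ n ih =>
    rw [lists_succ]
    simp only [List.mem_flatMap, List.mem_map, ih]
    constructor
    · rintro ⟨a, ha, l, ⟨h1, h2⟩, rfl⟩
      simp_all
    · rintro ⟨h1, h2⟩
      cases l with
      | nil => simp at h1
      | cons a l => exact ⟨a, h2 a (by simp), l, ⟨by simpa using h1, fun b hb => h2 b (by simp [hb])⟩, rfl⟩

lemma length_lists {α : Type} (A : List α) (n : ℕ) : (lists A n).length = A.length ^ n := by
  induction n with
  | zero => rfl
  | succ n ih =>
    rw [lists_succ, List.length_flatMap]
    simp [ih, pow_succ, mul_comm]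

/-- The measure contains the number of lists produced, since the output is exponential in the
length. -/
lemma TimeIn.lists :
    TimeIn (fun x : List α × ℕ => sz x + x.1.length ^ x.2) fun x => lists x.1 x.2 := by
  have hsz : PolyBounded (fun x : List α × ℕ => sz x + x.1.length ^ x.2) sz :=
    PolyBounded.self.mono fun x => Nat.le_add_right _ _
  have hp : PolyBounded (fun x : List α × ℕ => sz x + x.1.length ^ x.2)
      fun x => x.1.length ^ x.2 := PolyBounded.self.mono fun x => Nat.le_add_left _ _
  refine TimeIn.foldl (γ := List α × ℕ) (l := fun x => List.range x.2) (i := fun _ => [[]])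
    (g := fun x acc _ => x.1.flatMap fun a => acc.map fun l => a :: l)
    (PTime.timeIn (by fun_prop) hsz) (TimeIn.const _) hsz (by fun_prop)
    (fun x => (x.1.length ^ x.2 + 1) * (sz x * (sz x + 1) + 1 + 1) + 1)
    (((hp.add (.const 1)).mul (((hsz.mul (hsz.add (.const 1))).add (.const 1)).add (.const 1))).add
      (.const 1)) ?_
  rintro ⟨A, n⟩ l' h
  have h1 : l'.foldl (fun acc _ => A.flatMap fun a => acc.map fun l => a :: l) [[]] =
      FlowTime.lists A l'.length := by
    clear h
    induction l' using List.reverseRecOn with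
    | nil => rfl
    | append_singleton l a ih => simp [ih, lists_succ]
  have hl : l'.length ≤ n := by simpa using h.length_le
  dsimp only
  rw [h1]
  refine (sz_le_of_forall (B := sz (A, n) * (sz (A, n) + 1) + 1) fun l hl' => ?_).trans ?_
  · obtain ⟨h2, h3⟩ := (mem_lists _ _ _).1 hl'
    refine (sz_le_of_forall (B := sz (A, n)) fun a ha => ?_).trans ?_
    · have := sz_lt_of_mem (h3 a ha)
      simp only [sz_pair]; omega
    · refine Nat.add_le_add_right (Nat.mul_le_mul_right _ ?_) 1
      simp only [sz_pair, sz_nat]; omega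
  · rw [length_lists]
    refine Nat.add_le_add_right (Nat.mul_le_mul_right _ ?_) 1
    -- Over the empty alphabet the initial table has `0 ^ 0 = 1` entry, more than the final `0 ^ n`
    -- for `n > 0`; hence the `+ 1` in the bound.
    rcases Nat.eq_zero_or_pos A.length with h0 | h0
    · rw [h0]
      rcases Nat.eq_zero_or_pos l'.length with h | h
      · simp [h]
      · simp [zero_pow h.ne']
    · exact (Nat.pow_le_pow_right h0 hl).trans (Nat.le_succ _)

/-! ### Dynamic programming -/

/-- A list with a single element that minimizes `f`; the empty list if there is no element. -/
def best {α : Type} (f : α → ℕ) (l : List α) : List α :=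
  ((l.filter fun a => l.all fun b => decide (f a ≤ f b)).map fun a => [a]).headD []

lemma best_nil {α : Type} (f : α → ℕ) : best f [] = [] := rfl

lemma best_spec {α : Type} (f : α → ℕ) {l : List α} (hl : l ≠ []) :
    ∃ a ∈ l, best f l = [a] ∧ ∀ b ∈ l, f a ≤ f b := by
  have h1 : (l.filter fun a => l.all fun b => decide (f a ≤ f b)) ≠ [] := by
    obtain ⟨a, ha, hmin⟩ : ∃ a ∈ l, ∀ b ∈ l, f a ≤ f b := by
      classical
      obtain ⟨a, ha, h⟩ := Finset.exists_min_image l.toFinset f (by simpa using hl)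
      exact ⟨a, by simpa using ha, fun b hb => h b (by simpa using hb)⟩
    exact List.ne_nil_of_mem (a := a) (by simpa [ha] using hmin)
  obtain ⟨a, t, h2⟩ := List.exists_cons_of_ne_nil h1
  have ha : a ∈ l.filter fun a => l.all fun b => decide (f a ≤ f b) := by simp [h2]
  simp only [List.mem_filter, List.all_eq_true, decide_eq_true_eq] at ha
  exact ⟨a, ha.1, by simp [best, h2], ha.2⟩

lemma PTime.best {l : γ → List α} {f : γ → α → ℕ} (hl : PTime l)
    (hf : PTime fun x : γ × α => f x.1 x.2) : PTime fun c => best (f c) (l c) := by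
  have h1 : PTime fun x : (γ × α) × α => f x.1.1 x.2 :=
    hf.comp (f := fun x : (γ × α) × α => (x.1.1, x.2)) (by fun_prop)
  have h2 : PTime fun x : (γ × α) × α => f x.1.1 x.1.2 :=
    hf.comp (f := fun x : (γ × α) × α => (x.1.1, x.1.2)) (by fun_prop)
  unfold FlowTime.best
  fun_prop

/-- The total cost of a history (the last state comes first); `c` gives the cost of the first
element, given the rest of the history. -/
def total {σ : Type} (c : List σ → ℕ) (h : List σ) : ℕ :=
  ((List.range h.length).map fun i => c (h.drop i)).sum

lemma total_cons {σ : Type} (c : List σ → ℕ) (s : σ) (h : List σ) :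
    total c (s :: h) = c (s :: h) + total c h := by
  simp [total, List.range_succ_eq_map, Function.comp_def]

lemma PTime.total {h : γ → List σ} {c : γ → List σ → ℕ} (hh : PTime h)
    (hc : PTime fun x : γ × List σ => c x.1 x.2) : PTime fun g => total (c g) (h g) := by
  have h1 : PTime fun x : γ × ℕ => c x.1 ((h x.1).drop x.2) :=
    hc.comp (f := fun x : γ × ℕ => (x.1, (h x.1).drop x.2)) (by fun_prop)
  unfold FlowTime.total
  fun_prop

/-- The histories with states in `S`, all of whose steps are allowed by `ok`. -/
def IsHistory {σ : Type} (ok : List σ → Bool) (S : List σ) : List σ → Prop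
  | [] => True
  | s :: h => s ∈ S ∧ ok (s :: h) = true ∧ IsHistory ok S h

/-- For every state `s`, a cheapest history of length `t` that ends in `s`. -/
def dpTable {σ : Type} (ok : List σ → Bool) (c : List σ → ℕ) (S : List σ) (t : ℕ) :
    List (List σ) :=
  (List.range t).foldl (fun tab _ =>
    S.flatMap fun s => best (total c) ((tab.map fun h => s :: h).filter ok)) [[]]

/-- A cheapest history of length `t` with property `final`. -/
def dp {σ : Type} (ok : List σ → Bool) (c : List σ → ℕ) (S : List σ) (t : ℕ)
    (final : List σ → Bool) : List σ :=
  (best (total c) ((dpTable ok c S t).filter final)).headD []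

lemma dpTable_succ {σ : Type} (ok : List σ → Bool) (c : List σ → ℕ) (S : List σ) (t : ℕ) :
    dpTable ok c S (t + 1) = S.flatMap fun s =>
      best (total c) (((dpTable ok c S t).map fun h => s :: h).filter ok) := by
  simp [dpTable, List.range_succ]

lemma isHistory_of_mem_dpTable {σ : Type} {ok : List σ → Bool} {c : List σ → ℕ} {S : List σ}
    {t : ℕ} {h : List σ} (hh : h ∈ dpTable ok c S t) : IsHistory ok S h ∧ h.length = t := by
  induction t generalizing h with
  | zero =>
    have : h = [] := by simpa [dpTable] using hh
    subst this
    exact ⟨trivial, rfl⟩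
  | succ t ih =>
    rw [dpTable_succ, List.mem_flatMap] at hh
    obtain ⟨s, hs, hh⟩ := hh
    by_cases hn : ((dpTable ok c S t).map fun h => s :: h).filter ok = []
    · rw [hn, best_nil] at hh; simp at hh
    · obtain ⟨a, ha, h1, -⟩ := best_spec (total c) hn
      rw [h1, List.mem_singleton] at hh
      subst hh
      simp only [List.mem_filter, List.mem_map] at ha
      obtain ⟨⟨h', h2, rfl⟩, h3⟩ := ha
      exact ⟨⟨hs, h3, (ih h2).1⟩, by simp [(ih h2).2]⟩

/-- Bellman's principle: by `hmarkov` the tail of a history may be exchanged for the tabulated one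
of the same length and head without affecting whether the next step is allowed or what it costs. -/
lemma exists_mem_dpTable {σ : Type} {ok : List σ → Bool} {c : List σ → ℕ} {S : List σ}
    (hmarkov : ∀ s h h', h.length = h'.length → h.head? = h'.head? →
      ok (s :: h) = ok (s :: h') ∧ c (s :: h) = c (s :: h')) {h : List σ}
    (hh : IsHistory ok S h) :
    ∃ h' ∈ dpTable ok c S h.length, h'.head? = h.head? ∧ total c h' ≤ total c h := by
  induction h with
  | nil => exact ⟨[], by simp [dpTable], rfl, le_rfl⟩
  | cons s h ih =>
    obtain ⟨h1, h2, h3⟩ := hh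
    obtain ⟨h', h4, h5, h6⟩ := ih h3
    have h7 := hmarkov s h' h (isHistory_of_mem_dpTable h4).2 h5
    have h8 : s :: h' ∈ ((dpTable ok c S h.length).map fun h => s :: h).filter ok := by
      simp only [List.mem_filter, List.mem_map]
      exact ⟨⟨h', h4, rfl⟩, h7.1.trans h2⟩
    obtain ⟨a, ha, h9, h10⟩ := best_spec (total c) (List.ne_nil_of_mem h8)
    refine ⟨a, ?_, ?_, (h10 _ h8).trans ?_⟩
    · rw [List.length_cons, dpTable_succ, List.mem_flatMap]
      exact ⟨s, h1, by rw [h9]; simp⟩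
    · simp only [List.mem_filter, List.mem_map] at ha
      obtain ⟨⟨h'', -, rfl⟩, -⟩ := ha
      rfl
    · rw [total_cons, total_cons, h7.2]; omega

lemma dp_spec {σ : Type} {ok : List σ → Bool} {c : List σ → ℕ} {S : List σ}
    (hmarkov : ∀ s h h', h.length = h'.length → h.head? = h'.head? →
      ok (s :: h) = ok (s :: h') ∧ c (s :: h) = c (s :: h')) {final : List σ → Bool}
    (hfinal : ∀ h h', h.head? = h'.head? → final h = final h') {h : List σ}
    (hh : IsHistory ok S h) (hf : final h = true) :
    IsHistory ok S (dp ok c S h.length final) ∧ (dp ok c S h.length final).length = h.length ∧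
      final (dp ok c S h.length final) = true ∧
      total c (dp ok c S h.length final) ≤ total c h := by
  obtain ⟨h', h1, h2, h3⟩ := exists_mem_dpTable hmarkov hh
  have h4 : h' ∈ (dpTable ok c S h.length).filter final := by
    simp only [List.mem_filter]
    exact ⟨h1, (hfinal _ _ h2).trans hf⟩
  obtain ⟨a, ha, h5, h6⟩ := best_spec (total c) (List.ne_nil_of_mem h4)
  have h7 : dp ok c S h.length final = a := by simp [dp, h5]
  rw [h7]
  simp only [List.mem_filter] at ha
  exact ⟨(isHistory_of_mem_dpTable ha.1).1, (isHistory_of_mem_dpTable ha.1).2, ha.2,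
    (h6 _ h4).trans h3⟩

lemma length_best_le {α : Type} (f : α → ℕ) (l : List α) : (best f l).length ≤ 1 := by
  rcases eq_or_ne l [] with rfl | hl
  · simp [best_nil]
  · obtain ⟨a, -, h, -⟩ := best_spec f hl
    simp [h]

/-- At most one history per state survives, so the table stays small although the number of
histories does not. The `+ 1` accounts for the initial table, which holds the empty history even if
`S` is empty. -/
lemma length_dpTable_le {σ : Type} (ok : List σ → Bool) (c : List σ → ℕ) (S : List σ) (t : ℕ) :
    (dpTable ok c S t).length ≤ S.length + 1 := by
  cases t with
  | zero => simp [dpTable]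
  | succ t =>
    rw [dpTable_succ, List.length_flatMap]
    refine (List.sum_le_card_nsmul _ 1 ?_).trans (by simp)
    intro x hx
    obtain ⟨s, -, rfl⟩ := List.mem_map.1 hx
    exact length_best_le _ _

lemma IsHistory.forall_mem {σ : Type} {ok : List σ → Bool} {S : List σ} {h : List σ}
    (hh : IsHistory ok S h) : ∀ s ∈ h, s ∈ S := by
  induction h with
  | nil => simp
  | cons a h ih =>
    intro s hs
    rcases List.mem_cons.1 hs with rfl | hs
    · exact hh.1
    · exact ih hh.2.2 s hs

lemma PTime.dp {ok : γ → List σ → Bool} {c : γ → List σ → ℕ} {S : γ → List σ} {t : γ → ℕ}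
    {final : γ → List σ → Bool} (hok : PTime fun x : γ × List σ => ok x.1 x.2)
    (hc : PTime fun x : γ × List σ => c x.1 x.2) (hS : PTime S) (ht : PTime t)
    (hfinal : PTime fun x : γ × List σ => final x.1 x.2) :
    PTime fun g => dp (ok g) (c g) (S g) (t g) (final g) := by
  have htab : PTime fun g => dpTable (ok g) (c g) (S g) (t g) := by
    unfold dpTable
    refine PTime.foldl (l := fun g => List.range (t g)) (i := fun _ => [[]])
      (g := fun g tab _ => (S g).flatMap fun s =>
        FlowTime.best (FlowTime.total (c g)) ((tab.map fun h => s :: h).filter (ok g)))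
      (by fun_prop) (by fun_prop) ?_
      (fun g => (sz (S g) + 1) * (sz (t g) * (sz (S g) + 1) + 1 + 1) + 1)
      (((hS.polyBounded_sz.add (.const 1)).mul (((ht.polyBounded_sz.mul
        (hS.polyBounded_sz.add (.const 1))).add (.const 1)).add (.const 1))).add (.const 1)) ?_
    · apply PTime.flatMap (hS.comp (by fun_prop))
      apply PTime.best
      · apply PTime.filter (by fun_prop)
        exact hok.comp (f := fun x : ((γ × List (List σ) × ℕ) × σ) × List σ => (x.1.1.1, x.2))
          (by fun_prop)
      · apply PTime.total (by fun_prop)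
        exact hc.comp (f := fun x : (((γ × List (List σ) × ℕ) × σ) × List σ) × List σ =>
          (x.1.1.1.1, x.2)) (by fun_prop)
    · intro g l' h
      have h1 : l'.foldl (fun tab _ => (S g).flatMap fun s => FlowTime.best (FlowTime.total (c g))
          ((tab.map fun h => s :: h).filter (ok g))) [[]] = dpTable (ok g) (c g) (S g) l'.length := by
        clear h
        induction l' using List.reverseRecOn with
        | nil => rfl
        | append_singleton l a ih => simp [ih, dpTable_succ]
      have hl : l'.length ≤ t g := by simpa using h.length_le
      rw [h1]
      refine (sz_le_of_forall (B := sz (t g) * (sz (S g) + 1) + 1) fun l hl' => ?_).trans ?_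
      · obtain ⟨h2, h3⟩ := isHistory_of_mem_dpTable hl'
        refine (sz_le_of_forall (B := sz (S g)) fun a ha =>
          (sz_lt_of_mem (h2.forall_mem a ha)).le).trans ?_
        refine Nat.add_le_add_right (Nat.mul_le_mul_right _ ?_) 1
        rw [sz_nat]; omega
      · refine Nat.add_le_add_right (Nat.mul_le_mul_right _ ?_) 1
        have := length_dpTable_le (ok g) (c g) (S g) l'.length
        have := length_lt_sz (S g)
        omega
  unfold FlowTime.dp
  apply PTime.headD _ (by fun_prop)
  apply PTime.best
  · exact PTime.filter htab hfinal
  · apply PTime.total (by fun_prop)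
    exact hc.comp (f := fun x : (γ × List σ) × List σ => (x.1.1, x.2)) (by fun_prop)

end

/-! ### Layered shortest paths -/

section
variable {α β γ σ : Type} [Coded α] [Coded β] [Coded γ] [Coded σ]

/-- The state before time `t` in a sequence of states; `d` is the initial state. -/
def prev {σ : Type} (d : σ) (f : ℕ → σ) : ℕ → σ
  | 0 => d
  | t + 1 => f t

/-- The history `f t, …, f 1, f 0` of length `t + 1`, for `n = t + 1`. -/
def histOf {σ : Type} (f : ℕ → σ) : ℕ → List σ
  | 0 => []
  | t + 1 => f t :: histOf f t

lemma length_histOf {σ : Type} (f : ℕ → σ) (n : ℕ) : (histOf f n).length = n := by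
  induction n with
  | zero => rfl
  | succ n ih => simp [histOf, ih]

lemma headD_histOf {σ : Type} (d : σ) (f : ℕ → σ) (n : ℕ) :
    (histOf f n).headD d = prev d f n := by
  cases n <;> rfl

/-- Histories list the latest state first, so the state of time `t` sits at position `length - 1 -
t`. -/
lemma eq_histOf {σ : Type} (d : σ) (h : List σ) :
    h = histOf (fun t => h.getD (h.length - 1 - t) d) h.length := by
  have key : ∀ (h : List σ) (f : ℕ → σ), (∀ t < h.length, f t = h.getD (h.length - 1 - t) d) →
      h = histOf f h.length := by
    intro h
    induction h with
    | nil => intro f _; rfl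
    | cons s h ih =>
      intro f hf
      simp only [List.length_cons, histOf]
      rw [← ih f, hf h.length (by simp)]
      · simp
      · intro t ht
        rw [hf t (by simp; omega)]
        have : (s :: h).length - 1 - t = (h.length - 1 - t) + 1 := by simp only [List.length_cons]; omega
        rw [this, List.getD_cons_succ]
  exact key h _ fun _ _ => rfl

/-- A function of the time, the previous state and the current state, as a function of the
history. -/
def onHistory {σ β : Type} (d : σ) (f : ℕ → σ → σ → β) (h : List σ) : β :=
  f h.tail.length (h.tail.headD d) (h.headD d)

lemma isHistory_histOf {σ : Type} {d : σ} {ok : ℕ → σ → σ → Bool} {S : List σ} {f : ℕ → σ}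
    {n : ℕ} : IsHistory (onHistory d ok) S (histOf f n) ↔
      ∀ t < n, f t ∈ S ∧ ok t (prev d f t) (f t) = true := by
  induction n with
  | zero => simp [histOf, IsHistory]
  | succ n ih =>
    simp only [histOf, IsHistory, ih, onHistory, List.tail_cons, length_histOf, headD_histOf,
      List.headD_cons, Nat.lt_succ_iff_lt_or_eq]
    constructor
    · rintro ⟨h1, h2, h3⟩ t (ht | rfl)
      exacts [h3 t ht, ⟨h1, h2⟩]
    · intro h
      exact ⟨(h n (.inr rfl)).1, (h n (.inr rfl)).2, fun t ht => h t (.inl ht)⟩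

lemma total_histOf {σ : Type} {d : σ} {c : ℕ → σ → σ → ℕ} {f : ℕ → σ} {n : ℕ} :
    total (onHistory d c) (histOf f n) = ∑ t ∈ range n, c t (prev d f t) (f t) := by
  induction n with
  | zero => rfl
  | succ n ih =>
    rw [histOf, total_cons, ih, sum_range_succ, add_comm]
    simp only [onHistory, List.tail_cons, length_histOf, headD_histOf, List.headD_cons]

/-- A cheapest sequence of states for the times `0, …, N`, the last one first. -/
def shortest {σ : Type} (d : σ) (ok : ℕ → σ → σ → Bool) (c : ℕ → σ → σ → ℕ) (S : List σ) (N : ℕ)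
    (final : σ → Bool) : List σ :=
  dp (onHistory d ok) (onHistory d c) S (N + 1) fun h => final (h.headD d)

/-- The first conjunct ties `g` to the computed list, which does not depend on `f`. Thus one
computed sequence can be compared with several competitors `f`. -/
lemma shortest_spec {σ : Type} (d : σ) {ok : ℕ → σ → σ → Bool} {c : ℕ → σ → σ → ℕ} {S : List σ}
    {N : ℕ} {final : σ → Bool} {f : ℕ → σ}
    (hf : ∀ t ≤ N, f t ∈ S ∧ ok t (prev d f t) (f t) = true) (hfinal : final (f N) = true) :
    ∃ g : ℕ → σ, (∀ t ≤ N, g t = (shortest d ok c S N final).getD (N - t) d) ∧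
      (∀ t ≤ N, g t ∈ S ∧ ok t (prev d g t) (g t) = true) ∧ final (g N) = true ∧
      ∑ t ∈ range (N + 1), c t (prev d g t) (g t) ≤ ∑ t ∈ range (N + 1), c t (prev d f t) (f t) := by
  have h1 : IsHistory (onHistory d ok) S (histOf f (N + 1)) :=
    isHistory_histOf.2 fun t ht => hf t (Nat.lt_succ_iff.1 ht)
  obtain ⟨h2, h3, h4, h5⟩ := dp_spec (c := onHistory d c) (final := fun h => final (h.headD d))
    (by
      intro s h h' hl hh
      have : h.headD d = h'.headD d := by simp [List.headD_eq_head?_getD, hh]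
      simp only [onHistory, List.tail_cons, List.headD_cons, hl, this, and_self])
    (by intro h h' hh; simp [List.headD_eq_head?_getD, hh]) h1 (by simpa [histOf] using hfinal)
  rw [length_histOf] at h2 h3 h4 h5
  change IsHistory _ S (shortest d ok c S N final) at h2
  change (shortest d ok c S N final).length = _ at h3
  change final ((shortest d ok c S N final).headD d) = true at h4
  change total (onHistory d c) (shortest d ok c S N final) ≤ _ at h5
  set h := shortest d ok c S N final
  have h6 := eq_histOf d h
  set g : ℕ → σ := fun t => h.getD (h.length - 1 - t) d
  rw [h3] at h6
  refine ⟨g, fun t _ => ?_, ?_, ?_, ?_⟩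
  · simp only [g, h3]; rfl
  · rw [h6] at h2
    exact fun t ht => isHistory_histOf.1 h2 t (Nat.lt_succ_iff.2 ht)
  · rw [h6] at h4; simpa [histOf] using h4
  · rwa [h6, total_histOf, total_histOf] at h5

lemma PTime.shortest {d : σ} {ok : γ → ℕ → σ → σ → Bool} {c : γ → ℕ → σ → σ → ℕ}
    {S : γ → List σ} {N : γ → ℕ} {final : γ → σ → Bool}
    (hok : PTime fun x : γ × ℕ × σ × σ => ok x.1 x.2.1 x.2.2.1 x.2.2.2)
    (hc : PTime fun x : γ × ℕ × σ × σ => c x.1 x.2.1 x.2.2.1 x.2.2.2) (hS : PTime S) (hN : PTime N)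
    (hfinal : PTime fun x : γ × σ => final x.1 x.2) :
    PTime fun g => shortest d (ok g) (c g) (S g) (N g) (final g) := by
  unfold FlowTime.shortest
  apply PTime.dp
  · exact hok.comp (f := fun x : γ × List σ =>
      (x.1, x.2.tail.length, x.2.tail.headD d, x.2.headD d)) (by fun_prop)
  · exact hc.comp (f := fun x : γ × List σ =>
      (x.1, x.2.tail.length, x.2.tail.headD d, x.2.headD d)) (by fun_prop)
  · exact hS
  · fun_prop
  · exact hfinal.comp (f := fun x : γ × List σ => (x.1, x.2.headD d)) (by fun_prop)

/-! ### Sums and bounded quantifiers -/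

/-- The sum of `f i` over `i < n`. -/
def sumTo (n : ℕ) (f : ℕ → ℕ) : ℕ := ((List.range n).map f).sum

/-- Test whether `f i` holds for all `i < n`. -/
def allTo (n : ℕ) (f : ℕ → Bool) : Bool := (List.range n).all f

lemma sumTo_eq (n : ℕ) (f : ℕ → ℕ) : sumTo n f = ∑ i ∈ range n, f i := by
  induction n with
  | zero => rfl
  | succ n ih =>
    rw [sum_range_succ, ← ih]
    simp [sumTo, List.range_succ]

lemma allTo_iff {n : ℕ} {f : ℕ → Bool} : allTo n f = true ↔ ∀ i < n, f i = true := by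
  simp [allTo]

@[fun_prop] lemma PTime.sumTo {n : γ → ℕ} {f : γ → ℕ → ℕ} (hn : PTime n)
    (hf : PTime fun x : γ × ℕ => f x.1 x.2) : PTime fun g => sumTo (n g) (f g) := by
  unfold FlowTime.sumTo; fun_prop

@[fun_prop] lemma PTime.allTo {n : γ → ℕ} {f : γ → ℕ → Bool} (hn : PTime n)
    (hf : PTime fun x : γ × ℕ => f x.1 x.2) : PTime fun g => allTo (n g) (f g) := by
  unfold FlowTime.allTo; fun_prop

end

/-! ### Classes of numbers of almost the same size -/

/-- Positive numbers with the same value of `sizeClass q` differ at most by a factor `1 + 1 / q`. -/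
def sizeClass (q x : ℕ) : ℕ := Nat.log 2 x * q + (x - 2 ^ Nat.log 2 x) * q / 2 ^ Nat.log 2 x

@[fun_prop] lemma PTime.sizeClass {γ : Type} [Coded γ] {f : γ → ℕ} (q : ℕ) (hf : PTime f) :
    PTime fun g => sizeClass q (f g) := by
  have h : PTime fun g => Min.min (2 ^ Nat.log 2 (f g)) (f g + 1) :=
    PTime.pow_min 2 (by norm_num) (by fun_prop) (by fun_prop)
  have h2 : ∀ x, Min.min (2 ^ Nat.log 2 x) (x + 1) = 2 ^ Nat.log 2 x := fun x => by
    rcases Nat.eq_zero_or_pos x with h | h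
    · simp [h]
    · exact min_eq_left ((Nat.pow_log_le_self 2 h.ne').trans (Nat.le_succ _))
  simp only [h2] at h
  unfold FlowTime.sizeClass
  fun_prop

lemma sizeClass_frac_lt {q x : ℕ} (hq : 1 ≤ q) (hx : 1 ≤ x) :
    (x - 2 ^ Nat.log 2 x) * q / 2 ^ Nat.log 2 x < q := by
  have h1 := Nat.lt_pow_succ_log_self (b := 2) (by norm_num) x
  rw [Nat.div_lt_iff_lt_mul (by positivity), mul_comm]
  apply Nat.mul_lt_mul_of_pos_left _ (by omega)
  rw [pow_succ] at h1
  have : 0 < 2 ^ Nat.log 2 x := by positivity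
  omega

lemma sizeClass_lt {q x M : ℕ} (hq : 1 ≤ q) (hx : 1 ≤ x) (hM : x ≤ M) :
    sizeClass q x < q * (Nat.log 2 M + 1) := by
  have h1 := sizeClass_frac_lt hq hx
  have h2 : Nat.log 2 x ≤ Nat.log 2 M := Nat.log_mono_right hM
  unfold sizeClass
  nlinarith

/-- Uniqueness of digits in mixed radix; it recovers the components of the classes and keys that are
packed into single numbers. -/
lemma mul_add_inj {q a b c d : ℕ} (hb : b < q) (hd : d < q) (h : a * q + b = c * q + d) :
    a = c ∧ b = d := by
  have hq : 0 < q := by omega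
  have h1 : (a * q + b) / q = a := by
    rw [mul_comm, Nat.mul_add_div hq, Nat.div_eq_of_lt hb, add_zero]
  have h2 : (c * q + d) / q = c := by
    rw [mul_comm, Nat.mul_add_div hq, Nat.div_eq_of_lt hd, add_zero]
  have h3 : a = c := by rw [← h1, h, h2]
  subst h3
  exact ⟨rfl, by omega⟩

lemma mul_le_of_div_eq {q a b d : ℕ} (hd : 0 < d) (h : a * q / d = b * q / d) :
    q * a ≤ q * b + d := by
  have h1 := Nat.lt_div_mul_add hd (a := a * q)
  have h2 := Nat.div_mul_le_self (b * q) d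
  rw [h] at h1
  linarith [mul_comm a q, mul_comm b q]

/-- Equal classes mean the same leading power `2 ^ a`, and remainders above it that differ by at
most `2 ^ a / q`, which is at most `y / q`. -/
lemma sizeClass_ratio {q x y : ℕ} (hq : 1 ≤ q) (hx : 1 ≤ x) (hy : 1 ≤ y)
    (h : sizeClass q x = sizeClass q y) : q * x ≤ (q + 1) * y := by
  obtain ⟨h1, h2⟩ := mul_add_inj (sizeClass_frac_lt hq hx) (sizeClass_frac_lt hq hy) h
  rw [h1] at h2
  have h3 := mul_le_of_div_eq (by positivity) h2
  have hx' := Nat.pow_log_le_self 2 (by omega : x ≠ 0)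
  have hy' := Nat.pow_log_le_self 2 (by omega : y ≠ 0)
  rw [h1] at hx'
  obtain ⟨a, rfl⟩ := Nat.exists_eq_add_of_le hx'
  obtain ⟨b, hb⟩ := Nat.exists_eq_add_of_le hy'
  rw [Nat.add_sub_cancel_left] at h3
  have h4 : y - 2 ^ Nat.log 2 y = b := by omega
  rw [h4] at h3
  nlinarith

/-! ### Exchanging a set of jobs by the latest jobs of its class -/

/-- This is the origin of the factor 2. Comparing the smallest element of `F` with the largest of
`A` gives `q(|F| - 1) ≤ (q + 1)|A|`. The strict inequality forces `A` to be nonempty, so the omitted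
element is paid for by `1 ≤ |A|`. -/
lemma card_le_of_sum_erase_lt {ι : Type*} [DecidableEq ι] {F A : Finset ι} {p : ι → ℕ} {q : ℕ}
    (hp : ∀ i ∈ F, 1 ≤ p i) (hpq : ∀ i ∈ F, ∀ j ∈ A, q * p j ≤ (q + 1) * p i) {i₀ : ι}
    (hi₀ : i₀ ∈ F) (h : ∑ i ∈ F.erase i₀, p i < ∑ j ∈ A, p j) :
    q * F.card ≤ (2 * q + 1) * A.card := by
  have hA : A.Nonempty := by
    rw [nonempty_iff_ne_empty]; rintro rfl; simp at h
  obtain ⟨i, hi, hmin⟩ := exists_min_image F p ⟨i₀, hi₀⟩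
  obtain ⟨j, hj, hmax⟩ := exists_max_image A p hA
  have h1 : (F.card - 1) * p i ≤ ∑ i ∈ F.erase i₀, p i := by
    rw [← card_erase_of_mem hi₀, ← smul_eq_mul]
    exact card_nsmul_le_sum _ _ _ fun k hk => hmin k (mem_of_mem_erase hk)
  have h2 : ∑ j ∈ A, p j ≤ A.card * p j := by
    rw [← smul_eq_mul]; exact sum_le_card_nsmul _ _ _ hmax
  have h3 := hpq i hi j hj
  have h4 := hp i hi
  have h5 : 1 ≤ F.card := card_pos.2 ⟨i, hi⟩
  have h6 : 1 ≤ A.card := card_pos.2 hA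
  obtain ⟨f, hf⟩ := Nat.exists_eq_add_of_le h5
  rw [hf] at h1 ⊢
  rw [Nat.add_sub_cancel_left] at h1
  have h7 : q * f * p i ≤ (q + 1) * A.card * p i := by
    calc q * f * p i = q * (f * p i) := by ring
      _ ≤ q * (A.card * p j) := Nat.mul_le_mul_left _ (by omega)
      _ = A.card * (q * p j) := by ring
      _ ≤ A.card * ((q + 1) * p i) := Nat.mul_le_mul_left _ h3
      _ = _ := by ring
  have h8 := Nat.le_of_mul_le_mul_right h7 h4
  nlinarith

/-- Summing the hypothesis on `f` over all pairs in `F × A` turns the bound for cardinalities into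
one for costs. -/
lemma sum_le_of_sum_erase_lt {ι : Type*} [DecidableEq ι] {F A : Finset ι} {p f : ι → ℕ}
    {q D N : ℕ} (hp : ∀ i ∈ F, 1 ≤ p i) (hpq : ∀ i ∈ F, ∀ j ∈ A, q * p j ≤ (q + 1) * p i) {i₀ : ι}
    (hi₀ : i₀ ∈ F) (h : ∑ i ∈ F.erase i₀, p i < ∑ j ∈ A, p j)
    (hf : ∀ i ∈ F, ∀ j ∈ A, D * f i ≤ N * f j) :
    q * D * ∑ i ∈ F, f i ≤ (2 * q + 1) * N * ∑ j ∈ A, f j := by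
  have hA : 0 < A.card := by
    rw [card_pos, nonempty_iff_ne_empty]; rintro rfl; simp at h
  have h1 := card_le_of_sum_erase_lt hp hpq hi₀ h
  have h2 : A.card * (D * ∑ i ∈ F, f i) ≤ F.card * (N * ∑ j ∈ A, f j) := by
    calc A.card * (D * ∑ i ∈ F, f i) = ∑ i ∈ F, ∑ j ∈ A, D * f i := by
          simp [mul_sum, sum_const, mul_left_comm]
      _ ≤ ∑ i ∈ F, ∑ j ∈ A, N * f j := sum_le_sum fun i hi => sum_le_sum fun j hj => hf i hi j hj
      _ = _ := by simp [mul_sum, sum_const]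
  refine Nat.le_of_mul_le_mul_left ?_ hA
  calc A.card * (q * D * ∑ i ∈ F, f i) = q * (A.card * (D * ∑ i ∈ F, f i)) := by ring
    _ ≤ q * (F.card * (N * ∑ j ∈ A, f j)) := Nat.mul_le_mul_left _ h2
    _ = (q * F.card) * (N * ∑ j ∈ A, f j) := by ring
    _ ≤ ((2 * q + 1) * A.card) * (N * ∑ j ∈ A, f j) := Nat.mul_le_mul_right _ h1
    _ = _ := by ring

/-! ### First-in-first-out schedules of job classes

Jobs are numbered `0, …, n - 1`; `κ i` is the class of job `i`.  Inside a class, the jobs are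
processed in the order of their release. -/

section
variable (n : ℕ) (r p κ : ℕ → ℕ)

/-- The total processing time of the jobs of class `c` that are released before time `t`. -/
def releasedBefore (t c : ℕ) : ℕ := sumTo n fun i => if κ i = c ∧ r i < t then p i else 0

/-- The total processing time of job `j` and the jobs of its class that are released earlier. -/
def volumeUpTo (j : ℕ) : ℕ :=
  sumTo n fun i => if κ i = κ j ∧ (r i < r j ∨ (r i = r j ∧ i ≤ j)) then p i else 0

/-- The processed volumes of the classes may change from `v` to `v'` in the time slot before `t`. -/
def VolumeStep (L t : ℕ) (v v' : ℕ → ℕ) : Prop :=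
  (∀ c < L, v c ≤ v' c ∧ v' c ≤ releasedBefore n r p κ t c) ∧ ∑ c ∈ range L, (v' c - v c) ≤ 1

/-- Job `j` is processed when the processed volumes change from `v` to `v'`. -/
def Runs (v v' : ℕ → ℕ) (j : ℕ) : Prop :=
  v' (κ j) = v (κ j) + 1 ∧ volumeUpTo n r p κ j ≤ v (κ j) + p j ∧ v (κ j) < volumeUpTo n r p κ j

instance (v v' : ℕ → ℕ) : DecidablePred (Runs n r p κ v v') := fun j => by
  unfold Runs; infer_instance

end

section
variable {n : ℕ} {r p κ : ℕ → ℕ} {L : ℕ}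

/-- In the processed volume of its class, job `j` occupies the interval `[volumeUpTo j - p j,
volumeUpTo j)`. These intervals are disjoint and ordered by release. -/
lemma volumeUpTo_add_le {i j : ℕ} (hj : j < n) (hκ : κ i = κ j)
    (h : r i < r j ∨ (r i = r j ∧ i < j)) :
    volumeUpTo n r p κ i + p j ≤ volumeUpTo n r p κ j := by
  simp only [volumeUpTo, sumTo_eq, ← sum_filter]
  have hj' : j ∉ (range n).filter fun k => κ k = κ i ∧ (r k < r i ∨ (r k = r i ∧ k ≤ i)) := by
    simp only [mem_filter, mem_range]; omega
  rw [add_comm, ← sum_insert hj']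
  refine sum_le_sum_of_subset fun k hk => ?_
  simp only [mem_insert, mem_filter, mem_range] at hk ⊢
  rcases hk with rfl | hk <;> omega

/-- Jobs of different classes would use two units of volume in one slot; within a class the volume
intervals are disjoint. -/
lemma Runs.unique {v v' : ℕ → ℕ} {t : ℕ} (hv : VolumeStep n r p κ L t v v') {i j : ℕ}
    (hi : i < n) (hj : j < n) (hiL : κ i < L) (hjL : κ j < L) (h1 : Runs n r p κ v v' i)
    (h2 : Runs n r p κ v v' j) : i = j := by
  have hκ : κ i = κ j := by
    by_contra hne
    have h3 := hv.2
    have h4 : ∑ c ∈ {κ i, κ j}, (v' c - v c) ≤ ∑ c ∈ range L, (v' c - v c) :=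
      sum_le_sum_of_subset (by intro c hc; simp at hc ⊢; omega)
    rw [sum_pair hne, h1.1, h2.1] at h4
    omega
  by_contra hne
  obtain ⟨-, h3, h4⟩ := h1
  obtain ⟨-, h5, h6⟩ := h2
  rw [hκ] at h3 h4
  rcases lt_trichotomy (r i) (r j) with h | h | h
  · have := volumeUpTo_add_le (p := p) hj hκ (.inl h); omega
  · rcases lt_or_gt_of_ne hne with h' | h'
    · have := volumeUpTo_add_le (p := p) hj hκ (.inr ⟨h, h'⟩); omega
    · have := volumeUpTo_add_le (p := p) hi hκ.symm (.inr ⟨h.symm, h'⟩); omega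
  · have := volumeUpTo_add_le (p := p) hi hκ.symm (.inl h); omega

lemma exists_step_eq {v : ℕ → ℕ} {N y : ℕ} (hstep : ∀ t < N, v (t + 1) ≤ v t + 1) (h0 : v 0 ≤ y)
    (hN : y < v N) : ∃ u < N, v u = y ∧ v (u + 1) = y + 1 := by
  induction N with
  | zero => omega
  | succ N ih =>
    by_cases h : y < v N
    · obtain ⟨u, hu, h'⟩ := ih (fun t ht => hstep t (by omega)) h
      exact ⟨u, by omega, h'⟩
    · have := hstep N (by omega)
      exact ⟨N, by omega, by omega, by omega⟩

variable {v : ℕ → ℕ → ℕ} {N : ℕ}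

lemma volume_mono (hv : ∀ t ≤ N, VolumeStep n r p κ L t (prev 0 v t) (v t)) {c : ℕ} (hc : c < L)
    {s t : ℕ} (hst : s ≤ t) (ht : t ≤ N) : v s c ≤ v t c := by
  induction t, hst using Nat.le_induction with
  | base => exact le_rfl
  | succ t hst ih => exact (ih (by omega)).trans ((hv (t + 1) ht).1 c hc).1

/-- Every job receives its processing time between its release and its completion. -/
lemma le_card_runs (hv : ∀ t ≤ N, VolumeStep n r p κ L t (prev 0 v t) (v t)) {j : ℕ} (hj : j < n)
    (hjL : κ j < L) (hN : volumeUpTo n r p κ j ≤ v N (κ j)) :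
    p j ≤ ((range N).filter fun u => Runs n r p κ (v u) (v (u + 1)) j ∧ r j ≤ u ∧
      u < r j + ((range (N + 1)).filter fun t =>
        r j ≤ t ∧ v t (κ j) < volumeUpTo n r p κ j).card).card := by
  set U := (range N).filter fun u => Runs n r p κ (v u) (v (u + 1)) j ∧ r j ≤ u ∧
      u < r j + ((range (N + 1)).filter fun t =>
        r j ≤ t ∧ v t (κ j) < volumeUpTo n r p κ j).card with hU
  set b := volumeUpTo n r p κ j with hb
  have hpb : p j ≤ b := by
    simp only [hb, volumeUpTo, sumTo_eq, ← sum_filter]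
    exact single_le_sum (f := p) (fun _ _ => Nat.zero_le _) (by simp [hj])
  -- Each of the `p j` volume levels of job `j` is crossed in some slot, and distinct levels belong
  -- to distinct slots.
  have h1 : Ico (b - p j) b ⊆ U.image fun u => v u (κ j) := by
    intro y hy
    rw [mem_Ico] at hy
    obtain ⟨u, hu, h2, h3⟩ := exists_step_eq (v := fun t => v t (κ j)) (N := N) (y := y)
      (fun t ht => by
        have h4 := (hv (t + 1) (by omega)).2
        have h5 := single_le_sum (f := fun c => v (t + 1) c - prev 0 v (t + 1) c)
          (fun _ _ => Nat.zero_le _) (mem_range.2 hjL)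
        simp only [prev] at h4 h5 ⊢
        omega) (by
        have := ((hv 0 (by omega)).1 _ hjL).2
        simp [releasedBefore, sumTo_eq] at this
        omega) (by omega)
    -- In a slot before the release of `j`, the class volume is bounded by what has been released,
    -- which is at most `b - p j`.
    have hru : r j ≤ u := by
      by_contra hlt
      have h6 := ((hv (u + 1) (by omega)).1 _ hjL).2
      rw [h3] at h6
      have h7 : releasedBefore n r p κ (u + 1) (κ j) + p j ≤ b := by
        simp only [hb, releasedBefore, volumeUpTo, sumTo_eq, ← sum_filter]
        have hj' : j ∉ (range n).filter fun i => κ i = κ j ∧ r i < u + 1 := by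
          simp only [mem_filter, mem_range]; omega
        rw [add_comm, ← sum_insert hj']
        refine sum_le_sum_of_subset fun k hk => ?_
        simp only [mem_insert, mem_filter, mem_range] at hk ⊢
        rcases hk with rfl | hk <;> omega
      omega
    refine mem_image.2 ⟨u, ?_, h2⟩
    simp only [hU, mem_filter, mem_range]
    refine ⟨hu, ⟨by omega, by omega, by omega⟩, hru, ?_⟩
    -- Job `j` is pending at all times from `r j` to `u`, so the slot `u` ends no later than `r j`
    -- plus the number of pending times.
    have h8 : Icc (r j) u ⊆ (range (N + 1)).filter fun t => r j ≤ t ∧ v t (κ j) < b := by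
      intro t ht
      rw [mem_Icc] at ht
      have := volume_mono hv hjL ht.2 (by omega)
      simp only [mem_filter, mem_range]
      omega
    have h9 := card_le_card h8
    rw [Nat.card_Icc] at h9
    omega
  calc p j = (Ico (b - p j) b).card := by rw [Nat.card_Ico]; omega
    _ ≤ _ := card_le_card h1
    _ ≤ _ := card_image_le

/-! ### The priority schedule

`rem u j` is the remaining processing time of job `j` at time `u` when in every time slot the
available job with the smallest value of `C` is processed. -/

/-- The processing of an available job of highest priority in time slot `u`. -/
def PriorityStep (n : ℕ) (r : ℕ → ℕ) (C : ℕ → ℝ) (u : ℕ) (f f' : ℕ → ℕ) : Prop :=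
  ((∀ j < n, r j ≤ u → f j = 0) ∧ f' = f) ∨
    ∃ i < n, r i ≤ u ∧ 0 < f i ∧ (∀ j < n, r j ≤ u → 0 < f j → C i ≤ C j) ∧
      f' = Function.update f i (f i - 1)

lemma exists_prioritySchedule (n : ℕ) (r p : ℕ → ℕ) (C : ℕ → ℝ) :
    ∃ rem : ℕ → ℕ → ℕ, rem 0 = p ∧ ∀ u, PriorityStep n r C u (rem u) (rem (u + 1)) := by
  have h : ∀ u f, ∃ f', PriorityStep n r C u f f' := by
    intro u f
    by_cases h : ((range n).filter fun j => r j ≤ u ∧ 0 < f j).Nonempty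
    · obtain ⟨i, hi, hmin⟩ := exists_min_image _ C h
      simp only [mem_filter, mem_range] at hi hmin
      exact ⟨_, .inr ⟨i, hi.1, hi.2.1, hi.2.2, fun j h1 h2 h3 => hmin j ⟨h1, h2, h3⟩, rfl⟩⟩
    · refine ⟨f, .inl ⟨fun j h1 h2 => ?_, rfl⟩⟩
      by_contra h3
      exact h ⟨j, by simp only [mem_filter, mem_range]; omega⟩
  choose next hnext using h
  exact ⟨fun u => Nat.rec p (fun u f => next u f) u, rfl, fun u => hnext u _⟩

variable {C : ℕ → ℝ} {rem : ℕ → ℕ → ℕ}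

lemma rem_succ_le (hrem : ∀ u, PriorityStep n r C u (rem u) (rem (u + 1))) (u j : ℕ) :
    rem (u + 1) j ≤ rem u j := by
  rcases hrem u with ⟨-, h⟩ | ⟨i, -, -, -, -, h⟩
  · rw [h]
  · rw [h]
    by_cases hij : j = i
    · subst hij; simp
    · rw [Function.update_of_ne hij]

lemma rem_anti (hrem : ∀ u, PriorityStep n r C u (rem u) (rem (u + 1))) {u v : ℕ} (h : u ≤ v)
    (j : ℕ) : rem v j ≤ rem u j := by
  induction v, h using Nat.le_induction with
  | base => exact le_rfl
  | succ v _ ih => exact (rem_succ_le hrem v j).trans ih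

lemma rem_eq_of_le (h0 : rem 0 = p) (hrem : ∀ u, PriorityStep n r C u (rem u) (rem (u + 1)))
    {u j : ℕ} (h : u ≤ r j) : rem u j = p j := by
  induction u with
  | zero => rw [h0]
  | succ u ih =>
    rw [← ih (by omega)]
    rcases hrem u with ⟨-, h'⟩ | ⟨i, -, hi, -, -, h'⟩
    · rw [h']
    · rw [h', Function.update_of_ne]
      rintro rfl; omega

lemma rem_le (h0 : rem 0 = p) (hrem : ∀ u, PriorityStep n r C u (rem u) (rem (u + 1))) (u j : ℕ) :
    rem u j ≤ p j := by
  have := rem_anti hrem (Nat.zero_le u) j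
  rwa [h0] at this

/-- At every time `u` there is a time `s` since when the machine has been processing jobs with
priority at least `x` that are released at or after `s`. -/
lemma exists_busy_start (h0 : rem 0 = p)
    (hrem : ∀ u, PriorityStep n r C u (rem u) (rem (u + 1))) (x : ℝ) (u : ℕ) :
    ∃ s ≤ u, (∀ i < n, C i ≤ x → r i < s → rem u i = 0) ∧
      u + ∑ i ∈ (range n).filter (fun i => C i ≤ x ∧ s ≤ r i), rem u i ≤
        s + ∑ i ∈ (range n).filter (fun i => C i ≤ x ∧ s ≤ r i), p i := by
  induction u with
  | zero => exact ⟨0, le_rfl, by simp, by simp [h0]⟩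
  | succ u ih =>
    obtain ⟨s, h1, h2, h3⟩ := ih
    -- If a job with `C ≤ x` is available, the slot goes to such a job, and this job is released at
    -- or after `s` because the earlier ones are finished. Otherwise the busy period restarts at `u
    -- + 1`.
    by_cases h : ∃ j < n, C j ≤ x ∧ r j ≤ u ∧ 0 < rem u j
    · obtain ⟨j, hj, hjx, hju, hj0⟩ := h
      refine ⟨s, by omega, fun i hi hix his => Nat.le_zero.1 ?_, ?_⟩
      · exact (rem_succ_le hrem u i).trans (h2 i hi hix his).le
      rcases hrem u with ⟨h4, -⟩ | ⟨i, hi, hiu, hi0, hmin, h5⟩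
      · have := h4 j hj hju; omega
      · have hix : C i ≤ x := (hmin j hj hju hj0).trans hjx
        have his : s ≤ r i := by
          by_contra hlt
          have := h2 i hi hix (by omega); omega
        have hmem : i ∈ (range n).filter (fun i => C i ≤ x ∧ s ≤ r i) := by
          simp [hi, hix, his]
        rw [h5, sum_update_of_mem hmem]
        have h6 := add_sum_erase _ (rem u) hmem
        rw [erase_eq] at h6
        omega
    · push Not at h
      refine ⟨u + 1, le_rfl, fun i hi hix hiu => ?_, ?_⟩
      · have h4 := h i hi hix (by omega)
        have := rem_succ_le hrem u i
        omega
      · exact Nat.add_le_add_left (sum_le_sum fun i _ => rem_le h0 hrem _ _) _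

/-- The busy period up to `u` starts no later than `r j`, as the jobs with `C ≤ C j` released before
its start `s` are finished. It is filled with jobs that any schedule meeting `C` must place between
`s` and `C j`; this will force `u + 1 ≤ C j`. The first conjunct bounds the time by which all work
is done. -/
lemma lt_of_rem_pos (h0 : rem 0 = p) (hrem : ∀ u, PriorityStep n r C u (rem u) (rem (u + 1)))
    {u j : ℕ} (hj : j < n) (hu : 0 < rem u j) : u + 1 ≤ r j + ∑ i ∈ range n, p i ∧
    ∃ s ≤ r j, u + 1 ≤ s + ∑ i ∈ (range n).filter (fun i => C i ≤ C j ∧ s ≤ r i), p i := by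
  obtain ⟨s, h1, h2, h3⟩ := exists_busy_start h0 hrem (C j) u
  have hs : s ≤ r j := by
    by_contra hlt
    have := h2 j hj le_rfl (by omega); omega
  have h4 : rem u j ≤ ∑ i ∈ (range n).filter (fun i => C i ≤ C j ∧ s ≤ r i), rem u i :=
    single_le_sum (f := rem u) (fun _ _ => Nat.zero_le _) (by simp [hj, hs])
  have h5 : ∑ i ∈ (range n).filter (fun i => C i ≤ C j ∧ s ≤ r i), p i ≤ ∑ i ∈ range n, p i :=
    sum_le_sum_of_subset (filter_subset _ _)
  exact ⟨by omega, s, hs, by omega⟩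

/-- The volume of each class that the priority schedule has processed. -/
def processed (n : ℕ) (p κ : ℕ → ℕ) (rem : ℕ → ℕ → ℕ) (t c : ℕ) : ℕ :=
  ∑ i ∈ (range n).filter (fun i => κ i = c), (p i - rem t i)

lemma volumeStep_processed (h0 : rem 0 = p)
    (hrem : ∀ u, PriorityStep n r C u (rem u) (rem (u + 1))) (t : ℕ) :
    VolumeStep n r p κ L t (prev 0 (processed n p κ rem) t) (processed n p κ rem t) := by
  have hrel : ∀ c, processed n p κ rem t c ≤ releasedBefore n r p κ t c := by
    intro c
    simp only [processed, releasedBefore, sumTo_eq, ite_and, ← sum_filter]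
    rw [← sum_filter_add_sum_filter_not ((range n).filter fun i => κ i = c) (fun i => r i < t)]
    have h1 : ∑ i ∈ ((range n).filter fun i => κ i = c).filter (fun i => ¬ r i < t),
        (p i - rem t i) = 0 := by
      refine sum_eq_zero fun i hi => ?_
      simp only [mem_filter] at hi
      rw [rem_eq_of_le h0 hrem (by omega), Nat.sub_self]
    rw [h1, add_zero]
    exact sum_le_sum fun i _ => Nat.sub_le _ _
  cases t with
  | zero =>
    refine ⟨fun c _ => ⟨Nat.zero_le _, hrel c⟩, ?_⟩
    simp [processed, h0]
  | succ t =>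
    refine ⟨fun c _ => ⟨?_, hrel c⟩, ?_⟩
    · change processed n p κ rem t c ≤ _
      exact sum_le_sum fun i _ => Nat.sub_le_sub_left (rem_succ_le hrem t i) (p i)
    rcases hrem t with ⟨-, h⟩ | ⟨i, hi, -, hi0, -, h⟩
    · simp [processed, prev, h]
    · have h1 : ∀ c, processed n p κ rem (t + 1) c =
          processed n p κ rem t c + if c = κ i then 1 else 0 := by
        intro c
        have h2 : ∀ k, p k - rem (t + 1) k = p k - rem t k + if k = i then 1 else 0 := by
          intro k
          rw [h]
          by_cases hk : k = i
          · subst hk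
            have := rem_le h0 hrem t k
            simp only [Function.update_self, if_true]; omega
          · simp [hk]
        simp only [processed, h2, sum_add_distrib]
        congr 1
        simp [hi, eq_comm]
      simp only [prev, h1, Nat.add_sub_cancel_left]
      simp only [sum_ite_eq']
      split_ifs <;> omega

/-- Inside each class, processing in the order of release has at most `2 + O(1/q)` times the cost of
the priority schedule. -/
lemma class_cost_le {w : ℕ → ℕ} {q : ℕ} (h0 : rem 0 = p)
    (hrem : ∀ u, PriorityStep n r C u (rem u) (rem (u + 1))) (hp : ∀ i < n, 1 ≤ p i)
    (hpq : ∀ i < n, ∀ j < n, κ i = κ j → q * p i ≤ (q + 1) * p j)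
    (hwq : ∀ i < n, ∀ j < n, κ i = κ j → q * w i ≤ (q + 1) * w j) (t c : ℕ) :
    q * q * ∑ i ∈ (range n).filter (fun i => (r i ≤ t ∧ processed n p κ rem t (κ i) <
        volumeUpTo n r p κ i) ∧ κ i = c), w i ≤
      (2 * q + 1) * (q + 1) *
        ∑ i ∈ (range n).filter (fun i => (r i ≤ t ∧ 0 < rem t i) ∧ κ i = c), w i := by
  set F := (range n).filter (fun i => (r i ≤ t ∧ processed n p κ rem t (κ i) <
        volumeUpTo n r p κ i) ∧ κ i = c) with hF
  set A := (range n).filter (fun i => (r i ≤ t ∧ 0 < rem t i) ∧ κ i = c) with hA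
  rcases F.eq_empty_or_nonempty with hF0 | hF0
  · simp [hF0]
  -- The first pending job in the order of release, possibly partly processed, is the one exempted
  -- in the exchange argument.
  obtain ⟨j, hj, hmin⟩ := exists_min_image F (fun i => toLex (r i, i)) hF0
  have hjF := hj
  simp only [hF, mem_filter, mem_range] at hj
  obtain ⟨hjn, ⟨hjt, hjv⟩, hjc⟩ := hj
  refine sum_le_of_sum_erase_lt (i₀ := j) (p := p) ?_ ?_ hjF ?_ ?_
  · intro i hi; simp only [hF, mem_filter, mem_range] at hi; exact hp i hi.1
  · intro i hi k hk
    simp only [hF, hA, mem_filter, mem_range] at hi hk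
    exact hpq k hk.1 i hi.1 (by omega)
  -- The jobs up to `j` and the rest of `F` are disjoint sets of released jobs of the class. As less
  -- than `volumeUpTo j` has been processed, the rest of `F` has less volume than what remains of
  -- `A`.
  · have h1 : volumeUpTo n r p κ j + ∑ i ∈ F.erase j, p i ≤
        ∑ i ∈ (range n).filter (fun i => κ i = c ∧ r i ≤ t), p i := by
      simp only [volumeUpTo, sumTo_eq, ← sum_filter]
      rw [← sum_union]
      · refine sum_le_sum_of_subset fun k hk => ?_
        simp only [hF, mem_union, mem_filter, mem_range, mem_erase] at hk ⊢
        omega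
      · rw [disjoint_left]
        intro k hk hk'
        have h2 := hmin k (mem_of_mem_erase hk')
        rw [Prod.Lex.toLex_le_toLex] at h2
        simp only [mem_filter, mem_range, mem_erase] at hk hk'
        omega
    have h2 : ∑ i ∈ (range n).filter (fun i => κ i = c ∧ r i ≤ t), p i ≤
        processed n p κ rem t c + ∑ i ∈ A, rem t i := by
      have h3 : ∑ i ∈ A, rem t i =
          ∑ i ∈ (range n).filter (fun i => κ i = c ∧ r i ≤ t), rem t i := by
        refine sum_subset (fun k hk => ?_) fun k hk hk' => ?_
        · simp only [hA, mem_filter] at hk ⊢; tauto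
        · simp only [hA, mem_filter] at hk hk'
          by_contra h4
          exact hk' ⟨hk.1, ⟨hk.2.2, by omega⟩, hk.2.1⟩
      rw [h3]
      have h4 : ∑ i ∈ (range n).filter (fun i => κ i = c ∧ r i ≤ t), (p i - rem t i) ≤
          processed n p κ rem t c :=
        sum_le_sum_of_subset fun k hk => by simp only [mem_filter] at hk ⊢; tauto
      refine le_trans ?_ (Nat.add_le_add_right h4 _)
      rw [← sum_add_distrib]
      exact sum_le_sum fun i _ => by have := rem_le h0 hrem t i; omega
    have h5 : ∑ i ∈ A, rem t i ≤ ∑ i ∈ A, p i := sum_le_sum fun i _ => rem_le h0 hrem t i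
    rw [hjc] at hjv
    omega
  · intro i hi k hk
    simp only [hF, hA, mem_filter, mem_range] at hi hk
    exact hwq i hi.1 k hk.1 (by omega)

lemma cost_processed_le {w : ℕ → ℕ} {q : ℕ} (h0 : rem 0 = p)
    (hrem : ∀ u, PriorityStep n r C u (rem u) (rem (u + 1))) (hp : ∀ i < n, 1 ≤ p i)
    (hpq : ∀ i < n, ∀ j < n, κ i = κ j → q * p i ≤ (q + 1) * p j)
    (hwq : ∀ i < n, ∀ j < n, κ i = κ j → q * w i ≤ (q + 1) * w j) (hL : ∀ i < n, κ i < L) (t : ℕ) :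
    q * q * ∑ i ∈ (range n).filter (fun i => r i ≤ t ∧ processed n p κ rem t (κ i) <
        volumeUpTo n r p κ i), w i ≤
      (2 * q + 1) * (q + 1) * ∑ i ∈ (range n).filter (fun i => r i ≤ t ∧ 0 < rem t i), w i := by
  have hmaps : ∀ (P : ℕ → Prop) [DecidablePred P], ∑ c ∈ range L,
      ∑ i ∈ (range n).filter (fun i => P i ∧ κ i = c), w i =
        ∑ i ∈ (range n).filter (fun i => P i), w i := by
    intro P _
    rw [← sum_fiberwise_of_maps_to (s := (range n).filter fun i => P i) (t := range L) (g := κ)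
      (fun i hi => by simp only [mem_filter, mem_range] at hi ⊢; exact hL i hi.1)]
    simp only [filter_filter]
  rw [← hmaps (fun i => r i ≤ t ∧ processed n p κ rem t (κ i) < volumeUpTo n r p κ i),
    ← hmaps (fun i => r i ≤ t ∧ 0 < rem t i), mul_sum, mul_sum]
  exact sum_le_sum fun c _ => class_cost_le h0 hrem hp hpq hwq t c

end

/-! ### Job lists -/

/-- The list of the triples `(r_j, p_j, w_j)`. -/
def JobInstance.jobs (J : JobInstance) : List (List ℕ) :=
  (List.finRange J.n).map fun j => [J.r j, J.p j, J.w j]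

/-- The release time of job `i` in a list of jobs. -/
def release (I : List (List ℕ)) (i : ℕ) : ℕ := (I.getD i []).getD 0 0

/-- The processing time of job `i` in a list of jobs. -/
def proc (I : List (List ℕ)) (i : ℕ) : ℕ := (I.getD i []).getD 1 0

/-- The weight of job `i` in a list of jobs. -/
def weight (I : List (List ℕ)) (i : ℕ) : ℕ := (I.getD i []).getD 2 0

section
variable {γ : Type} [Coded γ] {I : γ → List (List ℕ)} {i : γ → ℕ}

@[fun_prop] lemma PTime.release (hI : PTime I) (hi : PTime i) :
    PTime fun g => release (I g) (i g) := by unfold FlowTime.release; fun_prop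

@[fun_prop] lemma PTime.proc (hI : PTime I) (hi : PTime i) :
    PTime fun g => proc (I g) (i g) := by unfold FlowTime.proc; fun_prop

@[fun_prop] lemma PTime.weight (hI : PTime I) (hi : PTime i) :
    PTime fun g => weight (I g) (i g) := by unfold FlowTime.weight; fun_prop

end

/-- The sum of all processing times. -/
def totalProc (I : List (List ℕ)) : ℕ := sumTo I.length (proc I)

/-- The sum of all weights. -/
def totalWeight (I : List (List ℕ)) : ℕ := sumTo I.length (weight I)

@[fun_prop] lemma PTime.totalProc {γ : Type} [Coded γ] {I : γ → List (List ℕ)} (hI : PTime I) :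
    PTime fun g => totalProc (I g) := by unfold FlowTime.totalProc; fun_prop

@[fun_prop] lemma PTime.totalWeight {γ : Type} [Coded γ] {I : γ → List (List ℕ)} (hI : PTime I) :
    PTime fun g => totalWeight (I g) := by unfold FlowTime.totalWeight; fun_prop

namespace JobInstance
variable (J : JobInstance)

lemma code_jobs : code J.jobs = J.encode := by
  simp only [jobs, encode, code, List.map_map]
  rfl

@[simp] lemma length_jobs : J.jobs.length = J.n := by simp [jobs]

lemma jobs_getD (j : Fin J.n) : J.jobs.getD j [] = [J.r j, J.p j, J.w j] := by
  simp [jobs, List.getD_eq_getElem?_getD]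

@[simp] lemma release_jobs (j : Fin J.n) : release J.jobs j = J.r j := by
  rw [release, jobs_getD]; rfl

@[simp] lemma proc_jobs (j : Fin J.n) : proc J.jobs j = J.p j := by
  rw [proc, jobs_getD]; rfl

@[simp] lemma weight_jobs (j : Fin J.n) : weight J.jobs j = J.w j := by
  rw [weight, jobs_getD]; rfl

lemma totalProc_jobs : totalProc J.jobs = ∑ j, J.p j := by
  simp [totalProc, sumTo_eq, sum_range]

lemma totalWeight_jobs : totalWeight J.jobs = ∑ j, J.w j := by
  simp [totalWeight, sumTo_eq, sum_range]

/-! ### Schedules -/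

/-- Distinct slots are disjoint intervals of length one, so the time a job receives is at least the
number of its slots. -/
lemma isSchedule_slotSchedule {L : List (Option (Fin J.n))} {C : Fin J.n → ℝ}
    {U : Fin J.n → Finset ℕ} (hC : ∀ j, (J.r j : ℝ) ≤ C j)
    (hU : ∀ j, ∀ u ∈ U j, L[u]? = some (some j) ∧ J.r j ≤ u ∧ ((u + 1 : ℕ) : ℝ) ≤ C j)
    (hp : ∀ j, J.p j ≤ (U j).card) : J.IsSchedule (J.slotSchedule L) C := by
  refine ⟨fun j => ?_, fun j => ⟨hC j, ?_⟩⟩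
  · have h : {t : ℝ | J.slotSchedule L t = some j} =
        Set.Ici 0 ∩ (fun t : ℝ => ⌊t⌋₊) ⁻¹' {u | (L[u]?).join = some j} := by
      ext t
      simp only [slotSchedule, Set.mem_ofPred_eq, Set.mem_inter_iff, Set.mem_Ici, Set.mem_preimage]
      split_ifs with h <;> simp [h]
    rw [h]
    exact measurableSet_Ici.inter (Nat.measurable_floor (MeasurableSet.of_discrete))
  · have h1 : (⋃ u ∈ U j, Set.Ico (u : ℝ) (u + 1)) ⊆
        {t | J.slotSchedule L t = some j} ∩ Set.Ico (J.r j : ℝ) (C j) := by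
      intro t ht
      simp only [Set.mem_iUnion] at ht
      obtain ⟨u, hu, ht1, ht2⟩ := ht
      obtain ⟨h1, h2, h3⟩ := hU j u hu
      have h4 : ⌊t⌋₊ = u := (Nat.floor_eq_iff ((Nat.cast_nonneg u).trans ht1)).2 ⟨ht1, ht2⟩
      refine ⟨?_, ?_, ?_⟩
      · simp [slotSchedule, (Nat.cast_nonneg u).trans ht1, h4, h1]
      · exact le_trans (by exact_mod_cast h2) ht1
      · push_cast at h3; linarith
    refine le_trans ?_ (measure_mono h1)
    rw [measure_biUnion_finset]
    · simp only [Real.volume_Ico, add_sub_cancel_left, ENNReal.ofReal_one, sum_const, nsmul_eq_mul,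
        mul_one]
      exact_mod_cast hp j
    · intro u _ u' _ hne
      rw [Function.onFun, Set.disjoint_left]
      intro t ht ht'
      apply hne
      have h4 : ⌊t⌋₊ = u := (Nat.floor_eq_iff ((Nat.cast_nonneg u).trans ht.1)).2 ht
      have h5 : ⌊t⌋₊ = u' := (Nat.floor_eq_iff ((Nat.cast_nonneg u').trans ht'.1)).2 ht'
      omega
    · exact fun u _ => measurableSet_Ico

/-- The jobs of `H` are processed in pairwise disjoint subsets of `[s, x)`. -/
lemma IsSchedule.sum_proc_le {J : JobInstance} {σ : ℝ → Option (Fin J.n)} {C : Fin J.n → ℝ}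
    (hσ : J.IsSchedule σ C)
    {H : Finset (Fin J.n)} {s x : ℝ} (hs : ∀ i ∈ H, s ≤ J.r i) (hx : ∀ i ∈ H, C i ≤ x)
    (hsx : s ≤ x) : ((∑ i ∈ H, J.p i : ℕ) : ℝ) ≤ x - s := by
  have h1 : (⋃ i ∈ H, {t | σ t = some i} ∩ Set.Ico (J.r i : ℝ) (C i)) ⊆ Set.Ico s x := by
    intro t ht
    simp only [Set.mem_iUnion] at ht
    obtain ⟨i, hi, -, h2, h3⟩ := ht
    exact ⟨(hs i hi).trans h2, h3.trans_le (hx i hi)⟩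
  have h2 := measure_mono (μ := volume) h1
  rw [measure_biUnion_finset, Real.volume_Ico] at h2
  · have h3 : ((∑ i ∈ H, J.p i : ℕ) : ENNReal) ≤ ENNReal.ofReal (x - s) := by
      refine le_trans ?_ h2
      push_cast
      exact sum_le_sum fun i _ => (hσ.2 i).2
    have h4 := ENNReal.toReal_mono ENNReal.ofReal_ne_top h3
    rwa [ENNReal.toReal_natCast, ENNReal.toReal_ofReal (by linarith)] at h4
  · intro i _ j _ hne
    rw [Function.onFun, Set.disjoint_left]
    rintro t ⟨h3, -⟩ ⟨h4, -⟩
    simp only [Set.mem_ofPred_eq] at h3 h4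
    rw [h3] at h4
    exact hne (Option.some_injective _ h4)
  · exact fun i _ => (hσ.1 i).inter measurableSet_Ico

end JobInstance

/-! ### The dynamic program for weighted flow time -/

section
variable (q : ℕ) (I : List (List ℕ))

/-- The number of classes of jobs. -/
def numClasses : ℕ := q * (Nat.log 2 (totalProc I) + 1) * (q * (Nat.log 2 (totalWeight I) + 1))

/-- The class of a job: the processing times in a class are almost the same, and so are the
weights. -/
def jobClass (i : ℕ) : ℕ :=
  sizeClass q (proc I i) * (q * (Nat.log 2 (totalWeight I) + 1)) + sizeClass q (weight I i)

/-- The number of time slots. -/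
def horizon : ℕ := sumTo I.length (release I) + totalProc I

def jobsReleasedBefore (t c : ℕ) : ℕ :=
  releasedBefore I.length (release I) (proc I) (jobClass q I) t c

def jobsVolumeUpTo (j : ℕ) : ℕ := volumeUpTo I.length (release I) (proc I) (jobClass q I) j

/-- The vector of processed volumes may change from `s` to `s'` in the time slot before `t`. -/
def volumeOk (t : ℕ) (s s' : List ℕ) : Bool :=
  (allTo (numClasses q I) fun c =>
    decide (s.getD c 0 ≤ s'.getD c 0 ∧ s'.getD c 0 ≤ jobsReleasedBefore q I t c)) &&
  decide (sumTo (numClasses q I) (fun c => s'.getD c 0 - s.getD c 0) ≤ 1)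

/-- The weight of the jobs that are pending at time `t` when the volumes in `s` are processed. -/
def pendingWeight (t : ℕ) (s : List ℕ) : ℕ := sumTo I.length fun i =>
  if release I i ≤ t ∧ s.getD (jobClass q I i) 0 < jobsVolumeUpTo q I i then weight I i else 0

/-- All jobs are completed when the volumes in `s` are processed. -/
def allDone (s : List ℕ) : Bool :=
  allTo I.length fun i => decide (jobsVolumeUpTo q I i ≤ s.getD (jobClass q I i) 0)

/-- The optimal sequence of processed volumes, the last one first. -/
def bestVolumes (S : List (List ℕ)) : List (List ℕ) :=
  shortest [] (volumeOk q I) (fun t _ s => pendingWeight q I t s) S (horizon I) (allDone q I)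

/-- The number of the job that is processed when the volumes change from `s` to `s'`. -/
def jobInSlot (s s' : List ℕ) : ℕ :=
  (((List.range I.length).filter fun j => decide (s'.getD (jobClass q I j) 0 =
    s.getD (jobClass q I j) 0 + 1 ∧ jobsVolumeUpTo q I j ≤ s.getD (jobClass q I j) 0 + proc I j ∧
      s.getD (jobClass q I j) 0 < jobsVolumeUpTo q I j)).map fun j => j + 1).headD 0

/-- The jobs in the time slots of the schedule. -/
def slotJobs (h : List (List ℕ)) : List ℕ := (List.range (horizon I)).map fun u =>
  jobInSlot q I (h.getD (horizon I - u) []) (h.getD (horizon I - (u + 1)) [])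

end

section
variable {γ : Type} [Coded γ] {I : γ → List (List ℕ)} {q : ℕ}

@[fun_prop] lemma PTime.numClasses (hI : PTime I) :
    PTime fun g => numClasses q (I g) := by unfold FlowTime.numClasses; fun_prop

@[fun_prop] lemma PTime.jobClass {i : γ → ℕ} (hI : PTime I) (hi : PTime i) :
    PTime fun g => jobClass q (I g) (i g) := by unfold FlowTime.jobClass; fun_prop

@[fun_prop] lemma PTime.horizon (hI : PTime I) :
    PTime fun g => horizon (I g) := by unfold FlowTime.horizon; fun_prop

@[fun_prop] lemma PTime.jobsReleasedBefore {t c : γ → ℕ} (hI : PTime I) (ht : PTime t)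
    (hc : PTime c) : PTime fun g => jobsReleasedBefore q (I g) (t g) (c g) := by
  unfold FlowTime.jobsReleasedBefore FlowTime.releasedBefore; fun_prop

@[fun_prop] lemma PTime.jobsVolumeUpTo {j : γ → ℕ} (hI : PTime I) (hj : PTime j) :
    PTime fun g => jobsVolumeUpTo q (I g) (j g) := by
  unfold FlowTime.jobsVolumeUpTo FlowTime.volumeUpTo; fun_prop

@[fun_prop] lemma PTime.jobInSlot {s s' : γ → List ℕ} (hI : PTime I) (hs : PTime s)
    (hs' : PTime s') : PTime fun g => jobInSlot q (I g) (s g) (s' g) := by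
  unfold FlowTime.jobInSlot; fun_prop

lemma PTime.slotJobs : PTime fun x : List (List ℕ) × List (List ℕ) =>
    slotJobs q x.1 (bestVolumes q x.1 x.2) := by
  have h1 : PTime fun x : List (List ℕ) × List (List ℕ) => bestVolumes q x.1 x.2 := by
    unfold bestVolumes
    apply PTime.shortest
    · unfold volumeOk; fun_prop
    · unfold pendingWeight; fun_prop
    · fun_prop
    · fun_prop
    · unfold allDone; fun_prop
  unfold FlowTime.slotJobs
  fun_prop

end

/-! ### Correctness of the dynamic program -/

section
variable {q : ℕ} {I : List (List ℕ)}

lemma volumeOk_iff {t : ℕ} {s s' : List ℕ} : volumeOk q I t s s' = true ↔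
    VolumeStep I.length (release I) (proc I) (jobClass q I) (numClasses q I) t
      (fun c => s.getD c 0) (fun c => s'.getD c 0) := by
  simp only [volumeOk, Bool.and_eq_true, allTo_iff, decide_eq_true_eq, sumTo_eq]
  rfl

lemma prev_getD (f : ℕ → List ℕ) (t : ℕ) :
    (fun c => (prev [] f t).getD c 0) = prev 0 (fun t c => (f t).getD c 0) t := by
  cases t with
  | zero => funext c; simp [prev]
  | succ t => rfl

/-- The possible vectors of processed volumes. -/
def volumeVectors (q : ℕ) (I : List (List ℕ)) : List (List ℕ) :=
  lists (List.range (totalProc I + 1)) (numClasses q I)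

lemma proc_le_totalProc {i : ℕ} (hi : i < I.length) : proc I i ≤ totalProc I := by
  rw [totalProc, sumTo_eq]
  exact single_le_sum (f := proc I) (fun _ _ => Nat.zero_le _) (mem_range.2 hi)

lemma weight_le_totalWeight {i : ℕ} (hi : i < I.length) : weight I i ≤ totalWeight I := by
  rw [totalWeight, sumTo_eq]
  exact single_le_sum (f := weight I) (fun _ _ => Nat.zero_le _) (mem_range.2 hi)

variable (hq : 1 ≤ q) (hp : ∀ i < I.length, 1 ≤ proc I i) (hw : ∀ i < I.length, 1 ≤ weight I i)
include hq hp hw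

lemma jobClass_lt {i : ℕ} (hi : i < I.length) : jobClass q I i < numClasses q I := by
  have h1 := sizeClass_lt hq (hp i hi) (proc_le_totalProc hi)
  have h2 := sizeClass_lt hq (hw i hi) (weight_le_totalWeight hi)
  unfold jobClass numClasses
  calc _ < sizeClass q (proc I i) * (q * (Nat.log 2 (totalWeight I) + 1)) +
        1 * (q * (Nat.log 2 (totalWeight I) + 1)) := by omega
    _ = (sizeClass q (proc I i) + 1) * (q * (Nat.log 2 (totalWeight I) + 1)) := by ring
    _ ≤ _ := Nat.mul_le_mul_right _ h1

lemma jobClass_ratio {i j : ℕ} (hi : i < I.length) (hj : j < I.length)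
    (h : jobClass q I i = jobClass q I j) :
    q * proc I i ≤ (q + 1) * proc I j ∧ q * weight I i ≤ (q + 1) * weight I j := by
  obtain ⟨h1, h2⟩ := mul_add_inj (sizeClass_lt hq (hw i hi) (weight_le_totalWeight hi))
    (sizeClass_lt hq (hw j hj) (weight_le_totalWeight hj)) h
  exact ⟨sizeClass_ratio hq (hp i hi) (hp j hj) h1, sizeClass_ratio hq (hw i hi) (hw j hj) h2⟩

/-- The class volumes of the priority schedule for `C` form an admissible path of the dynamic
program whose pending weight is controlled at every single time. -/
lemma exists_volumes (C : ℕ → ℝ) : ∃ (f : ℕ → List ℕ) (rem : ℕ → ℕ → ℕ), rem 0 = proc I ∧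
    (∀ u, PriorityStep I.length (release I) C u (rem u) (rem (u + 1))) ∧
    (∀ t ≤ horizon I, f t ∈ volumeVectors q I ∧ volumeOk q I t (prev [] f t) (f t) = true) ∧
    allDone q I (f (horizon I)) = true ∧
    ∀ t, q * q * pendingWeight q I t (f t) ≤ (2 * q + 1) * (q + 1) *
      ∑ i ∈ (range I.length).filter (fun i => release I i ≤ t ∧ 0 < rem t i), weight I i := by
  obtain ⟨rem, h0, hrem⟩ := exists_prioritySchedule I.length (release I) (proc I) C
  set v := processed I.length (proc I) (jobClass q I) rem with hv
  have hf : ∀ t c, ((List.range (numClasses q I)).map (v t)).getD c 0 =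
      if c < numClasses q I then v t c else 0 := by
    intro t c
    split_ifs with h <;> simp [List.getD_eq_getElem?_getD, h]
  have hf' : ∀ t, ∀ i < I.length,
      ((List.range (numClasses q I)).map (v t)).getD (jobClass q I i) 0 = v t (jobClass q I i) :=
    fun t i hi => by rw [hf, if_pos (jobClass_lt hq hp hw hi)]
  refine ⟨fun t => (List.range (numClasses q I)).map (v t), rem, h0, hrem, fun t _ => ⟨?_, ?_⟩,
    ?_, fun t => ?_⟩
  · refine (mem_lists _ _ _).2 ⟨by simp, fun a ha => ?_⟩
    obtain ⟨c, -, rfl⟩ := List.mem_map.1 ha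
    rw [List.mem_range, Nat.lt_succ_iff, totalProc, sumTo_eq]
    refine (sum_le_sum_of_subset (filter_subset _ _)).trans (sum_le_sum fun i _ => Nat.sub_le _ _)
  · rw [volumeOk_iff, prev_getD]
    have h1 := volumeStep_processed (L := numClasses q I) (κ := jobClass q I) h0 hrem t
    have h2 : ∀ c < numClasses q I, prev 0 (fun t c =>
        ((List.range (numClasses q I)).map (v t)).getD c 0) t c = prev 0 v t c := by
      intro c hc
      cases t with
      | zero => rfl
      | succ t => simp only [prev, hf, if_pos hc]
    refine ⟨fun c hc => ?_, ?_⟩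
    · dsimp only
      rw [h2 c hc, hf, if_pos hc]; exact h1.1 c hc
    · refine le_trans (sum_le_sum fun c hc => ?_) h1.2
      rw [mem_range] at hc
      dsimp only
      rw [h2 c hc, hf, if_pos hc]
  · simp only [allDone, allTo_iff, decide_eq_true_eq]
    intro i hi
    rw [hf' _ i hi]
    -- A job pending at the horizon would contradict the bound `r j + ∑ p` of `lt_of_rem_pos`.
    have h1 : ∀ j < I.length, rem (horizon I) j = 0 := by
      intro j hj
      by_contra hne
      have h2 := (lt_of_rem_pos h0 hrem hj (Nat.pos_of_ne_zero hne)).1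
      have h3 : release I j ≤ ∑ i ∈ range I.length, release I i :=
        single_le_sum (f := release I) (fun _ _ => Nat.zero_le _) (mem_range.2 hj)
      simp only [horizon, totalProc, sumTo_eq] at h2 h3
      omega
    simp only [jobsVolumeUpTo, volumeUpTo, sumTo_eq, ← sum_filter, hv, processed]
    have h4 : ∀ k ∈ (range I.length).filter (fun k => jobClass q I k = jobClass q I i),
        proc I k - rem (horizon I) k = proc I k := by
      intro k hk
      rw [h1 k (by simpa using (mem_filter.1 hk).1), Nat.sub_zero]
    rw [sum_congr rfl h4]
    exact sum_le_sum_of_subset fun k hk => by simp only [mem_filter] at hk ⊢; tauto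
  · have h1 := cost_processed_le (κ := jobClass q I) (w := weight I) (q := q) h0 hrem hp
      (fun i hi j hj h => (jobClass_ratio hq hp hw hi hj h).1)
      (fun i hi j hj h => (jobClass_ratio hq hp hw hi hj h).2)
      (fun i hi => jobClass_lt hq hp hw hi) t
    refine le_trans (Nat.mul_le_mul_left _ (le_of_eq ?_)) h1
    rw [pendingWeight, sumTo_eq, ← sum_filter]
    refine sum_congr (filter_congr fun i hi => ?_) fun _ _ => rfl
    rw [hf' _ i (mem_range.1 hi)]
    rfl

end

/-! ### From optimal volumes to a schedule -/

namespace JobInstance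
variable {J : JobInstance} {q : ℕ}

/-- The priority schedule meets all completion times `C`: a job unfinished at time `u` has `u + 1 ≤
C j` by the busy-period bound and `IsSchedule.sum_proc_le`. Hence each job is pending at no more
than `⌊C j⌋ - r j` integral times. -/
lemma sum_pending_le {σ : ℝ → Option (Fin J.n)} {C : Fin J.n → ℝ} (hσ : J.IsSchedule σ C)
    {rem : ℕ → ℕ → ℕ} (h0 : rem 0 = proc J.jobs)
    (hrem : ∀ u, PriorityStep J.n (release J.jobs)
      (fun i => if h : i < J.n then C ⟨i, h⟩ else 0) u (rem u) (rem (u + 1))) (N : ℕ) :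
    ((∑ t ∈ range N, ∑ i ∈ (range J.n).filter
      (fun i => release J.jobs i ≤ t ∧ 0 < rem t i), weight J.jobs i : ℕ) : ℝ) ≤ J.flowTime C := by
  have h1 : ∀ (j : Fin J.n) (u : ℕ), 0 < rem u j → ((u + 1 : ℕ) : ℝ) ≤ C j := by
    intro j u hu
    obtain ⟨-, s, hs, h2⟩ := lt_of_rem_pos h0 hrem j.2 hu
    have h3 : ∑ i ∈ (range J.n).filter (fun i => (if h : i < J.n then C ⟨i, h⟩ else 0) ≤
        (if h : (j : ℕ) < J.n then C ⟨j, h⟩ else 0) ∧ s ≤ release J.jobs i), proc J.jobs i =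
          ∑ i ∈ univ.filter (fun i : Fin J.n => C i ≤ C j ∧ s ≤ J.r i), J.p i := by
      rw [sum_filter, sum_range, sum_filter]
      simp
    rw [h3] at h2
    rw [release_jobs] at hs
    have h4 := hσ.sum_proc_le (H := univ.filter fun i : Fin J.n => C i ≤ C j ∧ s ≤ J.r i)
      (s := s) (x := C j) (by intro i hi; simp at hi; exact_mod_cast hi.2)
      (by intro i hi; simp at hi; exact hi.1)
      (le_trans (by exact_mod_cast hs) (hσ.2 j).1)
    have h5 : ((u + 1 : ℕ) : ℝ) ≤ s + ((∑ i ∈ univ.filter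
      (fun i : Fin J.n => C i ≤ C j ∧ s ≤ J.r i), J.p i : ℕ) : ℝ) := by exact_mod_cast h2
    linarith
  have h2 : ∑ t ∈ range N, ∑ i ∈ (range J.n).filter
      (fun i => release J.jobs i ≤ t ∧ 0 < rem t i), weight J.jobs i =
      ∑ j : Fin J.n, J.w j * ((range N).filter fun t => J.r j ≤ t ∧ 0 < rem t j).card := by
    simp only [sum_filter, sum_range (n := J.n), release_jobs, weight_jobs]
    rw [sum_comm]
    refine sum_congr rfl fun j _ => ?_
    rw [card_filter, mul_sum]
    simp
  rw [h2, flowTime]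
  push_cast
  refine sum_le_sum fun j _ => mul_le_mul_of_nonneg_left ?_ (Nat.cast_nonneg _)
  have h3 : ((range N).filter fun t => J.r j ≤ t ∧ 0 < rem t j) ⊆ Ico (J.r j) ⌊C j⌋₊ := by
    intro t ht
    simp only [mem_filter] at ht
    rw [mem_Ico]
    have := Nat.le_floor (h1 j t ht.2.2)
    omega
  have h4 := card_le_card h3
  rw [Nat.card_Ico] at h4
  have h5 : (0 : ℝ) ≤ J.r j := Nat.cast_nonneg _
  have h6 := (hσ.2 j).1
  have h7 : J.r j ≤ ⌊C j⌋₊ := Nat.le_floor h6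
  calc (((range N).filter fun t => J.r j ≤ t ∧ 0 < rem t j).card : ℝ)
      ≤ ((⌊C j⌋₊ - J.r j : ℕ) : ℝ) := by exact_mod_cast h4
    _ = ⌊C j⌋₊ - J.r j := by rw [Nat.cast_sub h7]
    _ ≤ C j - J.r j := by
      have := Nat.floor_le (h5.trans h6)
      linarith

/-- The slots of a schedule from the list of job numbers. -/
def slotsOf (J : JobInstance) (l : List ℕ) : List (Option (Fin J.n)) :=
  l.map fun x => if h : 0 < x ∧ x - 1 < J.n then some ⟨x - 1, h.2⟩ else none

lemma encodeSlots_slotsOf {l : List ℕ} (hl : ∀ x ∈ l, x ≤ J.n) :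
    J.encodeSlots (J.slotsOf l) = code l := by
  simp only [encodeSlots, slotsOf, List.map_map, code]
  congr 1
  refine List.map_congr_left fun x hx => ?_
  have := hl x hx
  simp only [Function.comp]
  congr 1
  split_ifs with h
  · simp; omega
  · simp; omega

lemma jobInSlot_le {I : List (List ℕ)} (s s' : List ℕ) : jobInSlot q I s s' ≤ I.length := by
  unfold jobInSlot
  set l := (List.range I.length).filter _ with hl
  cases h : l with
  | nil => simp
  | cons a t =>
    have : a ∈ l := by simp [h]
    rw [hl, List.mem_filter, List.mem_range] at this
    simp; omega

/-- By `Runs.unique` no other job qualifies, so taking the first qualifying number finds `j`. -/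
lemma jobInSlot_eq {I : List (List ℕ)} (hq : 1 ≤ q) (hp : ∀ i < I.length, 1 ≤ proc I i)
    (hw : ∀ i < I.length, 1 ≤ weight I i) {t : ℕ} {s s' : List ℕ}
    (hok : volumeOk q I t s s' = true) {j : ℕ} (hj : j < I.length)
    (hr : Runs I.length (release I) (proc I) (jobClass q I) (fun c => s.getD c 0)
      (fun c => s'.getD c 0) j) : jobInSlot q I s s' = j + 1 := by
  rw [volumeOk_iff] at hok
  unfold jobInSlot
  set l := (List.range I.length).filter _ with hl
  have hjl : j ∈ l := by
    rw [hl, List.mem_filter, List.mem_range]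
    exact ⟨hj, decide_eq_true hr⟩
  cases h : l with
  | nil => simp [h] at hjl
  | cons a t =>
    have ha : a ∈ l := by simp [h]
    rw [hl, List.mem_filter, List.mem_range, decide_eq_true_eq] at ha
    have := Runs.unique hok ha.1 hj (jobClass_lt hq hp hw ha.1) (jobClass_lt hq hp hw hj) ha.2 hr
    simp [this]

/-- The computed path gives job `j` the completion time `r j + D j`, where `D j` counts the times at
which it is pending; then flow time equals path cost. For a lower bound, the path is compared with
the one that `exists_volumes` attaches to an arbitrary schedule. -/
theorem exists_schedule (hq : 1 ≤ q) (hp : ∀ j, 1 ≤ J.p j) (hw : ∀ j, 1 ≤ J.w j) :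
    ∃ (L : List (Option (Fin J.n))) (C : Fin J.n → ℝ),
      J.encodeSlots L = code (slotJobs q J.jobs (bestVolumes q J.jobs (volumeVectors q J.jobs))) ∧
      J.IsSchedule (J.slotSchedule L) C ∧
      (q * q : ℕ) * J.flowTime C ≤ ((2 * q + 1) * (q + 1) : ℕ) * J.optFlowTime := by
  have hn := J.length_jobs
  have hp' : ∀ i < J.jobs.length, 1 ≤ proc J.jobs i := by
    intro i hi
    rw [hn] at hi
    rw [show i = ((⟨i, hi⟩ : Fin J.n) : ℕ) from rfl, proc_jobs]; exact hp _
  have hw' : ∀ i < J.jobs.length, 1 ≤ weight J.jobs i := by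
    intro i hi
    rw [hn] at hi
    rw [show i = ((⟨i, hi⟩ : Fin J.n) : ℕ) from rfl, weight_jobs]; exact hw _
  set N := horizon J.jobs with hN
  -- The priorities are irrelevant here; any admissible path shows that the dynamic program has a
  -- solution.
  obtain ⟨f₀, -, -, -, hf₀, hfin₀, -⟩ := exists_volumes hq hp' hw' fun _ => 0
  obtain ⟨g, hg, hgok, hgfin, -⟩ := shortest_spec [] (c := fun t _ s => pendingWeight q J.jobs t s)
    hf₀ hfin₀
  have hgcost : ∀ f : ℕ → List ℕ, (∀ t ≤ N, f t ∈ volumeVectors q J.jobs ∧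
      volumeOk q J.jobs t (prev [] f t) (f t) = true) → allDone q J.jobs (f N) = true →
      ∑ t ∈ range (N + 1), pendingWeight q J.jobs t (g t) ≤
        ∑ t ∈ range (N + 1), pendingWeight q J.jobs t (f t) := by
    intro f hf hfin
    obtain ⟨g', hg', -, -, hle⟩ := shortest_spec []
      (c := fun t _ s => pendingWeight q J.jobs t s) hf hfin
    refine le_trans (le_of_eq (sum_congr rfl fun t ht => ?_)) hle
    have : t ≤ N := Nat.lt_succ_iff.1 (mem_range.1 ht)
    rw [hg t this, hg' t this]
  clear hf₀ hfin₀ f₀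
  set v : ℕ → ℕ → ℕ := fun t c => (g t).getD c 0 with hv
  have hvok : ∀ t ≤ N, VolumeStep J.jobs.length (release J.jobs) (proc J.jobs) (jobClass q J.jobs)
      (numClasses q J.jobs) t (prev 0 v t) (v t) := by
    intro t ht
    have := volumeOk_iff.1 (hgok t ht).2
    rwa [prev_getD] at this
  simp only [allDone, allTo_iff, decide_eq_true_eq] at hgfin
  set D : Fin J.n → ℕ := fun j => ((range (N + 1)).filter fun t =>
    release J.jobs j ≤ t ∧ v t (jobClass q J.jobs j) < jobsVolumeUpTo q J.jobs j).card with hD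
  set l := slotJobs q J.jobs (bestVolumes q J.jobs (volumeVectors q J.jobs)) with hl
  have hflow : J.flowTime (fun j => J.r j + D j) =
      ((∑ t ∈ range (N + 1), pendingWeight q J.jobs t (g t) : ℕ) : ℝ) := by
    have : ∑ t ∈ range (N + 1), pendingWeight q J.jobs t (g t) = ∑ j : Fin J.n, J.w j * D j := by
      simp only [pendingWeight, sumTo_eq, hn, sum_range (n := J.n), weight_jobs]
      rw [sum_comm]
      refine sum_congr rfl fun j _ => ?_
      simp only [hD]
      rw [card_filter, mul_sum]
      simp [hv]
    rw [this, flowTime]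
    push_cast
    exact sum_congr rfl fun j _ => by ring
  have hsched : J.IsSchedule (J.slotSchedule (J.slotsOf l)) (fun j => J.r j + D j) := by
    refine J.isSchedule_slotSchedule (U := fun j => (range N).filter fun u =>
      Runs J.jobs.length (release J.jobs) (proc J.jobs) (jobClass q J.jobs) (v u) (v (u + 1)) j ∧
        release J.jobs j ≤ u ∧ u < release J.jobs j + D j) (fun j => by simp) ?_ ?_
    · intro j u hu
      simp only [mem_filter, mem_range, release_jobs] at hu
      refine ⟨?_, hu.2.2.1, by exact_mod_cast hu.2.2.2⟩
      have h1 : l[u]? = some ((j : ℕ) + 1) := by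
        rw [hl, slotJobs, List.getElem?_map, List.getElem?_range (by omega), Option.map_some]
        congr 1
        have h3 := hg u (by omega)
        have h4 := hg (u + 1) (by omega)
        have h5 := (hgok (u + 1) (by omega)).2
        rw [bestVolumes, ← hN, ← h3, ← h4]
        exact jobInSlot_eq hq hp' hw' h5 (by rw [hn]; exact j.2) hu.2.1
      simp only [slotsOf, List.getElem?_map, h1]
      simp
    · intro j
      have := le_card_runs hvok (j := j) (by rw [hn]; exact j.2)
        (jobClass_lt hq hp' hw' (by rw [hn]; exact j.2)) (hgfin j (by rw [hn]; exact j.2))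
      rwa [proc_jobs] at this
  refine ⟨J.slotsOf l, fun j => J.r j + D j, encodeSlots_slotsOf ?_, hsched, ?_⟩
  · intro x hx
    rw [hl, slotJobs, List.mem_map] at hx
    obtain ⟨u, -, rfl⟩ := hx
    exact (jobInSlot_le _ _).trans hn.le
  · have hpos : (0 : ℝ) < ((2 * q + 1) * (q + 1) : ℕ) := by positivity
    rw [mul_comm _ J.optFlowTime, ← div_le_iff₀ hpos]
    -- The infimum need not be attained: it suffices to bound the computed cost by that of every
    -- schedule.
    refine le_csInf ⟨_, _, _, hsched, rfl⟩ ?_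
    rintro _ ⟨σ, C, hσ, rfl⟩
    rw [div_le_iff₀ hpos, mul_comm (J.flowTime C)]
    obtain ⟨f, rem, h0, hrem, hf, hfin, hcost⟩ :=
      exists_volumes hq hp' hw' fun i => if h : i < J.n then C ⟨i, h⟩ else 0
    rw [hn] at hrem hcost
    have h1 := sum_pending_le hσ h0 hrem (N + 1)
    have h2 := hgcost f hf hfin
    have h3 : q * q * ∑ t ∈ range (N + 1), pendingWeight q J.jobs t (f t) ≤
        (2 * q + 1) * (q + 1) * ∑ t ∈ range (N + 1), ∑ i ∈ (range J.n).filter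
          (fun i => release J.jobs i ≤ t ∧ 0 < rem t i), weight J.jobs i := by
      rw [mul_sum, mul_sum]
      exact sum_le_sum fun t _ => hcost t
    rw [hflow]
    calc ((q * q : ℕ) : ℝ) * ((∑ t ∈ range (N + 1), pendingWeight q J.jobs t (g t) : ℕ) : ℝ)
        ≤ ((q * q * ∑ t ∈ range (N + 1), pendingWeight q J.jobs t (f t) : ℕ) : ℝ) := by
          exact_mod_cast Nat.mul_le_mul_left _ h2
      _ ≤ (((2 * q + 1) * (q + 1) * ∑ t ∈ range (N + 1), ∑ i ∈ (range J.n).filter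
          (fun i => release J.jobs i ≤ t ∧ 0 < rem t i), weight J.jobs i : ℕ) : ℝ) := by
          exact_mod_cast h3
      _ ≤ _ := by
          rw [Nat.cast_mul]
          exact mul_le_mul_of_nonneg_left h1 hpos.le

end JobInstance

/-! ### Quasi-polynomial bounds -/

section
variable {ι : Type} {l : ι → ℕ}

/-- `g` is at most `2 ^ O(l ^ k)`. -/
def ExpBounded (l : ι → ℕ) (k : ℕ) (g : ι → ℕ) : Prop := ∃ D, ∀ i, g i ≤ 2 ^ (D * l i ^ k)

/-- `g` is at most `O(l ^ k)`. -/
def LogBounded (l : ι → ℕ) (k : ℕ) (g : ι → ℕ) : Prop := ∃ D, ∀ i, g i ≤ D * l i ^ k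

variable {a b k : ℕ} {f g : ι → ℕ}

lemma LogBounded.mono (hg : LogBounded l k g) (h : ∀ i, f i ≤ g i) : LogBounded l k f :=
  hg.imp fun _ hD i => (h i).trans (hD i)

lemma LogBounded.const (c : ℕ) : LogBounded l 0 fun _ => c := ⟨c, fun i => by simp⟩

lemma LogBounded.mul (hf : LogBounded l a f) (hg : LogBounded l b g) :
    LogBounded l (a + b) fun i => f i * g i := by
  obtain ⟨D, hD⟩ := hf
  obtain ⟨E, hE⟩ := hg
  exact ⟨D * E, fun i => (Nat.mul_le_mul (hD i) (hE i)).trans (le_of_eq (by ring))⟩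

lemma LogBounded.add (hf : LogBounded l a f) (hg : LogBounded l a g) :
    LogBounded l a fun i => f i + g i := by
  obtain ⟨D, hD⟩ := hf
  obtain ⟨E, hE⟩ := hg
  exact ⟨D + E, fun i => (Nat.add_le_add (hD i) (hE i)).trans (le_of_eq (by ring))⟩

lemma LogBounded.of_le (hl : ∀ i, 1 ≤ l i) (hf : LogBounded l a f) (hab : a ≤ b) :
    LogBounded l b f := by
  obtain ⟨D, hD⟩ := hf
  exact ⟨D, fun i => (hD i).trans (Nat.mul_le_mul_left _ (Nat.pow_le_pow_right (hl i) hab))⟩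

lemma ExpBounded.mono (hg : ExpBounded l k g) (h : ∀ i, f i ≤ g i) : ExpBounded l k f :=
  hg.imp fun _ hD i => (h i).trans (hD i)

lemma ExpBounded.mul (hf : ExpBounded l a f) (hg : ExpBounded l a g) :
    ExpBounded l a fun i => f i * g i := by
  obtain ⟨D, hD⟩ := hf
  obtain ⟨E, hE⟩ := hg
  exact ⟨D + E, fun i => (Nat.mul_le_mul (hD i) (hE i)).trans
    (le_of_eq (by rw [← pow_add]; ring_nf))⟩

lemma ExpBounded.pow (hf : ExpBounded l a f) (hg : LogBounded l b g) :
    ExpBounded l (a + b) fun i => f i ^ g i := by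
  obtain ⟨D, hD⟩ := hf
  obtain ⟨E, hE⟩ := hg
  refine ⟨D * E, fun i => (Nat.pow_le_pow_left (hD i) _).trans ?_⟩
  rw [← pow_mul]
  refine Nat.pow_le_pow_right (by norm_num) ((Nat.mul_le_mul_left _ (hE i)).trans (le_of_eq ?_))
  ring

lemma ExpBounded.of_le (hl : ∀ i, 1 ≤ l i) (hf : ExpBounded l a f) (hab : a ≤ b) :
    ExpBounded l b f := by
  obtain ⟨D, hD⟩ := hf
  exact ⟨D, fun i => (hD i).trans (Nat.pow_le_pow_right (by norm_num)
    (Nat.mul_le_mul_left _ (Nat.pow_le_pow_right (hl i) hab)))⟩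

lemma ExpBounded.const (hl : ∀ i, 1 ≤ l i) (c k : ℕ) : ExpBounded l k fun _ => c :=
  ⟨c, fun i => (Nat.lt_two_pow_self).le.trans (Nat.pow_le_pow_right (by norm_num)
    (Nat.le_mul_of_pos_right _ (Nat.pow_pos (hl i))))⟩

lemma ExpBounded.add (hl : ∀ i, 1 ≤ l i) (hf : ExpBounded l a f) (hg : ExpBounded l a g) :
    ExpBounded l a fun i => f i + g i := by
  have h1 : ∀ {f g : ι → ℕ}, ExpBounded l a f → ExpBounded l a g →
      ExpBounded l a fun i => (f i + 1) * (g i + 1) := by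
    intro f g hf hg
    have h2 : ∀ {f : ι → ℕ}, ExpBounded l a f → ExpBounded l a fun i => f i + 1 := by
      rintro f ⟨D, hD⟩
      refine ⟨D + 1, fun i => ?_⟩
      have h3 := hD i
      have h4 : 1 ≤ l i ^ a := Nat.pow_pos (hl i)
      have h5 : 1 ≤ 2 ^ (D * l i ^ a) := Nat.pow_pos (by norm_num)
      calc f i + 1 ≤ 2 ^ (D * l i ^ a) * 2 := by omega
        _ = 2 ^ (D * l i ^ a + 1) := by rw [pow_succ]
        _ ≤ _ := Nat.pow_le_pow_right (by norm_num) (by rw [add_mul]; omega)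
    exact (h2 hf).mul (h2 hg)
  exact (h1 hf hg).mono fun i => by nlinarith [Nat.zero_le (f i * g i)]

lemma ExpBounded.log (hf : ExpBounded l a f) : LogBounded l a fun i => Nat.log 2 (f i) := by
  obtain ⟨D, hD⟩ := hf
  refine ⟨D, fun i => ?_⟩
  have := Nat.log_mono_right (b := 2) (hD i)
  rwa [Nat.log_pow (by norm_num)] at this

end

/-- The normalized instances with `n * P ≥ 2`. -/
abbrev NormalizedInstance (A : ℕ) : Type := {J : JobInstance // J.Normalized A ∧ 2 ≤ J.n * J.P}

namespace NormalizedInstance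
variable {A : ℕ}

/-- The logarithm of `n * P`. -/
def logSize (J : NormalizedInstance A) : ℕ := Nat.log 2 (J.1.n * J.1.P)

lemma one_le_logSize (J : NormalizedInstance A) : 1 ≤ J.logSize :=
  (Nat.le_log_iff_pow_le (by norm_num) (by have := J.2.2; omega)).2 (by simpa using J.2.2)

lemma expBounded_size : ExpBounded (logSize (A := A)) 1 fun J => J.1.n * J.1.P := by
  refine ⟨2, fun J => ?_⟩
  have h1 := Nat.lt_pow_succ_log_self (b := 2) (by norm_num) (J.1.n * J.1.P)
  have h2 := J.one_le_logSize
  refine h1.le.trans (Nat.pow_le_pow_right (by norm_num) ?_)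
  rw [pow_one]
  change J.logSize + 1 ≤ 2 * J.logSize
  omega

lemma n_le (J : NormalizedInstance A) : J.1.n ≤ J.1.n * J.1.P :=
  Nat.le_mul_of_pos_right _ (Nat.pos_of_ne_zero fun h => by have := J.2.2; simp [h] at this)

lemma p_le (J : NormalizedInstance A) (j : Fin J.1.n) : J.1.p j ≤ J.1.P :=
  le_sup (f := J.1.p) (mem_univ j)

lemma P_le (J : NormalizedInstance A) : J.1.P ≤ J.1.n * J.1.P :=
  Nat.le_mul_of_pos_left _ (Nat.pos_of_ne_zero fun h => by have := J.2.2; simp [h] at this)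

lemma sum_p_le (J : NormalizedInstance A) : ∑ j, J.1.p j ≤ J.1.n * J.1.P := by
  refine (sum_le_card_nsmul _ _ _ fun j _ => J.p_le j).trans ?_
  simp

lemma r_le (J : NormalizedInstance A) (j : Fin J.1.n) : J.1.r j ≤ J.1.n * J.1.P :=
  (J.2.1.r_le j).trans J.sum_p_le

lemma w_le (J : NormalizedInstance A) (j : Fin J.1.n) :
    J.1.w j ≤ A * (J.1.n * J.1.P) * (J.1.n * J.1.P) := by
  refine (J.2.1.w_le j).trans ?_
  calc A * J.1.n ^ 2 * J.1.P = A * (J.1.n * J.1.P) * J.1.n := by ring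
    _ ≤ _ := Nat.mul_le_mul_left _ J.n_le

lemma expBounded_n : ExpBounded (logSize (A := A)) 1 fun J => J.1.n :=
  expBounded_size.mono n_le

lemma expBounded_totalProc : ExpBounded (logSize (A := A)) 1 fun J => totalProc J.1.jobs :=
  expBounded_size.mono fun J => by rw [JobInstance.totalProc_jobs]; exact J.sum_p_le

lemma expBounded_totalWeight : ExpBounded (logSize (A := A)) 1 fun J => totalWeight J.1.jobs := by
  refine ((expBounded_size.mul (((ExpBounded.const one_le_logSize A 1).mul expBounded_size).mul
    expBounded_size))).mono fun J => ?_
  rw [JobInstance.totalWeight_jobs]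
  refine (sum_le_card_nsmul _ _ _ fun j _ => J.w_le j).trans ?_
  simp only [card_univ, Fintype.card_fin, smul_eq_mul]
  exact Nat.mul_le_mul_right _ J.n_le

lemma expBounded_sz_jobs : ExpBounded (logSize (A := A)) 1 fun J => sz J.1.jobs := by
  have hc : ∀ c, ExpBounded (logSize (A := A)) 1 fun _ => c := fun c => .const one_le_logSize c 1
  have h := expBounded_size (A := A)
  refine ((expBounded_n.mul ((((h.mul (hc 4)).add one_le_logSize
    ((hc 2).mul (((hc A).mul h).mul h))).add one_le_logSize (hc 7)).add one_le_logSize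
      (hc 1))).add one_le_logSize (hc 1)).mono fun J => ?_
  refine (sz_le_of_forall (B := J.1.n * J.1.P * 4 + 2 * (A * (J.1.n * J.1.P) * (J.1.n * J.1.P)) + 7)
    ?_).trans (by rw [JobInstance.length_jobs])
  intro x hx
  simp only [JobInstance.jobs, List.mem_map] at hx
  obtain ⟨j, -, rfl⟩ := hx
  have h1 := J.r_le j
  have h2 := (J.p_le j).trans J.P_le
  have h3 := J.w_le j
  simp only [sz_cons, sz_nat, sz_nil]
  omega

/-- With `l = ⌊log₂ N⌋` one has `l * ln 2 ≤ ln N`, so `D * l³ * ln 2 ≤ D / (ln 2)² * (ln N)³`, and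
the logarithm of `quasiPoly c` is `c * (ln N)³`. -/
lemma exists_le_quasiPoly {g : NormalizedInstance A → ℕ} (hg : ExpBounded logSize 3 g) :
    ∃ c : ℝ, 0 ≤ c ∧ ∀ J, (g J : ℝ) ≤ J.1.quasiPoly c := by
  obtain ⟨D, hD⟩ := hg
  have hlog : 0 < Real.log 2 := Real.log_pos (by norm_num)
  refine ⟨D / Real.log 2 ^ 2, by positivity, fun J => ?_⟩
  set N := J.1.n * J.1.P with hN
  have hN2 : 2 ≤ N := J.2.2
  have hN0 : (0 : ℝ) < N := by exact_mod_cast (by omega : 0 < N)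
  have h1 : (J.logSize : ℝ) * Real.log 2 ≤ Real.log N := by
    rw [← Real.log_pow]
    refine Real.log_le_log (by positivity) ?_
    exact_mod_cast Nat.pow_log_le_self 2 (by omega : N ≠ 0)
  have h2 : (g J : ℝ) ≤ 2 ^ (D * J.logSize ^ 3) := by exact_mod_cast hD J
  refine h2.trans ?_
  rw [JobInstance.quasiPoly, ← hN, Real.rpow_def_of_pos hN0,
    ← Real.log_le_log_iff (by positivity) (Real.exp_pos _), Real.log_exp, Real.log_pow]
  push_cast
  have h3 : ((J.logSize : ℝ) * Real.log 2) ^ 3 ≤ Real.log N ^ 3 :=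
    pow_le_pow_left₀ (by positivity) h1 3
  have h4 : Real.log N * (D / Real.log 2 ^ 2 * Real.log N ^ 2) =
      D / Real.log 2 ^ 2 * Real.log N ^ 3 := by ring
  rw [h4]
  calc (D : ℝ) * (J.logSize : ℝ) ^ 3 * Real.log 2 =
        D / Real.log 2 ^ 2 * ((J.logSize : ℝ) * Real.log 2) ^ 3 := by
        field_simp
    _ ≤ _ := mul_le_mul_of_nonneg_left h3 (by positivity)

end NormalizedInstance

/-! ### The approximation algorithm for weighted flow time -/

lemma timeIn_slotJobs (q : ℕ) :
    TimeIn (fun I => sz I + (totalProc I + 1) ^ numClasses q I)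
      fun I => slotJobs q I (bestVolumes q I (volumeVectors q I)) := by
  have hsz : PolyBounded (fun I => sz I + (totalProc I + 1) ^ numClasses q I) sz :=
    PolyBounded.self.mono fun _ => Nat.le_add_right _ _
  have h1 : PTime fun I : List (List ℕ) => (List.range (totalProc I + 1), numClasses q I) := by
    fun_prop
  have h2 : TimeIn (fun I => sz I + (totalProc I + 1) ^ numClasses q I)
      fun I => volumeVectors q I := by
    refine TimeIn.comp' (g := fun x : List ℕ × ℕ => lists x.1 x.2)
      (f := fun I => (List.range (totalProc I + 1), numClasses q I)) TimeIn.lists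
      (h1.timeIn hsz) ?_
    refine ((h1.polyBounded_sz.comp (φ := id) hsz).add
      (PolyBounded.self.mono fun I => Nat.le_add_left _ (sz I))).mono fun I => ?_
    simp
  exact TimeIn.comp (g := fun x : List (List ℕ) × List (List ℕ) =>
    slotJobs q x.1 (bestVolumes q x.1 x.2)) (f := fun I => (I, volumeVectors q I))
    PTime.slotJobs ((PTime.timeIn (f := fun I => I) PTime.id' hsz).pair h2)

theorem exists_flowTime_program (ε : ℝ) (A : ℕ) (hε : 0 < ε) : ∃ (prog : Program) (c : ℝ),
    ∀ J : JobInstance, J.Normalized A → 2 ≤ J.n * J.P →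
      ∃ (L : List (Option (Fin J.n))) (C : Fin J.n → ℝ),
        prog.OutputsWithin J.encode (J.encodeSlots L) (J.quasiPoly c) ∧
        J.IsSchedule (J.slotSchedule L) C ∧ J.flowTime C ≤ (2 + ε) * J.optFlowTime := by
  -- Then `q ≥ 1` and `ε * q ≥ 4`, so `(2q + 1)(q + 1) = 2q² + 3q + 1 ≤ (2 + ε) * q²`.
  obtain ⟨q, hq⟩ := exists_nat_ge (4 / ε + 1)
  have hq1 : (1 : ℝ) ≤ q := by have : 0 < 4 / ε := by positivity
                               linarith
  obtain ⟨prog, d, hprog⟩ := (timeIn_slotJobs q).exists_program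
  have hl := NormalizedInstance.one_le_logSize (A := A)
  have hbound : ExpBounded (NormalizedInstance.logSize (A := A)) 3 fun J =>
      (sz J.1.jobs + (totalProc J.1.jobs + 1) ^ numClasses q J.1.jobs + 2) ^ d := by
    have hV := NormalizedInstance.expBounded_totalProc (A := A)
    have hc : ∀ k c, ExpBounded (NormalizedInstance.logSize (A := A)) k fun _ => c :=
      fun k c => .const hl c k
    have h0 : ∀ c, LogBounded (NormalizedInstance.logSize (A := A)) 1 fun _ => c :=
      fun c => (LogBounded.const c).of_le hl (by norm_num)
    -- Each of the two roundings contributes a logarithm. With `O(l²)` coordinates of size `2^O(l)`,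
    -- the number of volume vectors is `2^O(l³)`.
    have h1 : LogBounded (NormalizedInstance.logSize (A := A)) 2 fun J =>
        numClasses q J.1.jobs := by
      have := ((LogBounded.const q).mul (hV.log.add (h0 1))).mul
        ((LogBounded.const q).mul (NormalizedInstance.expBounded_totalWeight.log.add (h0 1)))
      exact this
    exact ((((NormalizedInstance.expBounded_sz_jobs.of_le hl (by norm_num)).add hl
      ((hV.add hl (hc 1 1)).pow h1)).add hl (hc 3 2)).pow (.const d))
  obtain ⟨c, -, hc⟩ := NormalizedInstance.exists_le_quasiPoly hbound
  refine ⟨prog, c, fun J hJ hJ2 => ?_⟩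
  obtain ⟨L, C, h1, h2, h3⟩ := J.exists_schedule (q := q) (by exact_mod_cast hq1) hJ.one_le_p
    hJ.one_le_w
  refine ⟨L, C, ?_, h2, ?_⟩
  · obtain ⟨k, s, h4, h5, h6⟩ := hprog J.jobs
    rw [JobInstance.code_jobs] at h4
    exact ⟨k, s, h4, by rw [h5, h1], h6.trans (hc ⟨J, hJ, hJ2⟩)⟩
  · have hopt : 0 ≤ J.optFlowTime := by
      refine Real.sInf_nonneg ?_
      rintro _ ⟨σ, C, hσ, rfl⟩
      exact sum_nonneg fun j _ => mul_nonneg (Nat.cast_nonneg _) (by linarith [(hσ.2 j).1])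
    have hqε : 4 ≤ ε * q := by
      have : 4 / ε ≤ q := by linarith
      rw [div_le_iff₀ hε] at this; linarith
    have h4 : (((2 * q + 1) * (q + 1) : ℕ) : ℝ) ≤ (q * q : ℕ) * (2 + ε) := by
      push_cast; nlinarith
    have hqq : (0 : ℝ) < (q * q : ℕ) := by push_cast; positivity
    refine le_of_mul_le_mul_left (h3.trans ?_) hqq
    calc _ ≤ (q * q : ℕ) * (2 + ε) * J.optFlowTime := mul_le_mul_of_nonneg_right h4 hopt
      _ = _ := by ring

/-! ### Selections by budgets in a single cell

The jobs of the cell `c₀` are those with `cell i = c₀`.  A job `i` has `h i` segments in the cell,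
with costs `c i 0, …, c i (h i - 1)`.  For every key `k` and every `j < R` there is a budget
`u * b (k * R + j)` for the `j`-th segments of the jobs with this key; it is spent on the jobs that
are released last. -/

section
variable (n : ℕ) (cell key h : ℕ → ℕ) (c : ℕ → ℕ → ℕ) (c₀ R u : ℕ) (b : ℕ → ℕ)

/-- The cost of the `j`-th segments of job `i` and the later jobs with the same key. -/
def laterCost (i j : ℕ) : ℕ :=
  sumTo n fun i' => if i ≤ i' ∧ cell i' = c₀ ∧ key i' = key i ∧ j < h i' then c i' j else 0

/-- The selection of a prefix of the segments of each job that respects all budgets. -/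
def selected (i j : ℕ) : Bool :=
  decide (cell i = c₀ ∧ j < h i) &&
    allTo (j + 1) fun j' => decide (laterCost n cell key h c c₀ i j' ≤ u * b (key i * R + j'))

end

lemma selected_iff {n : ℕ} {cell key h : ℕ → ℕ} {c : ℕ → ℕ → ℕ} {c₀ R u : ℕ} {b : ℕ → ℕ}
    {i j : ℕ} : selected n cell key h c c₀ R u b i j = true ↔ cell i = c₀ ∧ j < h i ∧
      ∀ j' ≤ j, laterCost n cell key h c c₀ i j' ≤ u * b (key i * R + j') := by
  simp [selected, allTo_iff, and_assoc]

lemma sum_range_mul (f : ℕ → ℕ) (L R : ℕ) :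
    ∑ x ∈ range (L * R), f x = ∑ k ∈ range L, ∑ j ∈ range R, f (k * R + j) := by
  induction L with
  | zero => simp
  | succ L ih => rw [add_mul, one_mul, sum_range_add, ih, sum_range_succ]

lemma sum_div_le {ι : Type*} (s : Finset ι) (f : ι → ℕ) {u : ℕ} (hu : 0 < u) :
    ∑ i ∈ s, f i / u ≤ (∑ i ∈ s, f i) / u := by
  rw [Nat.le_div_iff_mul_le hu, sum_mul]
  exact sum_le_sum fun i _ => Nat.div_mul_le_self _ _

section
variable {n : ℕ} {cell key h p : ℕ → ℕ} {c : ℕ → ℕ → ℕ} {c₀ R L q : ℕ} {Y : ℕ → ℕ → Prop}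

open Classical in
/-- The volume of the `j`-th segments in `Y` that belong to jobs with key `k`. -/
noncomputable def volumeIn (n : ℕ) (key p : ℕ → ℕ) (Y : ℕ → ℕ → Prop) (k j : ℕ) : ℕ :=
  ∑ i ∈ (range n).filter (fun i => Y i j ∧ key i = k), p i

/-- The volume of the jobs of the cell that have the same key as `i` and are released later. -/
def laterVolume (n : ℕ) (cell key p : ℕ → ℕ) (c₀ i : ℕ) : ℕ :=
  ∑ i' ∈ (range n).filter (fun i' => i < i' ∧ cell i' = c₀ ∧ key i' = key i), p i'

/-- The latest jobs with a given key whose volume is at least the volume of those in `Y`. -/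
def Latest (n : ℕ) (cell key h p : ℕ → ℕ) (c₀ : ℕ) (Y : ℕ → ℕ → Prop) (i j : ℕ) : Prop :=
  cell i = c₀ ∧ j < h i ∧ laterVolume n cell key p c₀ i < volumeIn n key p Y (key i) j

lemma laterVolume_anti {i i' : ℕ} (hi : i ≤ i') (hk : key i' = key i) :
    laterVolume n cell key p c₀ i' ≤ laterVolume n cell key p c₀ i :=
  sum_le_sum_of_subset fun k hk' => by
    simp only [mem_filter] at hk' ⊢
    exact ⟨hk'.1, by omega, hk'.2.2.1, by omega⟩

lemma volumeIn_anti (hdown : ∀ i j j', Y i j → j' ≤ j → Y i j') {k j j' : ℕ} (hj : j' ≤ j) :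
    volumeIn n key p Y k j ≤ volumeIn n key p Y k j' :=
  sum_le_sum_of_subset fun i hi => by
    simp only [mem_filter] at hi ⊢
    exact ⟨hi.1, hdown i j j' hi.2.1 hj, hi.2.2⟩

lemma Latest.down (hdown : ∀ i j j', Y i j → j' ≤ j → Y i j') {i j j' : ℕ}
    (hi : Latest n cell key h p c₀ Y i j) (hj : j' ≤ j) : Latest n cell key h p c₀ Y i j' :=
  ⟨hi.1, by have := hi.2.1; omega, hi.2.2.trans_le (volumeIn_anti hdown hj)⟩

-- Without its earliest job the set of latest jobs has less volume than the set in `Y` it replaces,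
-- so the exchange argument applies.
open Classical in
lemma latest_cost_le {D N : ℕ} (hp : ∀ i < n, 1 ≤ p i)
    (hY : ∀ i j, Y i j → i < n ∧ cell i = c₀ ∧ j < h i)
    (hpq : ∀ i < n, ∀ i' < n, cell i = c₀ → cell i' = c₀ → key i = key i' →
      q * p i ≤ (q + 1) * p i')
    (hc : ∀ i < n, ∀ i' < n, cell i = c₀ → cell i' = c₀ → key i = key i' → ∀ j,
      D * c i j ≤ N * c i' j) (k j : ℕ) :
    q * D * ∑ i ∈ (range n).filter (fun i => Latest n cell key h p c₀ Y i j ∧ key i = k), c i j ≤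
      (2 * q + 1) * N * ∑ i ∈ (range n).filter (fun i => Y i j ∧ key i = k), c i j := by
  set F := (range n).filter (fun i => Latest n cell key h p c₀ Y i j ∧ key i = k) with hF
  rcases F.eq_empty_or_nonempty with h0 | h0
  · simp [h0]
  obtain ⟨i₀, hi₀, hmin⟩ := exists_min_image F id h0
  have hi₀F := hi₀
  simp only [hF, mem_filter, mem_range] at hi₀
  refine sum_le_of_sum_erase_lt (p := p) (i₀ := i₀) ?_ ?_ hi₀F ?_ ?_
  · intro i hi; simp only [hF, mem_filter, mem_range] at hi; exact hp i hi.1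
  · intro i hi i' hi'
    simp only [hF, mem_filter, mem_range] at hi hi'
    exact hpq i' hi'.1 i hi.1 (hY _ _ hi'.2.1).2.1 hi.2.1.1 (by omega)
  · refine lt_of_le_of_lt ?_ ((hi₀.2.1.2.2).trans_eq (by rw [hi₀.2.2]; rfl))
    refine sum_le_sum_of_subset fun i hi => ?_
    have h1 := hmin i (mem_of_mem_erase hi)
    simp only [hF, mem_erase, mem_filter, mem_range, id] at hi h1 ⊢
    exact ⟨hi.2.1, by omega, hi.2.2.1.1, by omega⟩
  · intro i hi i' hi'
    simp only [hF, mem_filter, mem_range] at hi hi'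
    exact hc i hi.1 i' hi'.1 hi.2.1.1 (hY _ _ hi'.2.1).2.1 (by omega) j

open Classical in
/-- In each set of jobs that contains all later jobs, the latest jobs have at least the volume of
the jobs in `Y`. -/
lemma volume_le_latest (hY : ∀ i j, Y i j → i < n ∧ cell i = c₀ ∧ j < h i)
    (hh : ∀ i < n, ∀ i' < n, cell i = c₀ → cell i' = c₀ → key i = key i' → h i = h i')
    {U : ℕ → Prop} (hU : ∀ i i', i ≤ i' → i' < n → U i → U i') (k j : ℕ) :
    ∑ i ∈ (range n).filter (fun i => U i ∧ Y i j ∧ key i = k), p i ≤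
      ∑ i ∈ (range n).filter (fun i => U i ∧ Latest n cell key h p c₀ Y i j ∧ key i = k), p i := by
  -- Either all candidates in `U` are taken, or the last one that is not taken has at least the
  -- volume of `Y` behind it; the jobs behind it lie in `U` and are all taken.
  by_cases hall : ∀ i < n, U i → cell i = c₀ → key i = k → j < h i →
      Latest n cell key h p c₀ Y i j
  · refine sum_le_sum_of_subset fun i hi => ?_
    simp only [mem_filter, mem_range] at hi ⊢
    obtain ⟨-, h1, h2⟩ := hY i j hi.2.2.1
    exact ⟨hi.1, hi.2.1, hall i hi.1 hi.2.1 h1 hi.2.2.2 h2, hi.2.2.2⟩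
  · push Not at hall
    obtain ⟨i₁, hi₁, hmax⟩ := exists_max_image ((range n).filter fun i => U i ∧ cell i = c₀ ∧
      key i = k ∧ j < h i ∧ ¬ Latest n cell key h p c₀ Y i j) id (by
        obtain ⟨i, hi⟩ := hall
        exact ⟨i, by simp only [mem_filter, mem_range]; tauto⟩)
    simp only [mem_filter, mem_range, id] at hi₁ hmax
    obtain ⟨h1, h2, h3, h4, h5, h6⟩ := hi₁
    have h7 : volumeIn n key p Y k j ≤ laterVolume n cell key p c₀ i₁ := by
      by_contra hlt
      exact h6 ⟨h3, h5, by rw [h4]; omega⟩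
    calc _ ≤ volumeIn n key p Y k j := sum_le_sum_of_subset fun i hi => by
          simp only [mem_filter] at hi ⊢; tauto
      _ ≤ _ := h7
      _ ≤ _ := sum_le_sum_of_subset fun i hi => by
          simp only [mem_filter, mem_range] at hi ⊢
          obtain ⟨hi1, hi2, hi3, hi4⟩ := hi
          have hUi := hU i₁ i (by omega) hi1 h2
          refine ⟨hi1, hUi, ?_, by omega⟩
          by_contra hL
          have hhi := hh i₁ h1 i hi1 h3 hi3 hi4.symm
          have := hmax i ⟨hi1, hUi, hi3, by omega, by omega, hL⟩
          omega

open Classical in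
/-- There are budgets with a short description such that the selected segments cover as much as
those in `Y`, and cost at most `2 + O(1/q)` times as much. -/
theorem exists_budgets {D N M : ℕ} (hq : 1 ≤ q) (hL : 1 ≤ L) (hR : 1 ≤ R) (hp : ∀ i < n, 1 ≤ p i)
    (hY : ∀ i j, Y i j → i < n ∧ cell i = c₀ ∧ j < h i)
    (hdown : ∀ i j j', Y i j → j' ≤ j → Y i j')
    (hh : ∀ i < n, ∀ i' < n, cell i = c₀ → cell i' = c₀ → key i = key i' → h i = h i')
    (hhR : ∀ i < n, cell i = c₀ → h i ≤ R) (hkey : ∀ i < n, cell i = c₀ → key i < L)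
    (hpq : ∀ i < n, ∀ i' < n, cell i = c₀ → cell i' = c₀ → key i = key i' →
      q * p i ≤ (q + 1) * p i')
    (hc : ∀ i < n, ∀ i' < n, cell i = c₀ → cell i' = c₀ → key i = key i' → ∀ j,
      D * c i j ≤ N * c i' j)
    (hM : ∑ i ∈ range n, ∑ j ∈ range R, c i j ≤ M) :
    ∃ (u : ℕ) (b : ℕ → ℕ), u ≤ M + 1 ∧ ∑ x ∈ range (L * R), b x ≤ (q + 1) * (L * R) ∧
      q * (q * D) * ∑ i ∈ range n, ∑ j ∈ range R,
          (if selected n cell key h c c₀ R u b i j = true then c i j else 0) ≤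
        (q + 1) * ((2 * q + 1) * N) * ∑ i ∈ range n, ∑ j ∈ range R, (if Y i j then c i j else 0) ∧
      ∀ U Φ : ℕ → Prop, (∀ i i', i ≤ i' → i' < n → U i → U i') →
        (∀ i < n, ∀ i' < n, cell i = c₀ → cell i' = c₀ → key i = key i' → Φ i → Φ i') → ∀ j,
        ∑ i ∈ (range n).filter (fun i => U i ∧ Φ i ∧ Y i j), p i ≤
          ∑ i ∈ (range n).filter (fun i => U i ∧ Φ i ∧
            selected n cell key h c c₀ R u b i j = true), p i := by
  set Z := Latest n cell key h p c₀ Y with hZ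
  set cz : ℕ → ℕ → ℕ := fun k j => ∑ i ∈ (range n).filter (fun i => Z i j ∧ key i = k), c i j
    with hcz
  set B := ∑ k ∈ range L, ∑ j ∈ range R, cz k j with hB
  have hLR : 0 < q * (L * R) := by positivity
  -- The unit is small enough that rounding up all `L * R` budgets loses at most `B / q`, and large
  -- enough that the rounded budgets add up to at most `(q + 1) * (L * R)` units.
  set u := B / (q * (L * R)) + 1 with hu
  set b : ℕ → ℕ := fun x => (cz (x / R) (x % R) + (u - 1)) / u with hb
  have hbk : ∀ k, ∀ j < R, b (k * R + j) = (cz k j + (u - 1)) / u := by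
    intro k j hj
    simp only [hb]
    rw [mul_comm k R, Nat.mul_add_div hR, Nat.div_eq_of_lt hj, add_zero, Nat.mul_add_mod,
      Nat.mod_eq_of_lt hj]
  have hu0 : 0 < u := Nat.succ_pos _
  have hub1 : ∀ k, ∀ j < R, cz k j ≤ u * b (k * R + j) := by
    intro k j hj
    rw [hbk k j hj]
    have := Nat.lt_mul_div_succ (cz k j + (u - 1)) hu0
    rw [mul_add, mul_one] at this; omega
  have hub2 : ∀ k, ∀ j < R, u * b (k * R + j) ≤ cz k j + (u - 1) := by
    intro k j hj
    rw [hbk k j hj]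
    exact Nat.mul_div_le _ _
  -- rearrangement of double sums by keys
  have hfib : ∀ (P : ℕ → ℕ → Prop) [∀ i j, Decidable (P i j)],
      (∀ i j, P i j → cell i = c₀ ∧ j < h i) → ∀ f : ℕ → ℕ → ℕ,
      ∑ i ∈ range n, ∑ j ∈ range R, (if P i j then f i j else 0) =
        ∑ k ∈ range L, ∑ j ∈ range R,
          ∑ i ∈ (range n).filter (fun i => P i j ∧ key i = k), f i j := by
    intro P _ hP f
    rw [sum_comm, sum_comm (s := range L)]
    refine sum_congr rfl fun j _ => ?_
    rw [← sum_filter, ← sum_fiberwise_of_maps_to (t := range L) (g := key)]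
    · simp only [filter_filter]
    · intro i hi
      simp only [mem_filter, mem_range] at hi ⊢
      exact hkey i hi.1 (hP i j hi.2).1
  have hZh : ∀ i j, Z i j → cell i = c₀ ∧ j < h i := fun i j hi => ⟨hi.1, hi.2.1⟩
  have hYh : ∀ i j, Y i j → cell i = c₀ ∧ j < h i := fun i j hi => (hY i j hi).2
  have hBY : q * D * B ≤ (2 * q + 1) * N *
      ∑ i ∈ range n, ∑ j ∈ range R, (if Y i j then c i j else 0) := by
    rw [hfib Y hYh, hB, mul_sum, mul_sum]
    refine sum_le_sum fun k _ => ?_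
    rw [mul_sum, mul_sum]
    exact sum_le_sum fun j _ => latest_cost_le hp hY hpq hc k j
  -- A later job with the key of a latest job is itself among the latest jobs, so the cost from `i`
  -- on is part of `cz`, which the budget covers.
  have hZsel : ∀ i j, i < n → Z i j → selected n cell key h c c₀ R u b i j = true := by
    intro i j hi hij
    refine selected_iff.2 ⟨hij.1, hij.2.1, fun j' hj' => ?_⟩
    have hij' := Latest.down hdown hij hj'
    refine le_trans ?_ (hub1 (key i) j' (hij'.2.1.trans_le (hhR i hi hij.1)))
    simp only [laterCost, sumTo_eq, ← sum_filter, hcz]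
    refine sum_le_sum_of_subset fun i' hi' => ?_
    simp only [mem_filter] at hi' ⊢
    obtain ⟨h1, h2, h3, h4, h5⟩ := hi'
    refine ⟨h1, ⟨h3, h5, ?_⟩, h4⟩
    have := laterVolume_anti (n := n) (cell := cell) (p := p) (c₀ := c₀) h2 h4
    rw [h4]
    exact this.trans_lt hij'.2.2
  refine ⟨u, b, ?_, ?_, ?_, ?_⟩
  · have h1 : B ≤ M := by
      rw [hB, ← hfib Z hZh]
      refine le_trans (sum_le_sum fun i _ => sum_le_sum fun j _ => ?_) hM
      split_ifs <;> simp
    have := Nat.div_le_self B (q * (L * R))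
    omega
  · rw [sum_range_mul]
    have h1 : ∀ k, ∀ j < R, b (k * R + j) ≤ cz k j / u + 1 := by
      intro k j hj
      rw [hbk k j hj, ← Nat.add_div_right _ hu0]
      exact Nat.div_le_div_right (by omega)
    calc ∑ k ∈ range L, ∑ j ∈ range R, b (k * R + j)
        ≤ ∑ k ∈ range L, ∑ j ∈ range R, (cz k j / u + 1) :=
          sum_le_sum fun k _ => sum_le_sum fun j hj => h1 k j (mem_range.1 hj)
      _ = ∑ k ∈ range L, ∑ j ∈ range R, cz k j / u + L * R := by simp [sum_add_distrib]
      _ ≤ B / u + L * R := by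
          refine Nat.add_le_add_right ?_ _
          rw [hB]
          refine le_trans (sum_le_sum fun k _ => sum_div_le _ _ hu0) (sum_div_le _ _ hu0)
      _ ≤ q * (L * R) + L * R := by
          refine Nat.add_le_add_right ?_ _
          rw [Nat.div_le_iff_le_mul_add_pred hu0]
          have := Nat.lt_mul_div_succ B hLR
          rw [← hu] at this
          rw [mul_comm]; omega
      _ = _ := by ring
  · rw [hfib (fun i j => selected n cell key h c c₀ R u b i j = true)
      (fun i j hij => ⟨(selected_iff.1 hij).1, (selected_iff.1 hij).2.1⟩)]
    have h1 : ∑ k ∈ range L, ∑ j ∈ range R, ∑ i ∈ (range n).filter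
        (fun i => selected n cell key h c c₀ R u b i j = true ∧ key i = k), c i j ≤
        B + L * R * (u - 1) := by
      calc _ ≤ ∑ k ∈ range L, ∑ j ∈ range R, (cz k j + (u - 1)) := by
            refine sum_le_sum fun k _ => sum_le_sum fun j hj => ?_
            refine le_trans ?_ (hub2 k j (mem_range.1 hj))
            set F := (range n).filter
              (fun i => selected n cell key h c c₀ R u b i j = true ∧ key i = k) with hF
            rcases F.eq_empty_or_nonempty with h0 | h0
            · simp [h0]
            obtain ⟨i₀, hi₀, hmin⟩ := exists_min_image F id h0
            simp only [hF, mem_filter, mem_range] at hi₀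
            have h2 := (selected_iff.1 hi₀.2.1).2.2 j le_rfl
            rw [hi₀.2.2] at h2
            refine le_trans ?_ h2
            simp only [laterCost, sumTo_eq, ← sum_filter]
            refine sum_le_sum_of_subset fun i hi => ?_
            have h3 := hmin i hi
            simp only [hF, mem_filter, id] at hi h3 ⊢
            have h4 := selected_iff.1 hi.2.1
            exact ⟨hi.1, h3, h4.1, by omega, h4.2.1⟩
        _ = _ := by simp [sum_add_distrib, hB, mul_assoc]
    have h2 : q * (L * R * (u - 1)) ≤ B := by
      rw [hu, Nat.add_sub_cancel, ← mul_assoc]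
      exact Nat.mul_div_le _ _
    calc q * (q * D) * _ ≤ q * (q * D) * (B + L * R * (u - 1)) := Nat.mul_le_mul_left _ h1
      _ = q * D * (q * B + q * (L * R * (u - 1))) := by ring
      _ ≤ q * D * (q * B + B) := Nat.mul_le_mul_left _ (Nat.add_le_add_left h2 _)
      _ = (q + 1) * (q * D * B) := by ring
      _ ≤ (q + 1) * _ := Nat.mul_le_mul_left _ hBY
      _ = _ := by ring
  · intro U Φ hU hΦ j
    have hmap : ∀ (P : ℕ → Prop) [DecidablePred P], (∀ i, P i → cell i = c₀) →
        ∑ i ∈ (range n).filter (fun i => U i ∧ Φ i ∧ P i), p i = ∑ k ∈ range L,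
          ∑ i ∈ (range n).filter (fun i => (U i ∧ Φ i ∧ P i) ∧ key i = k), p i := by
      intro P _ hP
      rw [← sum_fiberwise_of_maps_to (t := range L) (g := key)]
      · simp only [filter_filter]
      · intro i hi
        simp only [mem_filter, mem_range] at hi ⊢
        exact hkey i hi.1 (hP i hi.2.2.2)
    rw [hmap (fun i => Y i j) fun i hi => (hYh i j hi).1,
      hmap (fun i => selected n cell key h c c₀ R u b i j = true) fun i hi => (selected_iff.1 hi).1]
    refine sum_le_sum fun k _ => ?_
    -- Since `Φ` depends on the key only, either all jobs of the cell with key `k` satisfy it or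
    -- none does.
    by_cases hex : ∃ i < n, cell i = c₀ ∧ key i = k ∧ Φ i
    · obtain ⟨i₀, h1, h2, h3, h4⟩ := hex
      have h5 := volume_le_latest (p := p) hY hh hU k j
      refine le_trans (le_trans (sum_le_sum_of_subset fun i hi => ?_) h5)
        (sum_le_sum_of_subset fun i hi => ?_)
      · simp only [mem_filter] at hi ⊢; tauto
      · simp only [mem_filter, mem_range] at hi ⊢
        exact ⟨hi.1, ⟨hi.2.1, hΦ i₀ h1 i hi.1 h2 hi.2.2.1.1 (by omega) h4,
          hZsel i j hi.1 hi.2.2.1⟩, hi.2.2.2⟩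
    · have : (range n).filter (fun i => (U i ∧ Φ i ∧ Y i j) ∧ key i = k) = ∅ := by
        refine filter_eq_empty_iff.2 fun i hi hi' => hex ?_
        exact ⟨i, mem_range.1 hi, (hYh i j hi'.1.2.2).1, hi'.2, hi'.1.2.1⟩
      rw [this]; simp

end

/-! ### Short descriptions of budgets -/

/-- The lengths of the runs of ones in a list of bits, each of them terminated by a zero. -/
def runs (l : List ℕ) : List ℕ :=
  l.reverse.foldl (fun acc a => if a = 0 then 0 :: acc else (acc.headD 0 + 1) :: acc.tail) []

lemma runs_cons (a : ℕ) (l : List ℕ) :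
    runs (a :: l) = if a = 0 then 0 :: runs l else ((runs l).headD 0 + 1) :: (runs l).tail := by
  simp [runs]

lemma runs_replicate_append (k : ℕ) (l : List ℕ) :
    runs (List.replicate k 1 ++ 0 :: l) = k :: runs l := by
  induction k with
  | zero => simp [runs_cons]
  | succ k ih => simp [List.replicate_succ, runs_cons, ih]

/-- Each value is written in unary and closed by a zero, and the word is padded with zeros to a
fixed length. The cost is the sum of the values plus their number, with no logarithm per value. -/
lemma exists_bits (b : ℕ → ℕ) (L M : ℕ) (hb : ∑ x ∈ range L, b x ≤ M) :
    ∃ l ∈ lists [0, 1] (M + L), ∀ x < L, (runs l).getD x 0 = b x := by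
  have key : ∀ (bs : List ℕ) (M : ℕ), bs.sum ≤ M → ∃ l ∈ lists [0, 1] (M + bs.length),
      ∀ x < bs.length, (runs l).getD x 0 = bs.getD x 0 := by
    intro bs
    induction bs with
    | nil =>
      intro M _
      refine ⟨List.replicate M 0, (mem_lists _ _ _).2 ⟨by simp, ?_⟩, by simp⟩
      intro a ha
      rw [List.eq_of_mem_replicate ha]; simp
    | cons k bs ih =>
      intro M hM
      rw [List.sum_cons] at hM
      obtain ⟨l, hl, h1⟩ := ih (M - k) (by omega)
      obtain ⟨h2, h3⟩ := (mem_lists _ _ _).1 hl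
      refine ⟨List.replicate k 1 ++ 0 :: l, (mem_lists _ _ _).2 ⟨?_, ?_⟩, ?_⟩
      · simp only [List.length_append, List.length_replicate, List.length_cons, h2]; omega
      · intro a ha
        rw [List.mem_append, List.mem_cons] at ha
        rcases ha with ha | rfl | ha
        · rw [List.eq_of_mem_replicate ha]; simp
        · simp
        · exact h3 a ha
      · intro x hx
        rw [runs_replicate_append]
        cases x with
        | zero => rfl
        | succ x => simpa only [List.getD_cons_succ] using h1 x (by simpa using hx)
  obtain ⟨l, hl, h⟩ := key ((List.range L).map b) M (by
    have := sumTo_eq L b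
    rw [sumTo] at this
    omega)
  simp only [List.length_map, List.length_range] at hl h
  refine ⟨l, hl, fun x hx => (h x hx).trans ?_⟩
  simp [List.getD_eq_getElem?_getD, hx]

@[fun_prop] lemma PTime.runs {γ : Type} [Coded γ] {f : γ → List ℕ} (hf : PTime f) :
    PTime fun g => runs (f g) := by
  suffices PTime fun l : List ℕ => FlowTime.runs l from this.comp hf
  have h1 : ∀ l : List ℕ, sz (FlowTime.runs l) ≤ 4 * l.length + 1 := by
    intro l
    induction l with
    | nil => simp [FlowTime.runs]
    | cons a l ih =>
      rw [runs_cons]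
      split_ifs
      · simp only [sz_cons, sz_nat, List.length_cons]; omega
      · cases h : FlowTime.runs l with
        | nil => simp
        | cons k t =>
          rw [h] at ih
          simp only [List.headD_cons, List.tail_cons, sz_cons, sz_nat, List.length_cons] at ih ⊢
          omega
  unfold FlowTime.runs
  refine PTime.foldl (l := fun l : List ℕ => l.reverse) (i := fun _ => [])
    (g := fun _ acc a => if a = 0 then 0 :: acc else (acc.headD 0 + 1) :: acc.tail)
    (by fun_prop) (by fun_prop) (by fun_prop) (fun l => 4 * sz l + 1)
    (((PolyBounded.const 4).mul .self).add (.const 1)) fun l l' hl => ?_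
  have h2 := h1 l'.reverse
  rw [FlowTime.runs, List.reverse_reverse, List.length_reverse] at h2
  have h3 := hl.length_le
  rw [List.length_reverse] at h3
  have := length_lt_sz l
  omega

/-- The input of an algorithm for the covering problem: the list of the jobs, and the offsets. -/
abbrev GridData : Type := List (List ℕ) × ℕ × ℕ

namespace GridData

/-! ### The grid in natural coordinates

Positions are measured from the left end of the root cell. -/

section
variable (m q : ℕ) (z : GridData) (k i j t : ℕ)

/-- The number of children of a cell. -/
def base : ℕ := (2 * m) ^ m

/-- The position of the release time of a job. -/
def start : ℕ := release z.1 i + z.2.2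

/-- The last release time plus the total processing time. -/
def lastTime : ℕ := release z.1 (z.1.length - 1) + totalProc z.1

/-- The level of the smallest cells. -/
def depth : ℕ := Nat.log (base m) (lastTime z * base m ^ 2 - 1) + 1

/-- The length of the smallest cells. -/
def scale : ℕ := ((List.range m).map fun i => (2 * m) ^ i).getD z.2.1 1

/-- The length of the cells of level `k`. -/
def len : ℕ := scale m z * min (base m ^ (depth m z - k)) (lastTime z * base m ^ 3)

/-- The total length of one cell of each level after `k`. -/
def tailLen : ℕ := sumTo (depth m z - k) fun d => len m z (k + 1 + d)

/-- The cell of job `i` on level `k`. -/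
def cellIdx : ℕ := (start z i + tailLen m z k) / len m z k

/-- The end of the last segment of job `i` on level `k`. -/
def segEnd : ℕ := (cellIdx m z k i + 1) * len m z k

/-- The beginning of the first segment of job `i` on level `k`. -/
def segBeg : ℕ := if k = depth m z then start z i else segEnd m z (k + 1) i

/-- The length of the segments on level `k`. -/
def segLen : ℕ := if k + 2 ≤ depth m z then len m z (k + 2) else 1

/-- The number of segments of job `i` on level `k`. -/
def segNum : ℕ := (segEnd m z k i - segBeg m z k i) / segLen m z k

/-- The cost of the `j`-th segment of job `i` on level `k`. -/
def segCost : ℕ := weight z.1 i *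
  if j = 0 then segBeg m z k i + segLen m z k - start z i else segLen m z k

/-- An upper bound for the number of segments of a job on one level. -/
def maxSegs : ℕ := base m ^ 2

/-- Bounds the distance from the release of a job to its first segment on a level, in units of
`segLen / q`; see `Ok.startOffset_lt`. -/
def relBound : ℕ := 2 * base m * q + 1

def procClasses : ℕ := q * (Nat.log 2 (totalProc z.1) + 1)

def weightClasses : ℕ := q * (Nat.log 2 (totalWeight z.1) + 1)

def numKeys : ℕ := maxSegs m * relBound m q * procClasses q z * weightClasses q z

/-- Jobs with the same cell and the same key have the same segments in this cell, and similar
processing times and costs. -/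
def key : ℕ :=
  (((segBeg m z k i - cellIdx m z k i * len m z k) / segLen m z k * relBound m q +
    (segBeg m z k i - start z i) * q / segLen m z k) * procClasses q z +
      sizeClass q (proc z.1 i)) * weightClasses q z + sizeClass q (weight z.1 i)

/-- The cell of level `k` that contains time `t`. -/
def cellAtTime : ℕ := (t + z.2.2) / len m z k

/-- The selection of segments for the cell of level `k` that contains time `t`, by the budgets
that `s` describes. -/
def selectedAt (s : List (ℕ × List ℕ)) : Bool :=
  selected z.1.length (cellIdx m z k) (key m q z k) (segNum m z k) (segCost m z k)
    (cellAtTime m z k t) (maxSegs m) (s.getD k (0, [])).1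
    (fun y => (runs (s.getD k (0, [])).2).getD y 0) i j

/-- A cell of level `k` begins at time `t`. -/
def enters : Bool := decide (t = 0) || !decide (cellAtTime m z k (t - 1) = cellAtTime m z k t)

/-- The `j`-th segment of job `i` on level `k` contains time `t`. -/
def covers : Bool := decide (segBeg m z k i + j * segLen m z k ≤ t + z.2.2) &&
  decide (t + z.2.2 < segBeg m z k i + (j + 1) * segLen m z k)

/-- The selection does not change within a cell. -/
def sameSelection (s s' : List (ℕ × List ℕ)) : Bool :=
  allTo z.1.length fun i => allTo (maxSegs m) fun j =>
    (selectedAt m q z k i j t s && selectedAt m q z k i j t s') ||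
      (!selectedAt m q z k i j t s && !selectedAt m q z k i j t s')

/-- The capacity that is available at time `t` for the jobs that are released from time `b` on. -/
def capacityAt (b : ℕ) (s : List (ℕ × List ℕ)) : ℕ :=
  sumTo z.1.length fun i => sumTo (depth m z + 1) fun k => sumTo (maxSegs m) fun j =>
    if b ≤ release z.1 i ∧ covers m z k i j t = true ∧ selectedAt m q z k i j t s = true
    then proc z.1 i else 0

/-- The total processing time of the jobs that are released in `[b, t]`. -/
def releasedIn (b : ℕ) : ℕ :=
  sumTo z.1.length fun i => if b ≤ release z.1 i ∧ release z.1 i ≤ t then proc z.1 i else 0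

/-- Selections may change only where a new cell begins, and all covering constraints of intervals
`[b, t]` must hold. These are stated without subtraction. -/
def stepOk (s s' : List (ℕ × List ℕ)) : Bool :=
  allTo (depth m z + 1) (fun k => enters m z k t || sameSelection m q z k t s s') &&
    allTo (t + 1) fun b => decide (releasedIn z t b + b ≤ t + capacityAt m q z t b s')

/-- The cost of the selection for the cell of level `k` that contains time `t`. -/
def selectionCost (s : List (ℕ × List ℕ)) : ℕ :=
  sumTo z.1.length fun i => sumTo (maxSegs m) fun j =>
    if selectedAt m q z k i j t s = true then segCost m z k i j else 0

/-- The cost of the selections for the cells that begin at time `t`. -/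
def stepCost (s : List (ℕ × List ℕ)) : ℕ :=
  sumTo (depth m z + 1) fun k => if enters m z k t = true then selectionCost m q z k t s else 0

def bestSelections (S : List (List (ℕ × List ℕ))) : List (List (ℕ × List ℕ)) :=
  shortest [] (fun t s s' => stepOk m q z t s s') (fun t _ s => stepCost m q z t s) S (lastTime z)
    fun _ => true

/-- The selected rectangles of the cells that contain some time `t` and have the property `φ`. -/
def chosenRects (h : List (List (ℕ × List ℕ))) (φ : ℕ → ℕ → Bool) : List (List ℕ) :=
  (List.range (lastTime z + 1)).flatMap fun t => (List.range (depth m z + 1)).flatMap fun k =>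
    (List.range z.1.length).flatMap fun i =>
      ((List.range (maxSegs m)).filter fun j =>
        φ t k && selectedAt m q z k i j t (h.getD (lastTime z - t) [])).map fun j =>
          [i, segBeg m z k i + j * segLen m z k - z.2.2,
            segBeg m z k i + (j + 1) * segLen m z k - z.2.2]

/-- The cell of level `k` that contains time `t` is an ancestor of the cell `c` of level `l`. -/
def isAncestor (l c : ℕ) : Bool :=
  decide (cellAtTime m z k t * len m z k ≤ c * len m z l) &&
    decide ((c + 1) * len m z l ≤ (cellAtTime m z k t + 1) * len m z k)

/-- For every cell, the selected rectangles of its ancestors. -/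
def chosenFamily (h : List (List (ℕ × List ℕ))) : List ((ℕ × ℕ) × List (List (List ℕ))) :=
  (List.range (depth m z + 1)).flatMap fun l =>
    (List.range (min (base m ^ l) (lastTime z * base m ^ 3))).map fun c =>
      ((l, c), [chosenRects m q z h fun t k => isAncestor m z k t l c])

/-- A bound for the costs of selections. -/
def maxCost : ℕ := totalWeight z.1 * maxSegs m * (3 * len m z 0)

/-- The word length in `exists_bits` for `numKeys * maxSegs` budgets whose sum is bounded as in
`exists_budgets`. -/
def codeLength : ℕ := (q + 1) * (numKeys m q z * maxSegs m) + numKeys m q z * maxSegs m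

/-- A code consists of the unit of the budgets and a word for their multiples. -/
def cellCodes : List (ℕ × List ℕ) :=
  (List.range (maxCost m z + 2)).flatMap fun u =>
    (lists [0, 1] (codeLength m q z)).map fun l => (u, l)

/-- One code per level, for the cell of this level that contains the current time. -/
def states : List (List (ℕ × List ℕ)) := lists (cellCodes m q z) (depth m z + 1)

end

section
variable {γ : Type} [Coded γ] {m q : ℕ} {z : γ → GridData} {k i j t : γ → ℕ}
  {s s' : γ → List (ℕ × List ℕ)}

@[fun_prop] lemma _root_.FlowTime.PTime.decide_eq_true {f : γ → Bool} (hf : PTime f) :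
    PTime fun g => decide (f g = true) := by simpa using hf

@[fun_prop] lemma _root_.FlowTime.PTime.start (hz : PTime z) (hi : PTime i) :
    PTime fun g => start (z g) (i g) := by unfold GridData.start; fun_prop

@[fun_prop] lemma _root_.FlowTime.PTime.lastTime (hz : PTime z) :
    PTime fun g => lastTime (z g) := by unfold GridData.lastTime; fun_prop

@[fun_prop] lemma _root_.FlowTime.PTime.depth (hz : PTime z) :
    PTime fun g => depth m (z g) := by unfold GridData.depth; fun_prop

@[fun_prop] lemma _root_.FlowTime.PTime.scale (hz : PTime z) :
    PTime fun g => scale m (z g) := by unfold GridData.scale; fun_prop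

@[fun_prop] lemma _root_.FlowTime.PTime.min_base_pow {f g : γ → ℕ} (hf : PTime f) (hg : PTime g) :
    PTime fun c => min (base m ^ f c) (g c) :=
  PTime.pow_min (base m) (by unfold GridData.base; rcases m.eq_zero_or_pos with rfl | h
                             · simp
                             · exact Nat.pow_pos (by omega)) hf hg

@[fun_prop] lemma _root_.FlowTime.PTime.len (hz : PTime z) (hk : PTime k) :
    PTime fun g => len m (z g) (k g) := by unfold GridData.len; fun_prop

@[fun_prop] lemma _root_.FlowTime.PTime.tailLen (hz : PTime z) (hk : PTime k) :
    PTime fun g => tailLen m (z g) (k g) := by unfold GridData.tailLen; fun_prop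

@[fun_prop] lemma _root_.FlowTime.PTime.cellIdx (hz : PTime z) (hk : PTime k) (hi : PTime i) :
    PTime fun g => cellIdx m (z g) (k g) (i g) := by unfold GridData.cellIdx; fun_prop

@[fun_prop] lemma _root_.FlowTime.PTime.segEnd (hz : PTime z) (hk : PTime k) (hi : PTime i) :
    PTime fun g => segEnd m (z g) (k g) (i g) := by unfold GridData.segEnd; fun_prop

@[fun_prop] lemma _root_.FlowTime.PTime.segBeg (hz : PTime z) (hk : PTime k) (hi : PTime i) :
    PTime fun g => segBeg m (z g) (k g) (i g) := by unfold GridData.segBeg; fun_prop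

@[fun_prop] lemma _root_.FlowTime.PTime.segLen (hz : PTime z) (hk : PTime k) :
    PTime fun g => segLen m (z g) (k g) := by unfold GridData.segLen; fun_prop

@[fun_prop] lemma _root_.FlowTime.PTime.segNum (hz : PTime z) (hk : PTime k) (hi : PTime i) :
    PTime fun g => segNum m (z g) (k g) (i g) := by unfold GridData.segNum; fun_prop

@[fun_prop] lemma _root_.FlowTime.PTime.segCost (hz : PTime z) (hk : PTime k) (hi : PTime i)
    (hj : PTime j) : PTime fun g => segCost m (z g) (k g) (i g) (j g) := by
  unfold GridData.segCost; fun_prop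

@[fun_prop] lemma _root_.FlowTime.PTime.procClasses (hz : PTime z) :
    PTime fun g => procClasses q (z g) := by unfold GridData.procClasses; fun_prop

@[fun_prop] lemma _root_.FlowTime.PTime.weightClasses (hz : PTime z) :
    PTime fun g => weightClasses q (z g) := by unfold GridData.weightClasses; fun_prop

@[fun_prop] lemma _root_.FlowTime.PTime.numKeys (hz : PTime z) :
    PTime fun g => numKeys m q (z g) := by unfold GridData.numKeys; fun_prop

@[fun_prop] lemma _root_.FlowTime.PTime.key (hz : PTime z) (hk : PTime k) (hi : PTime i) :
    PTime fun g => key m q (z g) (k g) (i g) := by unfold GridData.key; fun_prop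

@[fun_prop] lemma _root_.FlowTime.PTime.cellAtTime (hz : PTime z) (hk : PTime k) (ht : PTime t) :
    PTime fun g => cellAtTime m (z g) (k g) (t g) := by unfold GridData.cellAtTime; fun_prop

@[fun_prop] lemma _root_.FlowTime.PTime.selectedAt (hz : PTime z) (hk : PTime k) (hi : PTime i)
    (hj : PTime j) (ht : PTime t) (hs : PTime s) :
    PTime fun g => selectedAt m q (z g) (k g) (i g) (j g) (t g) (s g) := by
  unfold GridData.selectedAt FlowTime.selected FlowTime.laterCost; fun_prop

@[fun_prop] lemma _root_.FlowTime.PTime.enters (hz : PTime z) (hk : PTime k) (ht : PTime t) :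
    PTime fun g => enters m (z g) (k g) (t g) := by unfold GridData.enters; fun_prop

@[fun_prop] lemma _root_.FlowTime.PTime.covers (hz : PTime z) (hk : PTime k) (hi : PTime i)
    (hj : PTime j) (ht : PTime t) :
    PTime fun g => covers m (z g) (k g) (i g) (j g) (t g) := by unfold GridData.covers; fun_prop

@[fun_prop] lemma _root_.FlowTime.PTime.sameSelection (hz : PTime z) (hk : PTime k) (ht : PTime t)
    (hs : PTime s) (hs' : PTime s') :
    PTime fun g => sameSelection m q (z g) (k g) (t g) (s g) (s' g) := by
  unfold GridData.sameSelection; fun_prop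

@[fun_prop] lemma _root_.FlowTime.PTime.capacityAt {b : γ → ℕ} (hz : PTime z) (ht : PTime t)
    (hb : PTime b) (hs : PTime s) :
    PTime fun g => capacityAt m q (z g) (t g) (b g) (s g) := by
  unfold GridData.capacityAt; fun_prop

@[fun_prop] lemma _root_.FlowTime.PTime.stepOk (hz : PTime z) (ht : PTime t)
    (hs : PTime s) (hs' : PTime s') :
    PTime fun g => stepOk m q (z g) (t g) (s g) (s' g) := by
  unfold GridData.stepOk GridData.releasedIn; fun_prop

@[fun_prop] lemma _root_.FlowTime.PTime.stepCost (hz : PTime z) (ht : PTime t) (hs : PTime s) :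
    PTime fun g => stepCost m q (z g) (t g) (s g) := by
  unfold GridData.stepCost GridData.selectionCost; fun_prop

@[fun_prop] lemma _root_.FlowTime.PTime.bestSelections {S : γ → List (List (ℕ × List ℕ))}
    (hz : PTime z) (hS : PTime S) : PTime fun g => bestSelections m q (z g) (S g) := by
  unfold GridData.bestSelections
  apply PTime.shortest <;> fun_prop

lemma _root_.FlowTime.PTime.chosenRects {h : γ → List (List (ℕ × List ℕ))} {φ : γ → ℕ → ℕ → Bool}
    (hz : PTime z) (hh : PTime h) (hφ : PTime fun x : γ × ℕ × ℕ => φ x.1 x.2.1 x.2.2) :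
    PTime fun g => chosenRects m q (z g) (h g) (φ g) := by
  have h1 : PTime fun x : (((γ × ℕ) × ℕ) × ℕ) × ℕ => φ x.1.1.1.1 x.1.1.1.2 x.1.1.2 :=
    hφ.comp (f := fun x : (((γ × ℕ) × ℕ) × ℕ) × ℕ => (x.1.1.1.1, x.1.1.1.2, x.1.1.2))
      (by fun_prop)
  unfold GridData.chosenRects
  fun_prop

lemma _root_.FlowTime.PTime.chosenFamily {h : γ → List (List (ℕ × List ℕ))}
    (hz : PTime z) (hh : PTime h) : PTime fun g => chosenFamily m q (z g) (h g) := by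
  have h1 : PTime fun x : (γ × ℕ) × ℕ => chosenRects m q (z x.1.1) (h x.1.1)
      fun t k => isAncestor m (z x.1.1) k t x.1.2 x.2 := by
    apply PTime.chosenRects (by fun_prop) (by fun_prop)
    unfold GridData.isAncestor
    fun_prop
  unfold GridData.chosenFamily
  fun_prop

end

end GridData

/-! ### Arithmetic of the grid, and keys of jobs -/

namespace GridData

lemma le_base {m : ℕ} (hm : 2 ≤ m) : 16 ≤ base m := by
  calc 16 = 4 ^ 2 := by norm_num
    _ ≤ (2 * m) ^ 2 := Nat.pow_le_pow_left (by omega) 2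
    _ ≤ (2 * m) ^ m := Nat.pow_le_pow_right (by omega) hm

lemma le_base_pow_iff {m : ℕ} {z : GridData} (hm : 2 ≤ m) (hT : 0 < lastTime z) {k : ℕ} :
    lastTime z * base m ^ 2 ≤ base m ^ k ↔ depth m z ≤ k := by
  have h1 := le_base hm
  have h2 : 2 ≤ lastTime z * base m ^ 2 := by nlinarith
  rw [depth, Nat.succ_le_iff, Nat.log_lt_iff_lt_pow (by omega) (by omega)]
  omega

/-- The properties of the input that the analysis depends on. -/
structure Ok (m : ℕ) (z : GridData) : Prop where
  two_le : 2 ≤ m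
  offset_lt : z.2.1 < m
  shift_lt : z.2.2 < base m ^ (depth m z - 1)
  length_pos : 0 < z.1.length
  mono : ∀ i i', i ≤ i' → i' < z.1.length → release z.1 i ≤ release z.1 i'
  one_le_proc : ∀ i < z.1.length, 1 ≤ proc z.1 i
  one_le_weight : ∀ i < z.1.length, 1 ≤ weight z.1 i

namespace Ok
variable {m q : ℕ} {z : GridData} {k i i' j t : ℕ} (h : Ok m z)
include h

lemma base_pow_pos (d : ℕ) : 0 < base m ^ d := Nat.pow_pos (by have := le_base h.two_le; omega)

omit h in
lemma proc_le_totalProc (hi : i < z.1.length) : proc z.1 i ≤ totalProc z.1 := by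
  rw [totalProc, sumTo_eq]
  exact single_le_sum (f := proc z.1) (fun _ _ => Nat.zero_le _) (mem_range.2 hi)

omit h in
lemma weight_le_totalWeight (hi : i < z.1.length) : weight z.1 i ≤ totalWeight z.1 := by
  rw [totalWeight, sumTo_eq]
  exact single_le_sum (f := weight z.1) (fun _ _ => Nat.zero_le _) (mem_range.2 hi)

lemma release_lt (hi : i < z.1.length) : release z.1 i < lastTime z := by
  have h1 := h.mono i (z.1.length - 1) (by omega) (by have := h.length_pos; omega)
  have h2 := proc_le_totalProc h.length_pos
  have h3 := h.one_le_proc 0 h.length_pos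
  unfold lastTime; omega

lemma lastTime_pos : 0 < lastTime z := (Nat.zero_le _).trans_lt (h.release_lt h.length_pos)

lemma two_le_depth : 2 ≤ depth m z := by
  have h1 := (le_base_pow_iff h.two_le h.lastTime_pos).2 le_rfl
  have h2 : base m ^ 2 ≤ base m ^ depth m z :=
    (Nat.le_mul_of_pos_left _ h.lastTime_pos).trans h1
  exact (Nat.pow_le_pow_iff_right (by have := le_base h.two_le; omega)).1 h2

lemma lastTime_le : lastTime z ≤ base m ^ (depth m z - 2) := by
  have h1 := (le_base_pow_iff h.two_le h.lastTime_pos).2 le_rfl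
  have h2 := h.two_le_depth
  rw [← Nat.sub_add_cancel h2, pow_add] at h1
  have := Nat.le_of_mul_le_mul_right h1 (h.base_pow_pos 2)
  simpa using this

/-- The caps `lastTime * base ^ 3` in `len` and `chosenFamily` are there only to keep unary
arithmetic polynomial. By this bound they never take effect. -/
lemma base_pow_depth_le : base m ^ depth m z ≤ lastTime z * base m ^ 3 := by
  have h1 := h.two_le_depth
  have h2 : ¬ lastTime z * base m ^ 2 ≤ base m ^ (depth m z - 1) := fun h' => by
    have := (le_base_pow_iff h.two_le h.lastTime_pos).1 h'; omega
  calc base m ^ depth m z = base m ^ (depth m z - 1) * base m := by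
        rw [← pow_succ, Nat.sub_add_cancel (by omega)]
    _ ≤ lastTime z * base m ^ 2 * base m := Nat.mul_le_mul_right _ (by omega)
    _ = _ := by ring

lemma base_pow_le (hk : k ≤ depth m z) : base m ^ k ≤ lastTime z * base m ^ 3 :=
  (Nat.pow_le_pow_right (by have := le_base h.two_le; omega) hk).trans h.base_pow_depth_le

lemma scale_eq : scale m z = (2 * m) ^ z.2.1 := by
  have := h.offset_lt
  simp [scale, List.getD_eq_getElem?_getD, this]

lemma scale_pos : 0 < scale m z := by
  rw [h.scale_eq]; exact Nat.pow_pos (by have := h.two_le; omega)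

lemma scale_le : scale m z ≤ base m := by
  rw [h.scale_eq]; exact Nat.pow_le_pow_right (by have := h.two_le; omega) h.offset_lt.le

lemma len_eq : len m z k = scale m z * base m ^ (depth m z - k) := by
  rw [len, min_eq_left (h.base_pow_le (by omega))]

lemma len_pos : 0 < len m z k := by
  rw [h.len_eq]; exact Nat.mul_pos h.scale_pos (h.base_pow_pos _)

lemma len_succ (hk : k < depth m z) : len m z k = base m * len m z (k + 1) := by
  rw [h.len_eq, h.len_eq, show depth m z - k = depth m z - (k + 1) + 1 by omega, pow_succ]; ring

lemma len_zero (hk : k ≤ depth m z) : len m z 0 = base m ^ k * len m z k := by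
  rw [h.len_eq, h.len_eq, mul_left_comm, ← pow_add]; congr 2; omega

lemma len_anti (hk : k ≤ i) : len m z i ≤ len m z k := by
  rw [h.len_eq, h.len_eq]
  exact Nat.mul_le_mul_left _ (Nat.pow_le_pow_right (by have := le_base h.two_le; omega) (by omega))

omit h in
lemma tailLen_depth : tailLen m z (depth m z) = 0 := by
  simp [tailLen, sumTo]

omit h in
lemma tailLen_eq (hk : k < depth m z) :
    tailLen m z k = len m z (k + 1) + tailLen m z (k + 1) := by
  simp only [tailLen, sumTo_eq]
  rw [show depth m z - k = depth m z - (k + 1) + 1 by omega, sum_range_succ', add_comm]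
  refine congrArg₂ _ rfl (sum_congr rfl fun d _ => ?_)
  congr 1; omega

/-- A geometric sum with ratio at least 16. -/
lemma tailLen_le (hk : k < depth m z) : tailLen m z k ≤ 2 * len m z (k + 1) := by
  obtain ⟨d, hd⟩ : ∃ d, depth m z = k + 1 + d := ⟨depth m z - (k + 1), by omega⟩
  induction d generalizing k with
  | zero => rw [tailLen_eq hk, ← add_zero (k + 1), ← hd, tailLen_depth]; omega
  | succ d ih =>
    have h1 := ih (k := k + 1) (by omega) (by omega)
    have h2 := h.len_succ (k := k + 1) (by omega)
    have h3 := Nat.mul_le_mul_right (len m z (k + 1 + 1)) (le_base h.two_le)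
    rw [tailLen_eq hk]; omega

omit h in
lemma segBeg_of_lt (hk : k < depth m z) : segBeg m z k i = segEnd m z (k + 1) i := by
  rw [segBeg, if_neg (by omega)]

omit h in
lemma segBeg_depth : segBeg m z (depth m z) i = start z i := by
  rw [segBeg, if_pos rfl]

/-- Justifies the closed form of the recursively defined cells. Passing to the right end of the cell
of level `k + 1` adds one cell length before rounding down, and nested floor divisions combine, so
the added lengths accumulate to `tailLen`. -/
lemma cellIdx_eq (hk : k ≤ depth m z) : cellIdx m z k i = segBeg m z k i / len m z k := by
  rcases hk.eq_or_lt with rfl | hk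
  · rw [segBeg_depth, cellIdx, tailLen_depth, add_zero]
  · rw [segBeg_of_lt hk, segEnd, cellIdx, cellIdx, h.len_succ hk, mul_comm (base m),
      ← Nat.div_div_eq_div_mul, ← Nat.div_div_eq_div_mul, Nat.mul_div_cancel _ h.len_pos,
      tailLen_eq hk, ← Nat.add_div_right _ h.len_pos]
    congr 2; omega

lemma cellIdx_mul_le (hk : k ≤ depth m z) :
    cellIdx m z k i * len m z k ≤ segBeg m z k i := by
  rw [h.cellIdx_eq hk]; exact Nat.div_mul_le_self _ _

lemma segBeg_lt (hk : k ≤ depth m z) : segBeg m z k i < segEnd m z k i := by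
  rw [segEnd, h.cellIdx_eq hk, mul_comm]
  exact Nat.lt_mul_div_succ _ h.len_pos

lemma start_le_segBeg (hk : k ≤ depth m z) : start z i ≤ segBeg m z k i := by
  obtain ⟨d, hd⟩ : ∃ d, depth m z = k + d := ⟨depth m z - k, by omega⟩
  induction d generalizing k with
  | zero => rw [add_zero] at hd; rw [← hd, segBeg_depth]
  | succ d ih =>
    rw [segBeg_of_lt (by omega)]
    exact (ih (by omega) (by omega)).trans (h.segBeg_lt (by omega)).le

lemma segEnd_le_segBeg {l : ℕ} (hkl : k < l) (hl : l ≤ depth m z) :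
    segEnd m z l i ≤ segBeg m z k i := by
  obtain ⟨d, rfl⟩ : ∃ d, l = k + 1 + d := ⟨l - (k + 1), by omega⟩
  induction d with
  | zero => rw [segBeg_of_lt (by omega), add_zero]
  | succ d ih =>
    refine le_trans ?_ (ih (by omega) (by omega))
    exact (segBeg_of_lt (k := k + 1 + d) (by omega)).symm.le.trans (h.segBeg_lt (by omega)).le

omit h in
lemma segBeg_le (hk : k ≤ depth m z) : segBeg m z k i ≤ start z i + tailLen m z k := by
  rcases hk.eq_or_lt with rfl | hk
  · rw [segBeg_depth]; omega
  · rw [segBeg_of_lt hk, segEnd, tailLen_eq hk, add_mul, one_mul, cellIdx]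
    have := Nat.div_mul_le_self (start z i + tailLen m z (k + 1)) (len m z (k + 1))
    omega

lemma segLen_pos : 0 < segLen m z k := by
  unfold segLen; split_ifs
  · exact h.len_pos
  · exact one_pos

lemma segLen_dvd_len : segLen m z k ∣ len m z k := by
  unfold segLen; split_ifs with hk
  · rw [h.len_succ (k := k) (by omega), h.len_succ (k := k + 1) (by omega), ← mul_assoc]
    exact Dvd.intro_left _ rfl
  · exact one_dvd _

lemma segLen_dvd_segBeg : segLen m z k ∣ segBeg m z k i := by
  unfold segLen; split_ifs with hk
  · rw [segBeg_of_lt (by omega), segEnd, h.len_succ (k := k + 1) (by omega), mul_left_comm]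
    exact (Dvd.intro_left _ rfl).mul_left _
  · exact one_dvd _

lemma segBeg_add (hk : k ≤ depth m z) :
    segBeg m z k i + segNum m z k i * segLen m z k = segEnd m z k i := by
  have h1 : segLen m z k ∣ segEnd m z k i - segBeg m z k i :=
    Nat.dvd_sub (h.segLen_dvd_len.mul_left _) h.segLen_dvd_segBeg
  rw [segNum, Nat.div_mul_cancel h1]
  have := h.segBeg_lt hk (i := i); omega

lemma segNum_pos (hk : k ≤ depth m z) : 0 < segNum m z k i := by
  have h1 := h.segBeg_add hk (i := i)
  have h2 := h.segBeg_lt hk (i := i)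
  by_contra h3
  rw [Nat.eq_zero_of_not_pos h3] at h1; omega

/-- Above the two lowest levels this is two subdivisions by `base`. On the lowest two, where
segments have length 1, the cell length is at most `scale * base`. -/
lemma len_le : len m z k ≤ maxSegs m * segLen m z k := by
  unfold maxSegs segLen; split_ifs with hk
  · rw [h.len_succ (k := k) (by omega), h.len_succ (k := k + 1) (by omega)]
    exact le_of_eq (by ring)
  · rw [h.len_eq, mul_one]
    calc scale m z * base m ^ (depth m z - k) ≤ base m * base m ^ 1 :=
          Nat.mul_le_mul h.scale_le (Nat.pow_le_pow_right (by have := le_base h.two_le; omega) (by omega))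
      _ = _ := by ring

lemma segNum_le (hk : k ≤ depth m z) : segNum m z k i ≤ maxSegs m := by
  refine Nat.le_of_mul_le_mul_right (le_trans ?_ (h.len_le (k := k))) (h.segLen_pos (k := k))
  have h1 := h.segBeg_add hk (i := i)
  have h2 := h.cellIdx_mul_le hk (i := i)
  rw [segEnd, add_mul, one_mul] at h1
  omega

/-- Release time, shift and the total of the lower cells amount to at most four cells of level 1,
while the root contains at least 16. So the cells of a job never leave the root. -/
lemma start_add_tailLen_lt (hi : i < z.1.length) : start z i + tailLen m z 0 < len m z 0 := by
  have h1 := h.release_lt hi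
  have h2 := h.lastTime_le
  have h3 := h.shift_lt
  have h4 := h.tailLen_le (k := 0) (by have := h.two_le_depth; omega)
  have h5 := h.len_succ (k := 0) (by have := h.two_le_depth; omega)
  have h6 : base m ^ (depth m z - 2) ≤ base m ^ (depth m z - 1) :=
    Nat.pow_le_pow_right (by have := le_base h.two_le; omega) (by omega)
  have h7 : base m ^ (depth m z - 1) ≤ len m z (0 + 1) := by
    rw [h.len_eq]; exact Nat.le_mul_of_pos_left _ h.scale_pos
  have h8 := Nat.mul_le_mul_right (len m z (0 + 1)) (le_base h.two_le)
  unfold start; omega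

omit h in
lemma tailLen_anti (hk : k ≤ depth m z) : tailLen m z k ≤ tailLen m z 0 := by
  induction k with
  | zero => rfl
  | succ k ih =>
    have := tailLen_eq (m := m) (z := z) (k := k) (by omega)
    exact (by omega : tailLen m z (k + 1) ≤ tailLen m z k).trans (ih (by omega))

lemma cellIdx_lt (hk : k ≤ depth m z) (hi : i < z.1.length) :
    cellIdx m z k i < base m ^ k := by
  rw [cellIdx, Nat.div_lt_iff_lt_mul h.len_pos, ← h.len_zero hk]
  have := tailLen_anti hk
  have := h.start_add_tailLen_lt hi
  omega

lemma segEnd_zero (hi : i < z.1.length) : segEnd m z 0 i = len m z 0 := by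
  have := h.cellIdx_lt (k := 0) (Nat.zero_le _) hi
  rw [pow_zero, Nat.lt_one_iff] at this
  rw [segEnd, this]; omega

lemma time_lt (ht : t ≤ lastTime z) : t + z.2.2 < len m z 0 := by
  have h2 := h.lastTime_le
  have h3 := h.shift_lt
  have h5 := h.len_succ (k := 0) (by have := h.two_le_depth; omega)
  have h6 : base m ^ (depth m z - 2) ≤ base m ^ (depth m z - 1) :=
    Nat.pow_le_pow_right (by have := le_base h.two_le; omega) (by omega)
  have h7 : base m ^ (depth m z - 1) ≤ len m z (0 + 1) := by
    rw [h.len_eq]; exact Nat.le_mul_of_pos_left _ h.scale_pos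
  have h8 := Nat.mul_le_mul_right (len m z (0 + 1)) (le_base h.two_le)
  omega

omit h in
lemma covers_iff : covers m z k i j t = true ↔ segBeg m z k i + j * segLen m z k ≤ t + z.2.2 ∧
    t + z.2.2 < segBeg m z k i + (j + 1) * segLen m z k := by
  simp [covers]

lemma segment_le (hk : k ≤ depth m z) (hj : j < segNum m z k i) :
    segBeg m z k i + (j + 1) * segLen m z k ≤ segEnd m z k i := by
  rw [← h.segBeg_add hk]
  exact Nat.add_le_add_left (Nat.mul_le_mul_right _ hj) _

/-- The segments of a job cover all later times. -/
lemma exists_covers (hi : i < z.1.length) (hit : release z.1 i ≤ t) (ht : t ≤ lastTime z) :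
    ∃ k ≤ depth m z, ∃ j < segNum m z k i, covers m z k i j t = true := by
  have h1 : t + z.2.2 < segEnd m z 0 i := by rw [h.segEnd_zero hi]; exact h.time_lt ht
  -- Otherwise, descending from the root, `t` would lie before the interval of job `i` on every
  -- level, and finally before its release.
  have h2 : ∃ k ≤ depth m z, segBeg m z k i ≤ t + z.2.2 ∧ t + z.2.2 < segEnd m z k i := by
    by_contra hne
    push Not at hne
    have h3 : ∀ k ≤ depth m z, t + z.2.2 < segEnd m z k i := by
      intro k hk
      induction k with
      | zero => exact h1
      | succ k ih =>
        have h4 := ih (by omega)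
        rw [← segBeg_of_lt (by omega)]
        by_contra h5
        have := hne k (by omega) (by omega)
        omega
    have h4 := hne _ le_rfl (by rw [segBeg_depth]; unfold start; omega)
    have := h3 _ le_rfl
    omega
  obtain ⟨k, hk, h3, h4⟩ := h2
  have h5 := Nat.div_mul_le_self (t + z.2.2 - segBeg m z k i) (segLen m z k)
  have h6 := Nat.lt_mul_div_succ (t + z.2.2 - segBeg m z k i) (h.segLen_pos (k := k))
  rw [mul_comm] at h6
  refine ⟨k, hk, (t + z.2.2 - segBeg m z k i) / segLen m z k, ?_, covers_iff.2 ⟨?_, ?_⟩⟩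
  · rw [Nat.div_lt_iff_lt_mul h.segLen_pos]
    have := h.segBeg_add hk (i := i); omega
  · omega
  · omega

/-- The segments of a cell lie inside it. Hence a state at time `t`, which knows only the cells
containing `t`, knows all selected segments that cover `t`. -/
lemma cellAtTime_eq (hk : k ≤ depth m z) (hj : j < segNum m z k i)
    (hc : covers m z k i j t = true) : cellAtTime m z k t = cellIdx m z k i := by
  rw [covers_iff] at hc
  have h1 := h.segment_le hk hj
  have h2 := h.cellIdx_mul_le hk (i := i)
  refine Nat.div_eq_of_lt_le (by omega) ?_
  rw [← segEnd]; omega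

lemma release_le_of_covers (hk : k ≤ depth m z) (hc : covers m z k i j t = true) :
    release z.1 i ≤ t := by
  rw [covers_iff] at hc
  have := h.start_le_segBeg hk (i := i)
  unfold start at this
  omega

lemma cellOffset_lt (hk : k ≤ depth m z) :
    (segBeg m z k i - cellIdx m z k i * len m z k) / segLen m z k < maxSegs m := by
  rw [Nat.div_lt_iff_lt_mul h.segLen_pos]
  refine lt_of_lt_of_le ?_ h.len_le
  have h1 := h.segBeg_lt hk (i := i)
  have h2 := h.len_pos (k := k)
  rw [segEnd, add_mul, one_mul] at h1
  omega

/-- The distance is at most `tailLen k ≤ 2 * len (k + 1)`, which is at most `2 * base` segment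
lengths. -/
lemma startOffset_lt (hk : k ≤ depth m z) :
    (segBeg m z k i - start z i) * q / segLen m z k < relBound m q := by
  rw [relBound, Nat.lt_succ_iff]
  refine Nat.div_le_of_le_mul ?_
  have h1 := segBeg_le hk (i := i)
  suffices hs : segBeg m z k i - start z i ≤ segLen m z k * (2 * base m) by
    calc _ ≤ segLen m z k * (2 * base m) * q := Nat.mul_le_mul_right _ hs
      _ = _ := by ring
  rcases hk.eq_or_lt with rfl | hk
  · rw [segBeg_depth]; simp
  · refine le_trans (le_trans (by omega : _ ≤ tailLen m z k) (h.tailLen_le hk)) ?_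
    unfold segLen; split_ifs with hk2
    · rw [h.len_succ (k := k + 1) (by omega)]; exact le_of_eq (by ring)
    · rw [h.len_eq, show depth m z - (k + 1) = 0 by omega]
      have := h.scale_le
      simpa using this

lemma procClass_lt (hq : 1 ≤ q) (hi : i < z.1.length) :
    sizeClass q (proc z.1 i) < procClasses q z :=
  sizeClass_lt hq (h.one_le_proc i hi) (proc_le_totalProc hi)

lemma weightClass_lt (hq : 1 ≤ q) (hi : i < z.1.length) :
    sizeClass q (weight z.1 i) < weightClasses q z :=
  sizeClass_lt hq (h.one_le_weight i hi) (weight_le_totalWeight hi)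

lemma key_lt (hq : 1 ≤ q) (hk : k ≤ depth m z) (hi : i < z.1.length) :
    key m q z k i < numKeys m q z := by
  have aux : ∀ {a b A B : ℕ}, a < A → b < B → a * B + b < A * B := fun {a b A B} ha hb =>
    calc a * B + b < (a + 1) * B := by rw [add_mul]; omega
      _ ≤ _ := Nat.mul_le_mul_right _ ha
  exact aux (aux (aux (h.cellOffset_lt hk) (h.startOffset_lt hk)) (h.procClass_lt hq hi))
    (h.weightClass_lt hq hi)

/-- The offset of the first segment in its cell is a multiple of the segment length, so its digit
determines it exactly; the distance to the release is known only up to `segLen / q`. -/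
lemma of_key_eq (hq : 1 ≤ q) (hk : k ≤ depth m z) (hi : i < z.1.length) (hi' : i' < z.1.length)
    (hc : cellIdx m z k i = cellIdx m z k i') (hkey : key m q z k i = key m q z k i') :
    segBeg m z k i = segBeg m z k i' ∧
      (segBeg m z k i - start z i) * q / segLen m z k =
        (segBeg m z k i' - start z i') * q / segLen m z k ∧
      sizeClass q (proc z.1 i) = sizeClass q (proc z.1 i') ∧
      sizeClass q (weight z.1 i) = sizeClass q (weight z.1 i') := by
  obtain ⟨h1, h2⟩ := mul_add_inj (h.weightClass_lt hq hi) (h.weightClass_lt hq hi') hkey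
  obtain ⟨h3, h4⟩ := mul_add_inj (h.procClass_lt hq hi) (h.procClass_lt hq hi') h1
  obtain ⟨h5, h6⟩ := mul_add_inj (h.startOffset_lt hk) (h.startOffset_lt hk) h3
  refine ⟨?_, h6, h4, h2⟩
  have h7 : ∀ i, segLen m z k ∣ segBeg m z k i - cellIdx m z k i * len m z k := fun i =>
    Nat.dvd_sub h.segLen_dvd_segBeg (h.segLen_dvd_len.mul_left _)
  have h8 := Nat.div_mul_cancel (h7 i)
  rw [h5, Nat.div_mul_cancel (h7 i'), ← hc] at h8
  have h9 := h.cellIdx_mul_le hk (i := i)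
  have h10 := h.cellIdx_mul_le hk (i := i')
  rw [← hc] at h10
  omega

omit h in
lemma segNum_eq (hc : cellIdx m z k i = cellIdx m z k i')
    (hb : segBeg m z k i = segBeg m z k i') : segNum m z k i = segNum m z k i' := by
  rw [segNum, segNum, segEnd, segEnd, hc, hb]

/-- One factor `1 + 1/q` comes from the weights. The other comes from the first segment, whose cost
involves the distance to the release; the rounding error `segLen / q` is small against the segment
itself. -/
lemma segCost_le (hq : 1 ≤ q) (hk : k ≤ depth m z) (hi : i < z.1.length) (hi' : i' < z.1.length)
    (hc : cellIdx m z k i = cellIdx m z k i') (hkey : key m q z k i = key m q z k i') (j : ℕ) :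
    q ^ 2 * segCost m z k i j ≤ (q + 1) ^ 2 * segCost m z k i' j := by
  obtain ⟨h1, h2, -, h4⟩ := h.of_key_eq hq hk hi hi' hc hkey
  have h5 := sizeClass_ratio hq (h.one_le_weight i hi) (h.one_le_weight i' hi') h4
  have h6 := mul_le_of_div_eq h.segLen_pos h2
  have h7 := h.start_le_segBeg hk (i := i)
  have h8 := h.start_le_segBeg hk (i := i')
  suffices hs : ∀ a b, q * a ≤ (q + 1) * b →
      q ^ 2 * (weight z.1 i * a) ≤ (q + 1) ^ 2 * (weight z.1 i' * b) by
    unfold segCost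
    split_ifs
    · refine hs _ _ ?_
      rw [Nat.sub_add_comm h7, Nat.sub_add_comm h8]
      nlinarith
    · exact hs _ _ (Nat.mul_le_mul_right _ (Nat.le_succ q))
  intro a b hab
  calc q ^ 2 * (weight z.1 i * a) = (q * weight z.1 i) * (q * a) := by ring
    _ ≤ ((q + 1) * weight z.1 i') * ((q + 1) * b) := Nat.mul_le_mul h5 hab
    _ = _ := by ring

lemma sum_segCost_le (hk : k ≤ depth m z) :
    ∑ i ∈ range z.1.length, ∑ j ∈ range (maxSegs m), segCost m z k i j ≤ maxCost m z := by
  have h1 : ∀ i j, segCost m z k i j ≤ weight z.1 i * (3 * len m z 0) := by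
    intro i j
    refine Nat.mul_le_mul_left _ ?_
    have h2 : segLen m z k ≤ len m z 0 :=
      (Nat.le_of_dvd h.len_pos h.segLen_dvd_len).trans (h.len_anti (Nat.zero_le _))
    have h3 := segBeg_le hk (i := i)
    have h4 : tailLen m z k ≤ 2 * len m z 0 := by
      refine (tailLen_anti hk).trans ((h.tailLen_le (by have := h.two_le_depth; omega)).trans ?_)
      exact Nat.mul_le_mul_left _ (h.len_anti (by omega))
    split_ifs <;> omega
  calc _ ≤ ∑ i ∈ range z.1.length, ∑ j ∈ range (maxSegs m), weight z.1 i * (3 * len m z 0) :=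
        sum_le_sum fun i _ => sum_le_sum fun j _ => h1 i j
    _ = _ := by
        simp only [sum_const, card_range, smul_eq_mul]
        rw [← mul_sum, ← sum_mul, maxCost, totalWeight, sumTo_eq]
        ring

end Ok
end GridData

/-! ### Feasible sets versus coded selections over time -/

lemma selected_congr {n : ℕ} {cell key h : ℕ → ℕ} {c : ℕ → ℕ → ℕ} {c₀ R u : ℕ} {b b' : ℕ → ℕ}
    {i j : ℕ} (hb : cell i = c₀ → j < h i → ∀ j' ≤ j, b (key i * R + j') = b' (key i * R + j')) :
    selected n cell key h c c₀ R u b i j = selected n cell key h c c₀ R u b' i j := by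
  rw [Bool.eq_iff_iff, selected_iff, selected_iff]
  refine and_congr_right fun h1 => and_congr_right fun h2 => forall₂_congr fun j' hj' => ?_
  rw [hb h1 h2 j' hj']

namespace GridData

/-- The selection of segments in the cell `c` of level `k` by the budgets that `d` describes. -/
def cellSelected (m q : ℕ) (z : GridData) (k c : ℕ) (d : ℕ × List ℕ) (i j : ℕ) : Bool :=
  selected z.1.length (cellIdx m z k) (key m q z k) (segNum m z k) (segCost m z k) c (maxSegs m)
    d.1 (fun y => (runs d.2).getD y 0) i j

lemma selectedAt_eq (m q : ℕ) (z : GridData) (k i j t : ℕ) (s : List (ℕ × List ℕ)) :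
    selectedAt m q z k i j t s =
      cellSelected m q z k (cellAtTime m z k t) (s.getD k (0, [])) i j := rfl

/-- A feasible set of segments: `Y k i j` says that the `j`-th segment of job `i` on level `k` is
selected. -/
structure IsCover (m : ℕ) (z : GridData) (Y : ℕ → ℕ → ℕ → Prop) [∀ k i j, Decidable (Y k i j)] :
    Prop where
  bounds : ∀ k i j, Y k i j → k ≤ depth m z ∧ i < z.1.length ∧ j < segNum m z k i
  down : ∀ k i j j', Y k i j → j' ≤ j → Y k i j'
  covering : ∀ b t, b ≤ t → t ≤ lastTime z → releasedIn z t b + b ≤ t +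
    ∑ i ∈ range z.1.length, ∑ k ∈ range (depth m z + 1), ∑ j ∈ range (maxSegs m),
      if b ≤ release z.1 i ∧ covers m z k i j t = true ∧ Y k i j then proc z.1 i else 0

/-- The cost of a set of segments. -/
def coverCost (m : ℕ) (z : GridData) (Y : ℕ → ℕ → ℕ → Prop) [∀ k i j, Decidable (Y k i j)] : ℕ :=
  ∑ k ∈ range (depth m z + 1), ∑ i ∈ range z.1.length, ∑ j ∈ range (maxSegs m),
    if Y k i j then segCost m z k i j else 0

lemma enters_iff {m : ℕ} {z : GridData} {k t : ℕ} : enters m z k t = true ↔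
    t = 0 ∨ cellAtTime m z k (t - 1) ≠ cellAtTime m z k t := by
  simp [enters]

/-- The cell index is monotone in time, so a cell is entered only once. -/
lemma enters_unique {m : ℕ} {z : GridData} {k t t' : ℕ} (ht : enters m z k t = true)
    (ht' : enters m z k t' = true) (h : cellAtTime m z k t = cellAtTime m z k t') : t = t' := by
  have hmono : ∀ {t t'}, t ≤ t' → cellAtTime m z k t ≤ cellAtTime m z k t' :=
    fun h => Nat.div_le_div_right (by omega)
  have key : ∀ {t t'}, t < t' → enters m z k t' = true →
      cellAtTime m z k t ≠ cellAtTime m z k t' := by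
    intro t t' hlt hent heq
    rcases enters_iff.1 hent with h0 | h0
    · omega
    · have h1 := hmono (show t ≤ t' - 1 by omega)
      have h2 := hmono (show t' - 1 ≤ t' by omega)
      omega
  rcases lt_trichotomy t t' with hlt | hlt | hlt
  · exact (key hlt ht' h).elim
  · exact hlt
  · exact (key hlt ht h.symm).elim

namespace Ok
variable {m q : ℕ} {z : GridData} (h : Ok m z) {Y : ℕ → ℕ → ℕ → Prop}
  [∀ k i j, Decidable (Y k i j)]
include h

/-- The segments of a cell in a feasible set can be replaced by a selection with a short
description. -/
lemma exists_cellCode (hq : 1 ≤ q) (hY : IsCover m z Y) {k : ℕ} (hk : k ≤ depth m z) (c : ℕ) :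
    ∃ d ∈ cellCodes m q z,
      q ^ 4 * ∑ i ∈ range z.1.length, ∑ j ∈ range (maxSegs m),
          (if cellSelected m q z k c d i j = true then segCost m z k i j else 0) ≤
        (q + 1) ^ 3 * (2 * q + 1) * ∑ i ∈ range z.1.length, ∑ j ∈ range (maxSegs m),
          (if Y k i j ∧ cellIdx m z k i = c then segCost m z k i j else 0) ∧
      ∀ b t j, ∑ i ∈ range z.1.length, (if b ≤ release z.1 i ∧ covers m z k i j t = true ∧
          Y k i j ∧ cellIdx m z k i = c then proc z.1 i else 0) ≤
        ∑ i ∈ range z.1.length, if b ≤ release z.1 i ∧ covers m z k i j t = true ∧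
          cellSelected m q z k c d i j = true then proc z.1 i else 0 := by
  classical
  have hR : 1 ≤ maxSegs m := h.base_pow_pos 2
  have hL : 1 ≤ numKeys m q z := (Nat.zero_le _).trans_lt (h.key_lt hq hk h.length_pos)
  have hY' : ∀ i j, (Y k i j ∧ cellIdx m z k i = c) →
      i < z.1.length ∧ cellIdx m z k i = c ∧ j < segNum m z k i := fun i j hij =>
    ⟨(hY.bounds _ _ _ hij.1).2.1, hij.2, (hY.bounds _ _ _ hij.1).2.2⟩
  -- The values of `D` and `N` are the two factors `1 + 1/q` of `segCost_le`; the budgets add a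
  -- third.
  obtain ⟨u, b, hu, hb, hcost, hcover⟩ := exists_budgets (n := z.1.length)
    (cell := cellIdx m z k) (key := key m q z k) (h := segNum m z k) (p := proc z.1)
    (c := segCost m z k) (c₀ := c) (R := maxSegs m) (L := numKeys m q z) (q := q)
    (Y := fun i j => Y k i j ∧ cellIdx m z k i = c) (D := q ^ 2) (N := (q + 1) ^ 2)
    (M := maxCost m z) hq hL hR h.one_le_proc hY'
    (fun i j j' hij hj => ⟨hY.down _ _ _ _ hij.1 hj, hij.2⟩)
    (fun i hi i' hi' h1 h2 h3 => segNum_eq (h1.trans h2.symm)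
      (h.of_key_eq hq hk hi hi' (h1.trans h2.symm) h3).1)
    (fun i _ _ => h.segNum_le hk) (fun i hi _ => h.key_lt hq hk hi)
    (fun i hi i' hi' h1 h2 h3 => sizeClass_ratio hq (h.one_le_proc i hi) (h.one_le_proc i' hi')
      (h.of_key_eq hq hk hi hi' (h1.trans h2.symm) h3).2.2.1)
    (fun i hi i' hi' h1 h2 h3 j => h.segCost_le hq hk hi hi' (h1.trans h2.symm) h3 j)
    (h.sum_segCost_le hk)
  obtain ⟨l, hl, hlb⟩ := exists_bits b _ _ hb
  have hsel : ∀ i < z.1.length, ∀ j, cellSelected m q z k c (u, l) i j =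
      selected z.1.length (cellIdx m z k) (key m q z k) (segNum m z k) (segCost m z k) c
        (maxSegs m) u b i j := by
    intro i hi j
    refine selected_congr fun _ h2 j' hj' => hlb _ ?_
    have h3 := h.segNum_le hk (i := i)
    calc key m q z k i * maxSegs m + j' < (key m q z k i + 1) * maxSegs m := by
          rw [add_mul, one_mul]; omega
      _ ≤ _ := Nat.mul_le_mul_right _ (h.key_lt hq hk hi)
  refine ⟨(u, l), ?_, ?_, fun b' t j => ?_⟩
  · simp only [cellCodes, List.mem_flatMap, List.mem_map, List.mem_range]
    exact ⟨u, by omega, l, hl, rfl⟩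
  · have h1 : ∑ i ∈ range z.1.length, ∑ j ∈ range (maxSegs m),
        (if cellSelected m q z k c (u, l) i j = true then segCost m z k i j else 0) =
        ∑ i ∈ range z.1.length, ∑ j ∈ range (maxSegs m), (if selected z.1.length (cellIdx m z k)
          (key m q z k) (segNum m z k) (segCost m z k) c (maxSegs m) u b i j = true
          then segCost m z k i j else 0) :=
      sum_congr rfl fun i hi => sum_congr rfl fun j _ => by rw [hsel i (mem_range.1 hi) j]
    rw [h1]
    refine le_trans (le_of_eq (by ring)) (hcost.trans (le_of_eq ?_))
    rw [show (q + 1) * ((2 * q + 1) * (q + 1) ^ 2) = (q + 1) ^ 3 * (2 * q + 1) by ring]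
    congr!
  -- Being released from `b'` on passes to later jobs because the jobs are sorted, and covering `t`
  -- depends only on the cell and the key.
  · have h1 := hcover (fun i => b' ≤ release z.1 i) (fun i => covers m z k i j t = true)
      (fun i i' hi hi' h1 => h1.trans (h.mono i i' hi hi'))
      (fun i hi i' hi' h1 h2 h3 h4 => by
        rw [covers_iff] at h4 ⊢
        rwa [← (h.of_key_eq hq hk hi hi' (h1.trans h2.symm) h3).1]) j
    rw [← sum_filter, ← sum_filter]
    refine le_trans (le_of_eq ?_) (h1.trans (le_of_eq ?_))
    · congr!
    · refine sum_congr ?_ fun _ _ => rfl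
      ext i
      simp only [mem_filter, mem_range]
      exact and_congr_right fun hi => by rw [hsel i hi]

/-- Feasible sets can be replaced by selections with short descriptions. -/
theorem exists_selections (hq : 1 ≤ q) (hY : IsCover m z Y) :
    ∃ f : ℕ → List (ℕ × List ℕ), (∀ t, f t ∈ states m q z) ∧
      (∀ t ≤ lastTime z, stepOk m q z t (prev [] f t) (f t) = true) ∧
      q ^ 4 * ∑ t ∈ range (lastTime z + 1), stepCost m q z t (f t) ≤
        (q + 1) ^ 3 * (2 * q + 1) * coverCost m z Y := by
  -- The code is chosen per cell, not per time, so it cannot change while the cell stays the same.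
  have hex : ∀ k c, ∃ d, k ≤ depth m z → _ := fun k c => by
    by_cases hk : k ≤ depth m z
    · obtain ⟨d, hd⟩ := h.exists_cellCode hq hY hk c
      exact ⟨d, fun _ => hd⟩
    · exact ⟨(0, []), fun h => (hk h).elim⟩
  choose d hd using hex
  set f : ℕ → List (ℕ × List ℕ) := fun t =>
    (List.range (depth m z + 1)).map fun k => d k (cellAtTime m z k t) with hf
  have hfk : ∀ t, ∀ k ≤ depth m z, (f t).getD k (0, []) = d k (cellAtTime m z k t) := by
    intro t k hk
    simp [hf, List.getD_eq_getElem?_getD, Nat.lt_succ_iff.2 hk]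
  refine ⟨f, fun t => ?_, fun t ht => ?_, ?_⟩
  · refine (mem_lists _ _ _).2 ⟨by simp [hf], fun a ha => ?_⟩
    simp only [hf, List.mem_map, List.mem_range] at ha
    obtain ⟨k, hk, rfl⟩ := ha
    exact (hd k _ (by omega)).1
  · rw [stepOk, Bool.and_eq_true, allTo_iff, allTo_iff]
    constructor
    · intro k hk
      rw [Bool.or_eq_true]
      by_cases he : enters m z k t = true
      · exact .inl he
      · right
        rw [enters_iff] at he
        push Not at he
        obtain ⟨t, rfl⟩ := Nat.exists_eq_succ_of_ne_zero he.1
        have h1 : ∀ i j, selectedAt m q z k i j (t + 1) (prev [] f (t + 1)) =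
            selectedAt m q z k i j (t + 1) (f (t + 1)) := by
          intro i j
          rw [selectedAt_eq, selectedAt_eq, prev, hfk t k (by omega), hfk (t + 1) k (by omega)]
          have := he.2
          rw [Nat.succ_eq_add_one, Nat.add_sub_cancel] at this
          rw [this]
        simp only [sameSelection, allTo_iff, Nat.succ_eq_add_one, h1]
        intro i _ j _
        cases selectedAt m q z k i j (t + 1) (f (t + 1)) <;> rfl
    · intro b hb
      rw [decide_eq_true_eq]
      refine (hY.covering b t (by omega) ht).trans (Nat.add_le_add_left ?_ _)
      simp only [capacityAt, sumTo_eq]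
      rw [sum_comm, sum_comm (s := range z.1.length)]
      refine sum_le_sum fun k hk => ?_
      have hk : k ≤ depth m z := by rw [mem_range] at hk; omega
      rw [sum_comm, sum_comm (s := range z.1.length)]
      refine sum_le_sum fun j _ => ?_
      simp only [selectedAt_eq, hfk t k hk]
      refine le_trans (sum_le_sum fun i _ => ?_) ((hd k (cellAtTime m z k t) hk).2.2 b t j)
      split_ifs with h1 h2 <;> try omega
      exact (h2 ⟨h1.1, h1.2.1, h1.2.2,
        (h.cellAtTime_eq hk (hY.bounds _ _ _ h1.2.2).2.2 h1.2.1).symm⟩).elim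
  · simp only [stepCost, sumTo_eq, coverCost]
    rw [sum_comm, mul_sum, mul_sum]
    refine sum_le_sum fun k hk => ?_
    have hk : k ≤ depth m z := by rw [mem_range] at hk; omega
    have h1 : ∀ t, q ^ 4 * (if enters m z k t = true then selectionCost m q z k t (f t) else 0) ≤
        (q + 1) ^ 3 * (2 * q + 1) * ∑ i ∈ range z.1.length, ∑ j ∈ range (maxSegs m),
          (if Y k i j ∧ enters m z k t = true ∧ cellIdx m z k i = cellAtTime m z k t
            then segCost m z k i j else 0) := by
      intro t
      split_ifs with he
      · have := (hd k (cellAtTime m z k t) hk).2.1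
        simpa only [selectionCost, sumTo_eq, selectedAt_eq, hfk t k hk, he, true_and] using this
      · simp
    rw [mul_sum]
    refine (sum_le_sum fun t _ => h1 t).trans ?_
    rw [← mul_sum]
    refine Nat.mul_le_mul_left _ ?_
    rw [sum_comm]
    refine sum_le_sum fun i _ => ?_
    rw [sum_comm]
    refine sum_le_sum fun j _ => ?_
    -- A segment is charged only at the entry of its own cell, hence at most once.
    split_ifs with hyij
    · simp only [hyij, true_and]
      rw [← sum_filter]
      refine (sum_le_card_nsmul _ _ _ fun _ _ => le_rfl).trans ?_
      rw [smul_eq_mul]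
      refine (Nat.mul_le_mul_right _ (card_le_one.2 ?_)).trans (by rw [one_mul])
      intro a ha b hb
      rw [mem_filter] at ha hb
      exact enters_unique ha.2.1 hb.2.1 (ha.2.2.symm.trans hb.2.2)
    · simp [hyij]

omit h [∀ k i j, Decidable (Y k i j)] in
/-- The segments that are selected in some cell form a feasible set. -/
theorem isCover_selections {f : ℕ → List (ℕ × List ℕ)}
    (hf : ∀ t ≤ lastTime z, stepOk m q z t (prev [] f t) (f t) = true)
    [∀ k i j, Decidable (Y k i j)] (hY : ∀ k i j, Y k i j ↔ (k ≤ depth m z ∧ i < z.1.length ∧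
      j < maxSegs m ∧ ∃ t ≤ lastTime z, selectedAt m q z k i j t (f t) = true)) :
    IsCover m z Y ∧ coverCost m z Y ≤ ∑ t ∈ range (lastTime z + 1), stepCost m q z t (f t) := by
  -- A selected segment is already selected when its cell is entered: go back in time as long as the
  -- cell does not change. So its cost has been charged.
  have hent : ∀ k ≤ depth m z, ∀ i < z.1.length, ∀ j < maxSegs m, ∀ t ≤ lastTime z,
      selectedAt m q z k i j t (f t) = true →
      ∃ t' ≤ lastTime z, enters m z k t' = true ∧ selectedAt m q z k i j t' (f t') = true := by
    intro k hk i hi j hj t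
    induction t with
    | zero => exact fun h0 hs => ⟨0, h0, enters_iff.2 (.inl rfl), hs⟩
    | succ t ih =>
      intro ht hs
      by_cases he : enters m z k (t + 1) = true
      · exact ⟨_, ht, he, hs⟩
      · refine ih (by omega) ?_
        have h1 := hf _ ht
        rw [stepOk, Bool.and_eq_true, allTo_iff] at h1
        have h2 := h1.1 k (by omega)
        rw [Bool.or_eq_true] at h2
        have h3 := h2.resolve_left he
        simp only [sameSelection, allTo_iff] at h3
        have h4 := h3 i hi j hj
        rw [hs] at h4
        rw [enters_iff] at he
        push Not at he
        have h5 : selectedAt m q z k i j (t + 1) (f t) = true := by simpa [prev] using h4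
        rw [selectedAt_eq] at h5 ⊢
        rwa [← he.2, Nat.add_sub_cancel] at h5
  refine ⟨⟨?_, ?_, ?_⟩, ?_⟩
  · intro k i j hij
    obtain ⟨h1, h2, h3, t, ht, h4⟩ := (hY k i j).1 hij
    exact ⟨h1, h2, (selected_iff.1 h4).2.1⟩
  · intro k i j j' hij hj
    obtain ⟨h1, h2, h3, t, ht, h4⟩ := (hY k i j).1 hij
    refine (hY k i j').2 ⟨h1, h2, by omega, t, ht, ?_⟩
    obtain ⟨h5, h6, h7⟩ := selected_iff.1 h4
    exact selected_iff.2 ⟨h5, by omega, fun j'' hj'' => h7 j'' (by omega)⟩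
  · intro b t hb ht
    have h1 := hf _ ht
    rw [stepOk, Bool.and_eq_true, allTo_iff, allTo_iff] at h1
    have h2 := of_decide_eq_true (h1.2 b (by omega))
    refine h2.trans (Nat.add_le_add_left ?_ _)
    simp only [capacityAt, sumTo_eq]
    refine sum_le_sum fun i hi => sum_le_sum fun k hk => sum_le_sum fun j hj => ?_
    rw [mem_range] at hi hk hj
    split_ifs with h3 h4 <;> try omega
    exact (h4 ⟨h3.1, h3.2.1, (hY k i j).2 ⟨by omega, hi, hj, t, ht, h3.2.2⟩⟩).elim
  · simp only [stepCost, sumTo_eq, coverCost]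
    rw [sum_comm (s := range (lastTime z + 1))]
    refine sum_le_sum fun k hk => ?_
    have h1 : ∀ t, (if enters m z k t = true then selectionCost m q z k t (f t) else 0) =
        ∑ i ∈ range z.1.length, ∑ j ∈ range (maxSegs m),
          if enters m z k t = true ∧ selectedAt m q z k i j t (f t) = true
          then segCost m z k i j else 0 := by
      intro t
      split_ifs with he <;> simp [selectionCost, sumTo_eq, he]
    simp only [h1]
    rw [sum_comm (s := range (lastTime z + 1))]
    refine sum_le_sum fun i hi => ?_
    rw [sum_comm (s := range (lastTime z + 1))]
    refine sum_le_sum fun j hj => ?_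
    rw [mem_range] at hk hi hj
    split_ifs with hij
    · obtain ⟨-, -, -, t, ht, h2⟩ := (hY k i j).1 hij
      obtain ⟨t', ht', h3, h4⟩ := hent k (by omega) i hi j hj t ht h2
      have h5 := single_le_sum (f := fun t => if enters m z k t = true ∧
        selectedAt m q z k i j t (f t) = true then segCost m z k i j else 0)
        (fun _ _ => Nat.zero_le _) (mem_range.2 (Nat.lt_succ_of_le ht'))
      simpa only [h3, h4, and_self, if_true] using h5
    · exact Nat.zero_le _

end Ok
end GridData

/-- The input of the algorithms. -/
def GridInstance.data (G : GridInstance) : GridData := (G.jobs, G.a, G.x)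

lemma GridInstance.code_data (G : GridInstance) : code G.data = G.encodeInput := by
  rw [encodeInput, ← JobInstance.code_jobs]; rfl

/-! ### Rectangles as indexed segments -/

namespace GridData

lemma lastTime_data {G : GridInstance} (hn : 0 < G.n) (hr : Monotone G.r) :
    lastTime G.data = G.T := by
  have h1 : release G.jobs (G.n - 1) = univ.sup G.r := by
    have h2 := JobInstance.release_jobs G.toJobInstance ⟨G.n - 1, by omega⟩
    rw [h2]
    refine le_antisymm (le_sup (f := G.r) (mem_univ _)) (Finset.sup_le fun j _ => hr ?_)
    rw [Fin.le_def]; have := j.2; simp only; omega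
  rw [lastTime, JobInstance.T, GridInstance.data, JobInstance.length_jobs, h1,
    JobInstance.totalProc_jobs]

lemma lmax_eq {G : GridInstance} (hm : 2 ≤ G.m) (hT : lastTime G.data = G.T)
    (hpos : 0 < lastTime G.data) : G.lmax = depth G.m G.data := by
  have h1 : {k | G.T * G.K ^ 2 ≤ G.K ^ k} = Set.Ici (depth G.m G.data) := by
    ext k
    rw [Set.mem_Ici, ← le_base_pow_iff hm hpos, hT]
    rfl
  rw [GridInstance.lmax, h1, csInf_Ici]

lemma ok_data {G : GridInstance} {A : ℕ} (hv : G.Valid) (hn : G.Normalized A) :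
    Ok G.m G.data := by
  obtain ⟨j₀, -⟩ := hn.exists_p_eq_one
  have hn0 : 0 < G.n := j₀.pos
  have hT := lastTime_data hn0 hv.mono
  have hpos : 0 < lastTime G.data := by
    have := hn.one_le_p j₀
    have h2 := single_le_sum (f := G.p) (fun _ _ => Nat.zero_le _) (mem_univ j₀)
    rw [hT, JobInstance.T]; omega
  refine ⟨hv.two_le_m, hv.a_lt, ?_, by simpa [GridInstance.data] using hn0, ?_, ?_, ?_⟩
  · rw [← lmax_eq hv.two_le_m hT hpos]; exact hv.x_lt
  · intro i i' hi hi'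
    simp only [GridInstance.data, JobInstance.length_jobs] at hi' ⊢
    have h1 := hv.mono (a := ⟨i, by omega⟩) (b := ⟨i', hi'⟩) hi
    rwa [← JobInstance.release_jobs, ← JobInstance.release_jobs] at h1
  · intro i hi
    simp only [GridInstance.data, JobInstance.length_jobs] at hi ⊢
    have h1 := hn.one_le_p ⟨i, hi⟩
    rwa [← JobInstance.proc_jobs] at h1
  · intro i hi
    simp only [GridInstance.data, JobInstance.length_jobs] at hi ⊢
    have h1 := hn.one_le_w ⟨i, hi⟩
    rwa [← JobInstance.weight_jobs] at h1

/-- The `j`-th rectangle of job `i` on level `k`. -/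
def rect (G : GridInstance) (i : Fin G.n) (k j : ℕ) : Rect G.n where
  job := i
  beg := (segBeg G.m G.data k i + j * segLen G.m G.data k : ℕ) - (G.x : ℤ)
  fin := (segBeg G.m G.data k i + (j + 1) * segLen G.m G.data k : ℕ) - (G.x : ℤ)

section
variable {G : GridInstance}

@[simp] lemma length_data : G.data.1.length = G.n := JobInstance.length_jobs _

@[simp] lemma shift_data : G.data.2.2 = G.x := rfl

@[simp] lemma release_data (i : Fin G.n) : release G.data.1 i = G.r i :=
  JobInstance.release_jobs _ i

@[simp] lemma proc_data (i : Fin G.n) : proc G.data.1 i = G.p i := JobInstance.proc_jobs _ i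

@[simp] lemma weight_data (i : Fin G.n) : weight G.data.1 i = G.w i := JobInstance.weight_jobs _ i

end

namespace Ok
variable {G : GridInstance} (h : Ok G.m G.data)
include h

lemma lastTime_eq : lastTime G.data = G.T := by
  have hn : 0 < G.n := by simpa using h.length_pos
  refine lastTime_data hn fun i i' hi => ?_
  have := h.mono i i' hi (by simp)
  simpa using this

lemma lmax_eq : G.lmax = depth G.m G.data := GridData.lmax_eq h.two_le h.lastTime_eq h.lastTime_pos

lemma cellLen_eq (k : ℕ) : G.cellLen k = (len G.m G.data k : ℤ) := by
  rw [GridInstance.cellLen, h.lmax_eq, h.len_eq, h.scale_eq]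
  rfl

lemma cellEnd_eq (k c : ℕ) :
    G.cellEnd ⟨k, c⟩ = (((c + 1) * len G.m G.data k : ℕ) : ℤ) - G.x := by
  rw [GridInstance.cellEnd, GridInstance.cellBeg, h.cellLen_eq, GridInstance.offX]
  push_cast; ring

lemma cellBeg_eq (k c : ℕ) :
    G.cellBeg ⟨k, c⟩ = ((c * len G.m G.data k : ℕ) : ℤ) - G.x := by
  rw [GridInstance.cellBeg, h.cellLen_eq, GridInstance.offX]
  push_cast; ring

lemma cellAt_eq (k y : ℕ) : G.cellAt k ((y : ℤ) - G.x) = ⟨k, y / len G.m G.data k⟩ := by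
  rw [GridInstance.cellAt, h.cellLen_eq, GridInstance.offX]
  simp only [sub_neg_eq_add, sub_add_cancel, Cell.mk.injEq, true_and]
  rw [← Int.natCast_div, Int.toNat_natCast]

lemma chain_eq (i : Fin G.n) {d : ℕ} (hd : d ≤ depth G.m G.data) :
    G.chain i d = ⟨depth G.m G.data - d, cellIdx G.m G.data (depth G.m G.data - d) i⟩ := by
  induction d with
  | zero =>
    rw [GridInstance.chain, h.lmax_eq, Nat.sub_zero, h.cellIdx_eq le_rfl, segBeg_depth, ← h.cellAt_eq,
      start, release_data, shift_data]
    congr 1; push_cast; ring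
  | succ d ih =>
    rw [GridInstance.chain, h.lmax_eq, ih (by omega), h.cellEnd_eq, h.cellAt_eq,
      h.cellIdx_eq (k := depth G.m G.data - (d + 1)) (by omega),
      segBeg_of_lt (k := depth G.m G.data - (d + 1)) (by omega),
      show depth G.m G.data - (d + 1) + 1 = depth G.m G.data - d by omega]
    rfl

lemma jobCell_eq (i : Fin G.n) {k : ℕ} (hk : k ≤ depth G.m G.data) :
    G.jobCell i k = ⟨k, cellIdx G.m G.data k i⟩ := by
  rw [GridInstance.jobCell, h.lmax_eq, h.chain_eq i (by omega)]
  rw [show depth G.m G.data - (depth G.m G.data - k) = k by omega]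

lemma segStart_eq (i : Fin G.n) {k : ℕ} (hk : k ≤ depth G.m G.data) :
    G.segStart i k = (segBeg G.m G.data k i : ℤ) - G.x := by
  rw [GridInstance.segStart, h.lmax_eq]
  split_ifs with hk'
  · rw [hk', segBeg_depth, start, release_data, shift_data]; push_cast; ring
  · rw [h.jobCell_eq i (by omega), h.cellEnd_eq, segBeg_of_lt (by omega), segEnd]

lemma segLen_eq (k : ℕ) : G.segLen k = (segLen G.m G.data k : ℤ) := by
  rw [GridInstance.segLen, h.lmax_eq, segLen, h.cellLen_eq]
  split_ifs <;> simp

lemma mem_jobCellRects {i : Fin G.n} {C : Cell} (hC : C.level ≤ depth G.m G.data) {R : Rect G.n} :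
    R ∈ G.jobCellRects i C ↔ C.idx = cellIdx G.m G.data C.level i ∧
      ∃ j < segNum G.m G.data C.level i, R = rect G i C.level j := by
  rw [GridInstance.jobCellRects, h.jobCell_eq i hC, h.segStart_eq i hC, h.segLen_eq]
  have h1 : C = ⟨C.level, cellIdx G.m G.data C.level i⟩ ↔ C.idx = cellIdx G.m G.data C.level i := by
    rw [Cell.ext_iff]; simp
  by_cases hc : C.idx = cellIdx G.m G.data C.level i
  · rw [if_pos (h1.2 hc)]
    have h2 : ((G.cellEnd C - ((segBeg G.m G.data C.level i : ℤ) - G.x)) /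
        (segLen G.m G.data C.level : ℤ)).toNat = segNum G.m G.data C.level i := by
      rw [h1.2 hc, h.cellEnd_eq, segNum, ← segEnd, sub_sub_sub_cancel_right,
        ← Nat.cast_sub (h.segBeg_lt hC).le, ← Int.natCast_div, Int.toNat_natCast]
    rw [h2]
    simp only [mem_image, mem_range, hc, true_and]
    refine exists_congr fun j => and_congr_right fun _ => ?_
    rw [eq_comm, Rect.ext_iff, Rect.ext_iff]
    simp only [rect]
    push_cast
    rw [sub_add_eq_add_sub, sub_add_eq_add_sub]
  · rw [if_neg (fun h' => hc (h1.1 h'))]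
    simp [hc]

lemma mem_cells {C : Cell} :
    C ∈ G.cells ↔ C.level ≤ depth G.m G.data ∧ C.idx < base G.m ^ C.level := by
  simp only [GridInstance.cells, mem_biUnion, mem_range, mem_image, h.lmax_eq]
  constructor
  · rintro ⟨l, hl, i, hi, rfl⟩
    exact ⟨by simp only; omega, hi⟩
  · rintro ⟨h1, h2⟩
    exact ⟨C.level, by omega, C.idx, h2, rfl⟩

lemma jobCell_mem {i : Fin G.n} {k : ℕ} (hk : k ≤ depth G.m G.data) :
    (⟨k, cellIdx G.m G.data k i⟩ : Cell) ∈ G.cells :=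
  h.mem_cells.2 ⟨hk, h.cellIdx_lt hk (by simp)⟩

lemma mem_rects {R : Rect G.n} : R ∈ G.rects ↔ ∃ (i : Fin G.n) (k j : ℕ),
    k ≤ depth G.m G.data ∧ j < segNum G.m G.data k i ∧ R = rect G i k j := by
  simp only [GridInstance.rects, GridInstance.cellRects, mem_biUnion, mem_univ, true_and]
  constructor
  · rintro ⟨C, hC, i, hR⟩
    obtain ⟨-, j, hj, rfl⟩ := (h.mem_jobCellRects (h.mem_cells.1 hC).1).1 hR
    exact ⟨i, C.level, j, (h.mem_cells.1 hC).1, hj, rfl⟩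
  · rintro ⟨i, k, j, hk, hj, rfl⟩
    exact ⟨_, h.jobCell_mem hk, i, (h.mem_jobCellRects hk).2 ⟨rfl, j, hj, rfl⟩⟩

/-- The segments of a job on a finer level end before those on a coarser level begin, so the left
end of a rectangle determines level and index. -/
lemma rect_inj {i i' : Fin G.n} {k k' j j' : ℕ} (hk : k ≤ depth G.m G.data)
    (hk' : k' ≤ depth G.m G.data) (hj : j < segNum G.m G.data k i)
    (hj' : j' < segNum G.m G.data k' i') (heq : rect G i k j = rect G i' k' j') :
    i = i' ∧ k = k' ∧ j = j' := by
  obtain ⟨h1, h2, -⟩ := (Rect.ext_iff ..).1 heq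
  simp only [rect] at h1 h2
  subst h1
  have h3 : segBeg G.m G.data k i + j * segLen G.m G.data k =
      segBeg G.m G.data k' i + j' * segLen G.m G.data k' := by omega
  have aux : ∀ {k k' j j' : ℕ}, k < k' → k' ≤ depth G.m G.data → j' < segNum G.m G.data k' i →
      segBeg G.m G.data k i + j * segLen G.m G.data k ≠
      segBeg G.m G.data k' i + j' * segLen G.m G.data k' := by
    intro k k' j j' hkk hk' hj' h3
    have h4 := h.segment_le hk' hj'
    have h5 := h.segEnd_le_segBeg hkk hk' (i := i)
    have h6 := h.segLen_pos (k := k')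
    rw [add_mul, one_mul] at h4
    have := Nat.zero_le (j * segLen G.m G.data k)
    omega
  rcases lt_trichotomy k k' with hlt | rfl | hlt
  · exact (aux hlt hk' hj' h3).elim
  · exact ⟨rfl, rfl, Nat.eq_of_mul_eq_mul_right (h.segLen_pos (k := k)) (by omega)⟩
  · exact (aux hlt hk hj h3.symm).elim

/-- By `rect_inj` only the cell of level `k` can witness `IsFirst`. -/
lemma isFirst_rect {i : Fin G.n} {k j : ℕ} (hk : k ≤ depth G.m G.data)
    (hj : j < segNum G.m G.data k i) : G.IsFirst (rect G i k j) ↔ j = 0 := by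
  constructor
  · rintro ⟨C, hC, hR, hmin⟩
    have hl := (h.mem_cells.1 hC).1
    obtain ⟨h1, j', hj', h2⟩ := (h.mem_jobCellRects hl).1 hR
    obtain ⟨-, rfl, rfl⟩ := h.rect_inj hk hl hj hj' h2
    have h3 := hmin _ ((h.mem_jobCellRects hl).2 ⟨h1, 0, h.segNum_pos hl, rfl⟩)
    simp only [rect] at h3
    by_contra h0
    have := Nat.mul_pos (Nat.pos_of_ne_zero h0) (h.segLen_pos (k := C.level))
    omega
  · rintro rfl
    refine ⟨_, h.jobCell_mem hk, (h.mem_jobCellRects hk).2 ⟨rfl, 0, hj, rfl⟩, fun R' hR' => ?_⟩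
    obtain ⟨-, j', -, rfl⟩ := (h.mem_jobCellRects hk).1 hR'
    simp only [rect]
    push_cast
    nlinarith [Nat.zero_le (j' * segLen G.m G.data k)]

lemma rectCost_rect {i : Fin G.n} {k j : ℕ} (hk : k ≤ depth G.m G.data)
    (hj : j < segNum G.m G.data k i) :
    G.rectCost (rect G i k j) = (segCost G.m G.data k i j : ℤ) := by
  have h1 := h.start_le_segBeg hk (i := i)
  rw [GridInstance.rectCost, segCost, weight_data]
  by_cases h0 : j = 0
  · rw [if_pos ((h.isFirst_rect hk hj).2 h0), if_pos h0]
    subst h0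
    simp only [start, release_data, shift_data] at h1 ⊢
    simp only [rect]
    rw [Nat.cast_mul, Nat.cast_sub (by omega)]
    push_cast; ring
  · rw [if_neg (fun h' => h0 ((h.isFirst_rect hk hj).1 h')), if_neg h0]
    simp only [rect]
    push_cast; ring

/-- Sums over sets of rectangles. -/
lemma sum_rects {X : Finset (Rect G.n)} (hX : X ⊆ G.rects) (g : Rect G.n → ℤ) :
    ∑ R ∈ X, g R = ∑ i : Fin G.n, ∑ k ∈ range (depth G.m G.data + 1),
      ∑ j ∈ range (maxSegs G.m), if j < segNum G.m G.data k i ∧ rect G i k j ∈ X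
        then g (rect G i k j) else 0 := by
  rw [← sum_product', ← sum_product', ← sum_filter]
  symm
  refine sum_bij (fun x _ => rect G x.1.1 x.1.2 x.2) ?_ ?_ ?_ ?_
  · intro x hx
    exact (mem_filter.1 hx).2.2
  · rintro ⟨⟨i, k⟩, j⟩ hx ⟨⟨i', k'⟩, j'⟩ hx' heq
    simp only [mem_filter, mem_product, mem_univ, mem_range, true_and] at hx hx'
    obtain ⟨rfl, rfl, rfl⟩ := h.rect_inj (by omega) (by omega) hx.2.1 hx'.2.1 heq
    rfl
  · intro R hR
    obtain ⟨i, k, j, hk, hj, rfl⟩ := h.mem_rects.1 (hX hR)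
    refine ⟨((i, k), j), ?_, rfl⟩
    simp only [mem_filter, mem_product, mem_univ, mem_range, true_and]
    exact ⟨⟨by omega, hj.trans_le (h.segNum_le hk)⟩, hj, hR⟩
  · intro x hx; rfl

end Ok
end GridData

/-! ### Feasibility, cost and optimum in terms of segments -/

namespace GridData

/-- The set of rectangles `X` consists of the rectangles of the segments in `Y`. -/
structure Represents (G : GridInstance) (Y : ℕ → ℕ → ℕ → Prop) (X : Finset (Rect G.n)) : Prop where
  subset : X ⊆ G.rects
  bounds : ∀ k i j, Y k i j → k ≤ depth G.m G.data ∧ i < G.n ∧ j < segNum G.m G.data k i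
  iff : ∀ (i : Fin G.n) (k j : ℕ), k ≤ depth G.m G.data → j < segNum G.m G.data k i →
    (Y k i j ↔ rect G i k j ∈ X)

lemma exists_represents {G : GridInstance} {X : Finset (Rect G.n)} (hX : X ⊆ G.rects) :
    ∃ Y, Represents G Y X :=
  ⟨fun k i j => ∃ hi : i < G.n, k ≤ depth G.m G.data ∧ j < segNum G.m G.data k i ∧
    rect G ⟨i, hi⟩ k j ∈ X, hX, fun _ _ _ ⟨h1, h2, h3, _⟩ => ⟨h2, h1, h3⟩,
    fun i _ _ h1 h2 => ⟨fun ⟨_, _, _, h⟩ => h, fun h => ⟨i.2, h1, h2, h⟩⟩⟩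

lemma demand_eq (G : GridInstance) (b t : ℕ) :
    G.demand b t = (releasedIn G.data t b + b : ℕ) - (t : ℤ) := by
  rw [GridInstance.demand, releasedIn, sumTo_eq, length_data, sum_range, sum_filter]
  push_cast
  simp only [release_data, proc_data]
  ring

namespace Ok
variable {G : GridInstance} (h : Ok G.m G.data) {Y : ℕ → ℕ → ℕ → Prop}
  [∀ k i j, Decidable (Y k i j)] {X : Finset (Rect G.n)}
include h

lemma cost_eq (hXY : Represents G Y X) : G.cost X = (coverCost G.m G.data Y : ℤ) := by
  rw [GridInstance.cost, h.sum_rects hXY.subset, coverCost]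
  push_cast
  rw [sum_comm]
  refine sum_congr rfl fun k hk => ?_
  have hk : k ≤ depth G.m G.data := by rw [mem_range] at hk; omega
  rw [length_data, sum_range]
  refine sum_congr rfl fun i _ => sum_congr rfl fun j _ => ?_
  by_cases hj : j < segNum G.m G.data k i
  · simp only [hj, true_and, hXY.iff i k j hk hj]
    rw [h.rectCost_rect hk hj]
  · rw [if_neg (fun h' => hj h'.1), if_neg (fun h' => hj (hXY.bounds k i j h').2.2)]

/-- The condition that a job is released by time `t` disappears, since a segment that covers `t`
lies to the right of the release time. -/
lemma cap_eq (hXY : Represents G Y X) (b t : ℕ) :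
    G.cap (X.filter fun R => (b ≤ G.r R.job ∧ G.r R.job ≤ t) ∧ (R.beg ≤ t ∧ (t : ℤ) < R.fin)) =
      (∑ i ∈ range G.data.1.length, ∑ k ∈ range (depth G.m G.data + 1), ∑ j ∈ range (maxSegs G.m),
        if b ≤ release G.data.1 i ∧ covers G.m G.data k i j t = true ∧ Y k i j
        then proc G.data.1 i else 0 : ℕ) := by
  rw [GridInstance.cap, h.sum_rects ((filter_subset _ _).trans hXY.subset)]
  push_cast
  rw [length_data, sum_range]
  refine sum_congr rfl fun i _ => sum_congr rfl fun k hk => sum_congr rfl fun j _ => ?_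
  have hk : k ≤ depth G.m G.data := by rw [mem_range] at hk; omega
  rw [proc_data, release_data]
  refine if_congr ?_ rfl rfl
  have h1 : ((rect G i k j).beg ≤ t ∧ (t : ℤ) < (rect G i k j).fin) ↔
      covers G.m G.data k i j t = true := by
    rw [covers_iff, shift_data]
    simp only [rect]
    omega
  have h2 := fun hc => h.release_le_of_covers hk hc (i := i) (j := j) (t := t)
  rw [release_data] at h2
  have h3 : (rect G i k j).job = i := rfl
  rw [mem_filter, h1, h3]
  constructor
  · rintro ⟨h4, h5, h6, h7⟩
    exact ⟨h6.1, h7, (hXY.iff i k j hk h4).2 h5⟩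
  · rintro ⟨h4, h5, h6⟩
    have h7 := (hXY.bounds k i j h6).2.2
    exact ⟨h7, (hXY.iff i k j hk h7).1 h6, ⟨h4, h2 h5⟩, h5⟩

lemma feasible_iff (hXY : Represents G Y X) : G.Feasible X ↔ IsCover G.m G.data Y := by
  constructor
  · intro hX
    refine ⟨fun k i j hij => ?_, ?_, ?_⟩
    · rw [length_data]; exact hXY.bounds k i j hij
    · intro k i j j' hij hj
      obtain ⟨hk, hi, hjs⟩ := hXY.bounds k i j hij
      rcases hj.eq_or_lt with rfl | hj
      · exact hij
      have h1 := (hXY.iff ⟨i, hi⟩ k j hk hjs).1 hij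
      refine (hXY.iff ⟨i, hi⟩ k j' hk (hj.trans hjs)).2 ?_
      refine hX.selectPrefix ⟨i, hi⟩ _ (h.jobCell_mem hk) _
        ((h.mem_jobCellRects hk).2 ⟨rfl, j', hj.trans hjs, rfl⟩) _
        ((h.mem_jobCellRects hk).2 ⟨rfl, j, hjs, rfl⟩) ?_ h1
      have h2 := Nat.mul_lt_mul_of_pos_right (show j' + 1 < j + 1 by omega) (h.segLen_pos (k := k))
      simp only [rect]; omega
    · intro b t hb ht
      have h1 := hX.covering b t hb (by rwa [← h.lastTime_eq])
      rw [h.cap_eq hXY, demand_eq] at h1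
      omega
  · intro hY
    refine ⟨hXY.subset, fun b t hb ht => ?_, ?_⟩
    · have h1 := hY.covering b t hb (by rwa [h.lastTime_eq])
      rw [h.cap_eq hXY, demand_eq]
      omega
    · intro i C hC R hR R' hR' hlt hX
      have hl := (h.mem_cells.1 hC).1
      obtain ⟨-, j, hj, rfl⟩ := (h.mem_jobCellRects hl).1 hR
      obtain ⟨-, j', hj', rfl⟩ := (h.mem_jobCellRects hl).1 hR'
      refine (hXY.iff i _ j hl hj).1 (hY.down _ _ _ _ ((hXY.iff i _ j' hl hj').2 hX) ?_)
      by_contra hjj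
      have h2 := Nat.mul_le_mul_right (segLen G.m G.data C.level) (show j' + 1 ≤ j + 1 by omega)
      simp only [rect] at hlt
      omega

/-- Every job released by time `t` has a segment containing `t`, so the whole released volume is
available as capacity. -/
lemma feasible_rects : G.Feasible G.rects := by
  classical
  obtain ⟨Y, hY⟩ := exists_represents (Subset.refl G.rects)
  refine (h.feasible_iff hY).2 ⟨fun k i j hij => ?_, ?_, ?_⟩
  · rw [length_data]; exact hY.bounds k i j hij
  · intro k i j j' hij hj
    obtain ⟨hk, hi, hjs⟩ := hY.bounds k i j hij
    exact (hY.iff ⟨i, hi⟩ k j' hk (hj.trans_lt hjs)).2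
      (h.mem_rects.2 ⟨⟨i, hi⟩, k, j', hk, hj.trans_lt hjs, rfl⟩)
  · intro b t hb ht
    rw [releasedIn, sumTo_eq, add_comm]
    refine Nat.add_le_add hb (sum_le_sum fun i hi => ?_)
    rw [mem_range] at hi
    split_ifs with hr
    · obtain ⟨k, hk, j, hj, hc⟩ := h.exists_covers hi hr.2 ht
      have h1 : Y k i j := by
        rw [length_data] at hi
        exact (hY.iff ⟨i, hi⟩ k j hk hj).2 (h.mem_rects.2 ⟨⟨i, hi⟩, k, j, hk, hj, rfl⟩)
      set F : ℕ → ℕ → ℕ := fun k j => if b ≤ release G.data.1 i ∧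
        covers G.m G.data k i j t = true ∧ Y k i j then proc G.data.1 i else 0 with hF
      calc proc G.data.1 i = F k j := by simp only [hF]; rw [if_pos ⟨hr.1, hc, h1⟩]
        _ ≤ ∑ j ∈ range (maxSegs G.m), F k j := single_le_sum (f := F k)
            (fun _ _ => Nat.zero_le _) (mem_range.2 (hj.trans_le (h.segNum_le hk)))
        _ ≤ ∑ k ∈ range (depth G.m G.data + 1), ∑ j ∈ range (maxSegs G.m), F k j :=
            single_le_sum (f := fun k => ∑ j ∈ range (maxSegs G.m), F k j)
              (fun _ _ => Nat.zero_le _) (mem_range.2 (Nat.lt_succ_of_le hk))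
    · exact Nat.zero_le _

/-- A nonempty set of nonnegative integers attains its infimum; in particular `opt` is not a default
value. -/
lemma exists_cost_eq_opt : ∃ X, G.Feasible X ∧ G.opt = G.cost X := by
  classical
  refine Int.csInf_mem (s := {v | ∃ X, G.Feasible X ∧ v = G.cost X})
    ⟨_, _, h.feasible_rects, rfl⟩ ⟨0, ?_⟩
  rintro _ ⟨X, hX, rfl⟩
  obtain ⟨Y, hY⟩ := exists_represents hX.subset
  rw [h.cost_eq hY]
  exact Int.natCast_nonneg _

end Ok

/-- The rectangle with the given list of coordinates. -/
def toRect {n : ℕ} (hn : 0 < n) (x : List ℕ) : Rect n :=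
  ⟨⟨x.getD 0 0 % n, Nat.mod_lt _ hn⟩, x.getD 1 0, x.getD 2 0⟩

/-- The selected segments. -/
def Chosen (G : GridInstance) (f : ℕ → List (ℕ × List ℕ)) (q : ℕ) (k i j : ℕ) : Prop :=
  k ≤ depth G.m G.data ∧ i < G.data.1.length ∧ j < maxSegs G.m ∧
    ∃ t ≤ lastTime G.data, selectedAt G.m q G.data k i j t (f t) = true

namespace Ok
variable {G : GridInstance} (h : Ok G.m G.data) {q : ℕ}
include h

/-- The truncated subtraction of the shift is harmless: segments do not begin before the shifted
release time. -/
lemma toRect_eq (i : Fin G.n) {k : ℕ} (hk : k ≤ depth G.m G.data) (j : ℕ) :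
    toRect i.pos [(i : ℕ), segBeg G.m G.data k i + j * segLen G.m G.data k - G.data.2.2,
      segBeg G.m G.data k i + (j + 1) * segLen G.m G.data k - G.data.2.2] = rect G i k j := by
  have h1 := h.start_le_segBeg hk (i := i)
  rw [start, shift_data] at h1
  have h2 : (i : ℕ) % G.n = i := Nat.mod_eq_of_lt i.2
  rw [shift_data, Rect.ext_iff]
  simp only [toRect, rect, List.getD_cons_zero, List.getD_cons_succ, h2, true_and]
  omega

lemma chosenRects_eq (S : List (List (ℕ × List ℕ))) (φ : ℕ → ℕ → Bool)
    {f : ℕ → List (ℕ × List ℕ)} (hf : ∀ t ≤ lastTime G.data, f t = S.getD (lastTime G.data - t) []) :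
    ∃ l : List (Rect G.n), Rect.encodeList l = code (chosenRects G.m q G.data S φ) ∧
      ∀ R, R ∈ l ↔ ∃ t ≤ lastTime G.data, ∃ k ≤ depth G.m G.data, ∃ (i : Fin G.n) (j : ℕ),
        j < maxSegs G.m ∧ φ t k = true ∧ selectedAt G.m q G.data k i j t (f t) = true ∧
        R = rect G i k j := by
  have hn : 0 < G.n := by simpa using h.length_pos
  have hmem : ∀ x, x ∈ chosenRects G.m q G.data S φ ↔ ∃ t ≤ lastTime G.data,
      ∃ k ≤ depth G.m G.data, ∃ (i : Fin G.n) (j : ℕ),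
        j < maxSegs G.m ∧ φ t k = true ∧ selectedAt G.m q G.data k i j t (f t) = true ∧
        x = [(i : ℕ), segBeg G.m G.data k i + j * segLen G.m G.data k - G.data.2.2,
          segBeg G.m G.data k i + (j + 1) * segLen G.m G.data k - G.data.2.2] := by
    intro x
    simp only [chosenRects, List.mem_flatMap, List.mem_map, List.mem_filter, List.mem_range,
      Nat.lt_succ_iff, Bool.and_eq_true, length_data]
    constructor
    · rintro ⟨t, ht, k, hk, i, hi, j, ⟨hj, h1, h2⟩, rfl⟩
      rw [← hf t ht] at h2
      exact ⟨t, ht, k, hk, ⟨i, hi⟩, j, hj, h1, h2, rfl⟩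
    · rintro ⟨t, ht, k, hk, i, j, hj, h1, h2, rfl⟩
      rw [hf t ht] at h2
      exact ⟨t, ht, k, hk, i, i.2, j, ⟨hj, h1, h2⟩, rfl⟩
  refine ⟨(chosenRects G.m q G.data S φ).map (toRect hn), ?_, fun R => ?_⟩
  · rw [Rect.encodeList, List.map_map]
    refine congrArg Data.ofList (List.map_congr_left fun x hx => ?_)
    obtain ⟨t, ht, k, hk, i, j, -, -, -, rfl⟩ := (hmem x).1 hx
    have h2 : (i : ℕ) % G.n = i := Nat.mod_eq_of_lt i.2
    simp only [Function.comp_apply, Rect.encode, toRect, List.getD_cons_zero, List.getD_cons_succ,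
      h2, Int.toNat_natCast]
    rfl
  · simp only [List.mem_map, hmem]
    constructor
    · rintro ⟨x, ⟨t, ht, k, hk, i, j, hj, h1, h2, rfl⟩, rfl⟩
      exact ⟨t, ht, k, hk, i, j, hj, h1, h2, h.toRect_eq i hk j⟩
    · rintro ⟨t, ht, k, hk, i, j, hj, h1, h2, rfl⟩
      exact ⟨_, ⟨t, ht, k, hk, i, j, hj, h1, h2, rfl⟩, h.toRect_eq i hk j⟩

omit h in
lemma lt_segNum_of_selectedAt {k i j t : ℕ} {s : List (ℕ × List ℕ)}
    (hs : selectedAt G.m q G.data k i j t s = true) :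
    cellIdx G.m G.data k i = cellAtTime G.m G.data k t ∧ j < segNum G.m G.data k i :=
  ⟨(selected_iff.1 hs).1, (selected_iff.1 hs).2.1⟩

/-- The best selections form a feasible set of almost twice the optimal cost. -/
theorem exists_bestSelections (hq : 1 ≤ q) :
    ∃ f : ℕ → List (ℕ × List ℕ), (∀ t ≤ lastTime G.data,
        f t = (bestSelections G.m q G.data (states G.m q G.data)).getD (lastTime G.data - t) []) ∧
      ∀ X : Finset (Rect G.n), (∀ R, R ∈ X ↔ ∃ t ≤ lastTime G.data, ∃ k ≤ depth G.m G.data,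
          ∃ (i : Fin G.n) (j : ℕ), j < maxSegs G.m ∧
            selectedAt G.m q G.data k i j t (f t) = true ∧ R = rect G i k j) →
        G.Feasible X ∧ (q : ℤ) ^ 4 * G.cost X ≤ ((q : ℤ) + 1) ^ 3 * (2 * q + 1) * G.opt := by
  classical
  -- An optimal set, replaced by coded selections, is an admissible path; the computed path costs no
  -- more.
  obtain ⟨X₀, hX₀, hopt⟩ := h.exists_cost_eq_opt
  obtain ⟨Y₀, hY₀⟩ := exists_represents hX₀.subset
  obtain ⟨f₀, hf₀, hok₀, hcost₀⟩ := h.exists_selections hq ((h.feasible_iff hY₀).1 hX₀)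
  obtain ⟨f, hf, hok, -, hcost⟩ := shortest_spec []
    (ok := fun t s s' => stepOk G.m q G.data t s s') (c := fun t _ s => stepCost G.m q G.data t s)
    (S := states G.m q G.data) (N := lastTime G.data) (final := fun _ => true) (f := f₀)
    (fun t ht => ⟨hf₀ t, hok₀ t ht⟩) rfl
  refine ⟨f, hf, fun X hX => ?_⟩
  obtain ⟨hcov, hle⟩ := isCover_selections (m := G.m) (z := G.data) (q := q)
    (Y := Chosen G f q) (fun t ht => (hok t ht).2) (fun _ _ _ => Iff.rfl)
  have hrep : Represents G (Chosen G f q) X := by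
    refine ⟨fun R hR => ?_, fun k i j hij => ?_, fun i k j hk hj => ?_⟩
    · obtain ⟨t, ht, k, hk, i, j, hj, hs, rfl⟩ := (hX R).1 hR
      exact h.mem_rects.2 ⟨i, k, j, hk, (lt_segNum_of_selectedAt hs).2, rfl⟩
    · obtain ⟨h1, h2, h3, t, ht, hs⟩ := hij
      rw [length_data] at h2
      exact ⟨h1, h2, (lt_segNum_of_selectedAt hs).2⟩
    · rw [hX]
      constructor
      · rintro ⟨h1, h2, h3, t, ht, hs⟩
        exact ⟨t, ht, k, hk, i, j, h3, hs, rfl⟩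
      · rintro ⟨t, ht, k', hk', i', j', hj', hs, heq⟩
        obtain ⟨rfl, rfl, rfl⟩ := h.rect_inj hk hk' hj (lt_segNum_of_selectedAt hs).2 heq
        exact ⟨hk, by simp, hj', t, ht, hs⟩
  refine ⟨(h.feasible_iff hrep).2 hcov, ?_⟩
  rw [hopt, h.cost_eq hrep, h.cost_eq hY₀]
  have := (Nat.mul_le_mul_left (q ^ 4) (hle.trans hcost)).trans hcost₀
  exact_mod_cast this

end Ok
end GridData

namespace GridData

/-! ### Running times -/

/-- A bound for the number of states of the dynamic program and the size of its input. -/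
def stateBound (m q : ℕ) (z : GridData) : ℕ :=
  sz z + 2 ^ codeLength m q z + ((maxCost m z + 2) * 2 ^ codeLength m q z) ^ (depth m z + 1)

lemma length_cellCodes (m q : ℕ) (z : GridData) :
    (cellCodes m q z).length = (maxCost m z + 2) * 2 ^ codeLength m q z := by
  simp [cellCodes, List.length_flatMap, length_lists]

/-- Only the two enumerations by `lists` are superpolynomial in the input, and `stateBound` contains
the number of words and the number of states. -/
lemma timeIn_bestSelections (m q : ℕ) :
    TimeIn (stateBound m q) fun z => bestSelections m q z (states m q z) := by
  have hsz : PolyBounded (stateBound m q) sz := PolyBounded.self.mono fun z =>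
    (Nat.le_add_right _ _).trans (Nat.le_add_right _ _)
  have hp : PolyBounded (stateBound m q) fun z => 2 ^ codeLength m q z :=
    PolyBounded.self.mono fun z => (Nat.le_add_left _ _).trans (Nat.le_add_right _ _)
  have hp' : PolyBounded (stateBound m q) fun z => (cellCodes m q z).length ^ (depth m z + 1) :=
    PolyBounded.self.mono fun z => by
      rw [length_cellCodes]; exact Nat.le_add_left _ _
  have h1 : PTime fun z : GridData => (([0, 1] : List ℕ), codeLength m q z) := by
    unfold codeLength; fun_prop
  have h2 : TimeIn (stateBound m q) fun z => lists [0, 1] (codeLength m q z) := by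
    refine TimeIn.comp' (g := fun x : List ℕ × ℕ => lists x.1 x.2)
      (f := fun z => ([0, 1], codeLength m q z)) TimeIn.lists (h1.timeIn hsz) ?_
    exact (h1.polyBounded_sz.comp (φ := id) hsz).add hp
  have h3 : TimeIn (stateBound m q) fun z => (cellCodes m q z, depth m z + 1) := by
    have h4 : PTime fun x : GridData × List (List ℕ) =>
        (((List.range (maxCost m x.1 + 2)).flatMap fun u => x.2.map fun l => (u, l)),
          depth m x.1 + 1) := by
      unfold maxCost; fun_prop
    exact TimeIn.comp (g := fun x : GridData × List (List ℕ) =>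
        (((List.range (maxCost m x.1 + 2)).flatMap fun u => x.2.map fun l => (u, l)),
          depth m x.1 + 1)) (f := fun z => (z, lists [0, 1] (codeLength m q z))) h4 ((PTime.timeIn PTime.id' hsz).pair h2)
  have h5 : TimeIn (stateBound m q) fun z => states m q z := by
    refine TimeIn.comp' (g := fun x : List (ℕ × List ℕ) × ℕ => lists x.1 x.2)
      (f := fun z => (cellCodes m q z, depth m z + 1)) TimeIn.lists h3 ?_
    exact h3.polyBounded_sz.add hp'
  have h6 : PTime fun x : GridData × List (List (ℕ × List ℕ)) => bestSelections m q x.1 x.2 := by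
    fun_prop
  exact TimeIn.comp (g := fun x : GridData × List (List (ℕ × List ℕ)) =>
    bestSelections m q x.1 x.2) (f := fun z => (z, states m q z)) h6
    ((PTime.timeIn PTime.id' hsz).pair h5)

lemma timeIn_chosenRects (m q : ℕ) : TimeIn (stateBound m q) fun z =>
    chosenRects m q z (bestSelections m q z (states m q z)) fun _ _ => true := by
  have hsz : PolyBounded (stateBound m q) sz := PolyBounded.self.mono fun z =>
    (Nat.le_add_right _ _).trans (Nat.le_add_right _ _)
  have h6 : PTime fun x : GridData × List (List (ℕ × List ℕ)) =>
      chosenRects m q x.1 x.2 fun _ _ => true :=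
    PTime.chosenRects (by fun_prop) (by fun_prop) (by fun_prop)
  exact TimeIn.comp (g := fun x : GridData × List (List (ℕ × List ℕ)) =>
    chosenRects m q x.1 x.2 fun _ _ => true) (f := fun z => (z, bestSelections m q z (states m q z))) h6
    ((PTime.timeIn PTime.id' hsz).pair (timeIn_bestSelections m q))

lemma timeIn_chosenFamily (m q : ℕ) : TimeIn (stateBound m q) fun z =>
    chosenFamily m q z (bestSelections m q z (states m q z)) := by
  have hsz : PolyBounded (stateBound m q) sz := PolyBounded.self.mono fun z =>
    (Nat.le_add_right _ _).trans (Nat.le_add_right _ _)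
  have h6 : PTime fun x : GridData × List (List (ℕ × List ℕ)) => chosenFamily m q x.1 x.2 :=
    PTime.chosenFamily (by fun_prop) (by fun_prop)
  exact TimeIn.comp (g := fun x : GridData × List (List (ℕ × List ℕ)) =>
    chosenFamily m q x.1 x.2) (f := fun z => (z, bestSelections m q z (states m q z))) h6
    ((PTime.timeIn PTime.id' hsz).pair (timeIn_bestSelections m q))

end GridData

/-- The inputs that the theorem is about. -/
abbrev ValidInput (m A : ℕ) : Type :=
  {G : GridInstance // G.m = m ∧ G.Valid ∧ G.Normalized A ∧ 2 ≤ G.n * G.P}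

/-! ### Quasi-polynomial bounds for the covering problem -/

namespace ValidInput
open GridData
variable {m A : ℕ}

def toNormalized (G : ValidInput m A) : NormalizedInstance A :=
  ⟨G.1.toJobInstance, G.2.2.2.1, G.2.2.2.2⟩

def logSize (G : ValidInput m A) : ℕ := G.toNormalized.logSize

lemma one_le_logSize (G : ValidInput m A) : 1 ≤ G.logSize := G.toNormalized.one_le_logSize

lemma ok (G : ValidInput m A) : Ok m G.1.data := by
  have := ok_data G.2.2.1 G.2.2.2.1
  rwa [G.2.1] at this

lemma expBounded_const (k c : ℕ) : ExpBounded (logSize (m := m) (A := A)) k fun _ => c :=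
  .const one_le_logSize c k

lemma expBounded_comp {k : ℕ} {g : NormalizedInstance A → ℕ}
    (hg : ExpBounded NormalizedInstance.logSize k g) :
    ExpBounded (logSize (m := m) (A := A)) k fun G => g G.toNormalized :=
  hg.imp fun _ hD G => hD G.toNormalized

lemma expBounded_lastTime : ExpBounded (logSize (m := m) (A := A)) 1 fun G => lastTime G.1.data := by
  have h := expBounded_comp (m := m) (NormalizedInstance.expBounded_size (A := A))
  refine (h.add one_le_logSize h).mono fun G => ?_
  have h1 := G.ok.lastTime_pos
  have hG : Ok G.1.m G.1.data := by rw [G.2.1]; exact G.ok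
  rw [hG.lastTime_eq, JobInstance.T]
  exact Nat.add_le_add (Finset.sup_le fun j _ => G.toNormalized.r_le j) G.toNormalized.sum_p_le

lemma expBounded_base_pow_depth :
    ExpBounded (logSize (m := m) (A := A)) 1 fun G => base m ^ depth m G.1.data :=
  (expBounded_lastTime.mul (expBounded_const 1 (base m ^ 3))).mono fun G => G.ok.base_pow_depth_le

lemma logBounded_depth : LogBounded (logSize (m := m) (A := A)) 1 fun G => depth m G.1.data := by
  refine expBounded_base_pow_depth.log.mono fun G => ?_
  refine (Nat.le_log_iff_pow_le (by norm_num) (G.ok.base_pow_pos _).ne').2 ?_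
  exact Nat.pow_le_pow_left (by have := le_base G.ok.two_le; omega) _

lemma expBounded_maxCost :
    ExpBounded (logSize (m := m) (A := A)) 1 fun G => maxCost m G.1.data := by
  refine ((expBounded_comp NormalizedInstance.expBounded_totalWeight).mul
    (expBounded_const 1 (maxSegs m))).mul ((expBounded_const 1 3).mul ?_)
  refine ((expBounded_const 1 (base m)).mul expBounded_base_pow_depth).mono fun G => ?_
  rw [G.ok.len_eq, Nat.sub_zero]
  exact Nat.mul_le_mul_right _ G.ok.scale_le

/-- Apart from constants, the number of keys is a product of two logarithms, for processing times
and weights. -/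
lemma logBounded_codeLength (q : ℕ) :
    LogBounded (logSize (m := m) (A := A)) 2 fun G => codeLength m q G.1.data := by
  have h0 : ∀ k c, LogBounded (logSize (m := m) (A := A)) k fun _ => c :=
    fun k c => (LogBounded.const c).of_le one_le_logSize (Nat.zero_le _)
  have h1 : LogBounded (logSize (m := m) (A := A)) 2 fun G =>
      numKeys m q G.1.data * maxSegs m := by
    have hV := (expBounded_comp (m := m) (NormalizedInstance.expBounded_totalProc (A := A))).log
    have hW := (expBounded_comp (m := m) (NormalizedInstance.expBounded_totalWeight (A := A))).log
    have := (((((h0 0 (maxSegs m)).mul (h0 0 (relBound m q))).mul ((h0 0 q).mul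
      (hV.add (h0 1 1)))).mul ((h0 0 q).mul (hW.add (h0 1 1))))).mul (h0 0 (maxSegs m))
    exact this
  have := ((h0 0 (q + 1)).mul h1)
  exact (this.of_le one_le_logSize (by norm_num)).add h1

lemma expBounded_sz :
    ExpBounded (logSize (m := m) (A := A)) 1 fun G => sz G.1.data := by
  have h1 := expBounded_comp (m := m) (NormalizedInstance.expBounded_sz_jobs (A := A))
  have h2 := expBounded_const (m := m) (A := A) 1
  refine (((h1.add one_le_logSize ((h2 2).mul expBounded_base_pow_depth))).add one_le_logSize
    (h2 (2 * m + 10))).mono fun G => ?_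
  have h3 := G.ok.shift_lt
  have h4 : base m ^ (depth m G.1.data - 1) ≤ base m ^ depth m G.1.data :=
    Nat.pow_le_pow_right (by have := le_base G.ok.two_le; omega) (by omega)
  have h5 := G.ok.offset_lt
  change sz (G.1.jobs, G.1.a, G.1.x) ≤ sz G.1.jobs + _ + _
  simp only [GridInstance.data] at h3 h5 ⊢
  simp only [sz_pair, sz_nat, GridInstance.data] at h4 ⊢
  omega

/-- There are `2^O(l²)` codes per cell and `O(l)` levels. -/
lemma expBounded_stateBound (q : ℕ) :
    ExpBounded (logSize (m := m) (A := A)) 3 fun G => stateBound m q G.1.data := by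
  have h1 : ExpBounded (logSize (m := m) (A := A)) 2 fun G => 2 ^ codeLength m q G.1.data := by
    have := (expBounded_const (m := m) (A := A) 0 2).pow (logBounded_codeLength q)
    simpa using this
  have h2 := (((expBounded_maxCost (m := m) (A := A)).add one_le_logSize
    (expBounded_const 1 2)).of_le one_le_logSize (by norm_num : 1 ≤ 2)).mul h1
  have h3 := logBounded_depth (m := m) (A := A)
  have h4 := h2.pow (h3.add ((LogBounded.const 1).of_le one_le_logSize (by norm_num)))
  exact ((expBounded_sz.of_le one_le_logSize (by norm_num)).add one_le_logSize
    (h1.of_le one_le_logSize (by norm_num))).add one_le_logSize h4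

lemma exists_le_quasiPoly {g : ValidInput m A → ℕ} (hg : ExpBounded logSize 3 g) :
    ∃ c : ℝ, ∀ G, (g G : ℝ) ≤ G.1.quasiPoly c := by
  obtain ⟨D, hD⟩ := hg
  obtain ⟨c, -, hc⟩ := NormalizedInstance.exists_le_quasiPoly (A := A)
    (g := fun J => 2 ^ (D * J.logSize ^ 3)) ⟨D, fun _ => le_rfl⟩
  exact ⟨c, fun G => le_trans (by exact_mod_cast hD G) (hc G.toNormalized)⟩

/-- Functions that are computable in time polynomial in the number of states have quasi-polynomial
running time. -/
lemma exists_program {β : Type} [Coded β] {q : ℕ} {F : GridData → β}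
    (hF : TimeIn (stateBound m q) F) : ∃ (prog : Program) (c : ℝ), ∀ G : ValidInput m A,
      prog.OutputsWithin G.1.encodeInput (code (F G.1.data)) (G.1.quasiPoly c) ∧
        1 ≤ G.1.quasiPoly c := by
  obtain ⟨prog, d, hprog⟩ := hF.exists_program
  have h1 : ExpBounded (logSize (m := m) (A := A)) 3 fun G =>
      (stateBound m q G.1.data + 2) ^ d :=
    ((expBounded_stateBound q).add one_le_logSize (expBounded_const 3 2)).pow (.const d)
  obtain ⟨c, hc⟩ := exists_le_quasiPoly h1
  refine ⟨prog, c, fun G => ⟨?_, ?_⟩⟩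
  · obtain ⟨k, s, h2, h3, h4⟩ := hprog G.1.data
    rw [GridInstance.code_data] at h2
    exact ⟨k, s, h2, h3, h4.trans (hc G)⟩
  · refine le_trans ?_ (hc G)
    exact_mod_cast Nat.one_le_pow _ _ (by omega)

end ValidInput

/-! ### The algorithms for the covering problem -/

/-- Expanding, `(q + 1)³(2q + 1) = 2q⁴ + 7q³ + 9q² + 5q + 1 ≤ 2q⁴ + 22q³`; the sum `7 + 9 + 5 + 1 =
22` explains the choice of `q`. -/
lemma cost_le_of_mul_le {m q : ℕ} (hm : 1 ≤ m) (hq : q = 22 * m) {a b : ℤ} (hb : 0 ≤ b)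
    (h : (q : ℤ) ^ 4 * a ≤ ((q : ℤ) + 1) ^ 3 * (2 * q + 1) * b) :
    (a : ℝ) ≤ (2 + 1 / (m : ℝ)) * b := by
  have hm' : (1 : ℝ) ≤ m := by exact_mod_cast hm
  have hq' : (q : ℝ) = 22 * m := by rw [hq]; push_cast; ring
  have hb' : (0 : ℝ) ≤ b := by exact_mod_cast hb
  have h1 : (q : ℝ) ^ 4 * a ≤ ((q : ℝ) + 1) ^ 3 * (2 * q + 1) * b := by exact_mod_cast h
  have hq0 : (22 : ℝ) ≤ q := by rw [hq']; linarith
  have h2 : ((q : ℝ) + 1) ^ 3 * (2 * q + 1) ≤ q ^ 4 * (2 + 1 / m) := by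
    have h3 : (1 : ℝ) / m = 22 / q := by rw [hq']; field_simp
    have h4 : (q : ℝ) ^ 4 * (2 + 22 / q) = 2 * q ^ 4 + 22 * q ^ 3 := by field_simp
    rw [h3, h4]
    have h5 : (1 : ℝ) ≤ q := by linarith
    nlinarith [pow_le_pow_right₀ h5 (show 2 ≤ 3 by norm_num),
      pow_le_pow_right₀ h5 (show 1 ≤ 3 by norm_num), pow_le_pow_right₀ h5 (show 0 ≤ 3 by norm_num)]
  refine le_of_mul_le_mul_left (h1.trans ?_) (by positivity : (0 : ℝ) < q ^ 4)
  calc _ ≤ (q : ℝ) ^ 4 * (2 + 1 / m) * b := mul_le_mul_of_nonneg_right h2 hb'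
    _ = _ := by ring

namespace GridData.Ok
variable {G : GridInstance} (h : Ok G.m G.data)
include h

lemma opt_nonneg : 0 ≤ G.opt := by
  classical
  obtain ⟨X, hX, h1⟩ := h.exists_cost_eq_opt
  obtain ⟨Y, hY⟩ := exists_represents hX.subset
  rw [h1, h.cost_eq hY]
  exact Int.natCast_nonneg _

lemma mem_pathRects {l c k j t : ℕ} {i : Fin G.n} (hk : k ≤ depth G.m G.data)
    (hj : j < segNum G.m G.data k i) (ht : cellIdx G.m G.data k i = cellAtTime G.m G.data k t) :
    rect G i k j ∈ G.pathRects ⟨l, c⟩ ↔ isAncestor G.m G.data k t l c = true := by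
  simp only [GridInstance.pathRects, GridInstance.path, GridInstance.cellRects, mem_biUnion,
    mem_filter, mem_univ, true_and, isAncestor, Bool.and_eq_true, decide_eq_true_eq, ← ht]
  constructor
  · rintro ⟨⟨l', c'⟩, ⟨hC, h1, h2⟩, i', hR⟩
    have hl := (h.mem_cells.1 hC).1
    obtain ⟨h3, j', hj', heq⟩ := (h.mem_jobCellRects hl).1 hR
    obtain ⟨rfl, rfl, rfl⟩ := h.rect_inj hk hl hj hj' heq
    simp only at h3
    subst h3
    rw [h.cellBeg_eq, h.cellBeg_eq] at h1
    rw [h.cellEnd_eq, h.cellEnd_eq] at h2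
    omega
  · rintro ⟨h1, h2⟩
    refine ⟨_, ⟨h.jobCell_mem hk, ?_, ?_⟩, i, (h.mem_jobCellRects hk).2 ⟨rfl, j, hj, rfl⟩⟩
    · rw [h.cellBeg_eq, h.cellBeg_eq]; omega
    · rw [h.cellEnd_eq, h.cellEnd_eq]; omega

omit h in
/-- The parts of a feasible set on the paths form a consistent solution. -/
lemma isConsistent {X : Finset (Rect G.n)} (hX : G.Feasible X)
    {χ : Cell → Finset (Finset (Rect G.n))} (hχ : ∀ Q ∈ G.cells, X ∩ G.pathRects Q ∈ χ Q) :
    G.IsConsistent χ X fun Q => X ∩ G.pathRects Q where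
  subset_rects := hX.subset
  mem := hχ
  subset _ _ := inter_subset_left
  covers b t hb ht Q _ hQ := by
    refine (hX.covering b t hb ht).trans (sum_le_sum_of_subset_of_nonneg ?_ fun _ _ _ =>
      Int.natCast_nonneg _)
    intro R hR
    obtain ⟨hRX, ⟨h1, h2⟩, h3, h4⟩ := mem_filter.1 hR
    -- Segment ends are integers, so a segment containing `t` also contains `t + 1/2`, and a job
    -- released from `b` on does not precede the first such job.
    have hray : R ∈ G.rayRects b t := by
      simp only [GridInstance.rayRects, mem_filter]
      refine ⟨hX.subset hRX, ?_⟩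
      obtain ⟨j, hj, hmin⟩ := exists_min_image (univ.filter fun i => b ≤ G.r i) id
        ⟨R.job, by simpa using h1⟩
      have hjR : j ≤ R.job := hmin R.job (by simpa using h1)
      have hjR' : ((j : ℕ) : ℝ) ≤ ((R.job : ℕ) : ℝ) := by exact_mod_cast hjR
      have h3' : (R.beg : ℝ) ≤ t := by exact_mod_cast h3
      have h4' : (t : ℝ) + 1 ≤ R.fin := by exact_mod_cast h4
      refine ⟨((t : ℝ) + 1 / 2, ((R.job : ℕ) : ℝ) + 1 / 2), ⟨⟨?_, ?_⟩, ⟨?_, ?_⟩⟩,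
        j, ⟨by simpa using hj, fun i hi => hmin i (by simpa using hi)⟩, rfl, ?_⟩ <;>
        simp only <;> linarith
    exact mem_inter.2 ⟨mem_inter.2 ⟨hRX, hQ hray⟩, hray⟩
  nested Q _ Q' _ _ R hR := by
    simp only [mem_inter] at hR ⊢
    exact ⟨hR.1.1, hR.2⟩

end GridData.Ok

open GridData in
theorem exists_feasible_program (m A : ℕ) (hm : 2 ≤ m) : ∃ (prog : Program) (c : ℝ),
    ∀ G : GridInstance, G.m = m → G.Valid → G.Normalized A → 2 ≤ G.n * G.P →
      ∃ l : List (Rect G.n), prog.OutputsWithin G.encodeInput (Rect.encodeList l) (G.quasiPoly c) ∧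
        G.Feasible l.toFinset ∧ (G.cost l.toFinset : ℝ) ≤ (2 + 1 / (m : ℝ)) * (G.opt : ℝ) := by
  obtain ⟨prog, c, hprog⟩ := ValidInput.exists_program (A := A) (timeIn_chosenRects m (22 * m))
  refine ⟨prog, c, fun G hGm hv hn hG => ?_⟩
  have h1 := (hprog ⟨G, hGm, hv, hn, hG⟩).1
  subst hGm
  have h := ok_data hv hn
  obtain ⟨f, hf, hX⟩ := h.exists_bestSelections (q := 22 * G.m) (by omega)
  obtain ⟨l, hl, hmem⟩ := h.chosenRects_eq (q := 22 * G.m) _ (fun _ _ => true) hf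
  obtain ⟨h2, h3⟩ := hX l.toFinset fun R => by simp only [List.mem_toFinset, hmem, true_and]
  exact ⟨l, by rw [hl]; exact h1, h2, cost_le_of_mul_le (by omega) rfl h.opt_nonneg h3⟩

-- A single member per path suffices: the part of the computed feasible set that lies on the path.
-- It is produced by restricting the selected rectangles to the ancestors of each cell.
open GridData GridData.Ok in
theorem exists_family_program (m A : ℕ) (hm : 2 ≤ m) : ∃ (prog : Program) (c : ℝ),
    ∀ G : GridInstance, G.m = m → G.Valid → G.Normalized A → 2 ≤ G.n * G.P →
      ∃ χ : Cell → Finset (Finset (Rect G.n)),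
        (∃ d, prog.OutputsWithin G.encodeInput d (G.quasiPoly c) ∧ G.EncodesFamily d χ) ∧
        (∀ Q ∈ G.cells, (∀ X ∈ χ Q, X ⊆ G.pathRects Q) ∧ ((χ Q).card : ℝ) ≤ G.quasiPoly c) ∧
        ∃ R' RQ, G.IsConsistent χ R' RQ ∧
          (G.cost R' : ℝ) ≤ (2 + 1 / (m : ℝ)) * (G.opt : ℝ) := by
  obtain ⟨prog, c, hprog⟩ := ValidInput.exists_program (A := A) (timeIn_chosenFamily m (22 * m))
  refine ⟨prog, c, fun G hGm hv hn hG => ?_⟩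
  obtain ⟨h1, hc⟩ := hprog ⟨G, hGm, hv, hn, hG⟩
  subst hGm
  have h := ok_data hv hn
  obtain ⟨f, hf, hX⟩ := h.exists_bestSelections (q := 22 * G.m) (by omega)
  obtain ⟨l, -, hmem⟩ := h.chosenRects_eq (q := 22 * G.m) _ (fun _ _ => true) hf
  obtain ⟨h2, h3⟩ := hX l.toFinset fun R => by simp only [List.mem_toFinset, hmem, true_and]
  choose L hL hLmem using fun k c => h.chosenRects_eq (q := 22 * G.m) _
    (fun t k' => isAncestor G.m G.data k' t k c) hf
  have hLX : ∀ Q, (L Q.level Q.idx).toFinset = l.toFinset ∩ G.pathRects Q := by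
    intro Q
    ext R
    simp only [List.mem_toFinset, mem_inter, hLmem, hmem, true_and]
    constructor
    · rintro ⟨t, ht, k, hk, i, j, hj, hφ, hs, rfl⟩
      obtain ⟨h4, h5⟩ := lt_segNum_of_selectedAt hs
      exact ⟨⟨t, ht, k, hk, i, j, hj, hs, rfl⟩, (h.mem_pathRects hk h5 h4).2 hφ⟩
    · rintro ⟨⟨t, ht, k, hk, i, j, hj, hs, rfl⟩, hp⟩
      obtain ⟨h4, h5⟩ := lt_segNum_of_selectedAt hs
      exact ⟨t, ht, k, hk, i, j, hj, (h.mem_pathRects hk h5 h4).1 hp, hs, rfl⟩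
  refine ⟨fun Q => {l.toFinset ∩ G.pathRects Q}, ⟨_, h1, ?_⟩, fun Q hQ => ⟨fun X hX' => ?_, ?_⟩,
    l.toFinset, _, isConsistent h2 fun Q _ => mem_singleton_self _,
    cost_le_of_mul_le (by omega) rfl h.opt_nonneg h3⟩
  · refine ⟨(List.range (depth G.m G.data + 1)).flatMap fun k =>
      (List.range (min (base G.m ^ k) (lastTime G.data * base G.m ^ 3))).map fun c =>
        (⟨k, c⟩, [L k c]), ?_, fun Q hQ => ?_, ?_⟩
    · simp only [chosenFamily, code, List.map_flatMap, List.map_map]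
      refine congrArg Data.ofList (List.flatMap_congr fun k _ => List.map_congr_left fun c _ => ?_)
      simp only [Function.comp_apply, List.map_cons, List.map_nil, hL]
      rfl
    · obtain ⟨h4, h5⟩ := h.mem_cells.1 hQ
      refine ⟨(Q, [L Q.level Q.idx]), ?_, rfl⟩
      simp only [List.mem_flatMap, List.mem_map, List.mem_range]
      exact ⟨Q.level, by omega, Q.idx, lt_min h5 (h5.trans_le (h.base_pow_le h4)), rfl⟩
    · intro e he
      simp only [List.mem_flatMap, List.mem_map, List.mem_range] at he
      obtain ⟨k, hk, c, hc, rfl⟩ := he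
      refine ⟨h.mem_cells.2 ⟨by simp only; omega, (lt_min_iff.1 hc).1⟩, fun X => ?_⟩
      have := hLX ⟨k, c⟩
      simp only at this
      simp [← this, eq_comm]
  · rw [mem_singleton.1 hX']; exact inter_subset_right
  · simpa using hc

end FlowTime

theorem mainTheorem8 :
    -- the family `χ` and a cheap consistent solution for it
    (∀ m A : ℕ, 2 ≤ m → ∃ (prog : FlowTime.Program) (c : ℝ),
      ∀ G : FlowTime.GridInstance, G.m = m → G.Valid → G.Normalized A → 2 ≤ G.n * G.P →
        ∃ χ : FlowTime.Cell → Finset (Finset (FlowTime.Rect G.n)),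
          (∃ d, prog.OutputsWithin G.encodeInput d (G.quasiPoly c) ∧ G.EncodesFamily d χ) ∧
          (∀ Q ∈ G.cells, (∀ X ∈ χ Q, X ⊆ G.pathRects Q) ∧ ((χ Q).card : ℝ) ≤ G.quasiPoly c) ∧
          ∃ R' RQ, G.IsConsistent χ R' RQ ∧
            (G.cost R' : ℝ) ≤ (2 + 1 / (m : ℝ)) * (G.opt : ℝ)) ∧
    -- a quasi-polynomial approximation algorithm for the geometric covering problem
    (∀ m A : ℕ, 2 ≤ m → ∃ (prog : FlowTime.Program) (c : ℝ),
      ∀ G : FlowTime.GridInstance, G.m = m → G.Valid → G.Normalized A → 2 ≤ G.n * G.P →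
        ∃ l : List (FlowTime.Rect G.n),
          prog.OutputsWithin G.encodeInput (FlowTime.Rect.encodeList l) (G.quasiPoly c) ∧
          G.Feasible l.toFinset ∧
          (G.cost l.toFinset : ℝ) ≤ (2 + 1 / (m : ℝ)) * (G.opt : ℝ)) ∧
    -- a quasi-polynomial approximation algorithm for weighted flow time
    (∀ (ε : ℝ) (A : ℕ), 0 < ε → ∃ (prog : FlowTime.Program) (c : ℝ),
      ∀ J : FlowTime.JobInstance, J.Normalized A → 2 ≤ J.n * J.P →
        ∃ (L : List (Option (Fin J.n))) (C : Fin J.n → ℝ),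
          prog.OutputsWithin J.encode (J.encodeSlots L) (J.quasiPoly c) ∧
          J.IsSchedule (J.slotSchedule L) C ∧
          J.flowTime C ≤ (2 + ε) * J.optFlowTime) := by
  exact ⟨FlowTime.exists_family_program, FlowTime.exists_feasible_program,
    FlowTime.exists_flowTime_program⟩
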